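/- \textbf{Setting.} Let $F:\emptyset=K_0\subset K_1\subset\cdots\subset K_m=K$ be a simplex-wise filtration of a finite simplicial complex, where $K_{i+1}=K_i\cup\{\sigma_i\}$ for a single new simplex $\sigma_i$. Homology is unreduced with real coefficients. Chains and cochains are identified through the basis $\sigma_0,\dots,\sigma_{m-1}$; $C_p,Z_p,B_p$ (respectively $C^p,Z^p,B^p$) denote chains, cycles, boundaries (cochains, cocycles, coboundaries), $\partial$ is the boundary and $\delta=\partial^{\top}$ (in $K_i$) the coboundary operator, and chains of $K_i$ are viewed as chains of $K$. The $p$-th harmonic chain group is $\mathcal H_p(K_i)=Z_p(K_i)\cap Z^p(K_i)$, and $\mathcal H(K_i)=\bigoplus_p\mathcal H_p(K_i)$. Consecutive groups are comparable under inclusion, so the $\mathcal H_p(K_i)$, $0\le i\le m$, form a zigzag module $\mathcal H_p(F)$ connected by inclusions, and likewise $\mathcal H(F)$. The ($p$-th) harmonic chain barcode of $F$ is the multiset of integer intervals $[b,d]$ in the decomposition of $\mathcal H(F)$ ($\mathcal H_p(F)$) into interval modules. A harmonic $p$-representative of $[b,d]$, $0<b\le d\le m$, is a chain $z$ with $z\in\mathcal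 H_p(K_i)$ for all $i\in[b,d]$, $z\notin\mathcal H_p(K_{b-1})$, and $z\notin\mathcal H_p(K_{d+1})$ if $d<m$; it is a partial representative if the last condition is dropped. A birth index of degree $p$ is an index $b>0$ with $\mathcal H_p(K_{b-1})\subsetneq\mathcal H_p(K_b)$; a death index is a $d<m$ with $\mathcal H_p(K_{d+1})\subsetneq\mathcal H_p(K_d)$. A $p$-pseudo-cochain of $K_i$ is a linear map $\psi:B_p(K_i)\to\mathbb R$; its coboundary is the $(p+1)$-cochain $\psi\circ\partial$. The pivot of a column vector is the largest index of a nonzero entry. The machine model is a real RAM: exact arithmetic and comparison of real numbers, and access to arrays, at unit cost; on natural numbers only constants, successor, predecessor and comparison. The input is the list $\sigma_0,\dots,\sigma_{m-1}$, each given by its increasing list of vertices (natural numbers); all other memory is initially $0$. \textbf{Theorem.} The harmonic chain barcode of $F$, with harmonic representatives, can be computed in $O(m^3)$ time, spending $O(m^2)$ time on each insertion. More precisely, there are an algorithm, consisting of a fixed step executed once for each insertion $K_i\subset K_{i+1}$, $i=0,\dots,m-1$, and a fixed final step, and an absolute constant $C$ such that for every $m$ and every $F$ the following hold. (a) Before the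 step for $K_i\subset K_{i+1}$ (and, for $i=m$, after the last step) the memory holds finished bars $[b,d]$ with $d<i$, each with a degree $p$ and a harmonic $p$-representative, whose ends $d$ in degree $p$ are exactly the death indices of degree $p$ below $i$, and, for every degree $p$, matrices such that: 1. the columns of $\mathtt H^p$ form a basis of $\mathcal H_p(K_i)$, and they are partial $p$-representatives for the intervals $[b,i]$, one for each unpaired birth index $b$, that is, each birth index $b\le i$ of degree $p$ that is not the birth of a finished bar of degree $p$; 2. the columns of $\mathtt R^p$ form a basis of $B_p(K_i)$ with distinct pivots; 3. the columns of $\mathtt{Cob}^p$ form a basis of $B^p(K_i)$; 4. $\mathtt{SC}^p$ has as many columns as $\mathtt{Cob}^{p+1}$, and its $j$-th column encodes, by its values on the basis $\mathtt R^p$, a $p$-pseudo-cochain of $K_i$ whose coboundary is $\mathtt{Cob}^{p+1}[j]$; 5. $\mathtt{BoC}^p$ has as many columns as $\mathtt{Cob}^{p+1}$, $\mathtt{BoC}^p[j]=\partial(\mathtt{Cob}^{p+1}[j])$ for each $j$, and these columns have distinct pivots. (b) Each of the $m$ steps takes at most $C m^2$ time. (c) The whole computation takes at most $C(m^3+1)$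 time, and it outputs a list of intervals with degrees and chains such that for every $p$ the intervals of degree $p$ form the $p$-th harmonic chain barcode of $F$, all the intervals together form the harmonic chain barcode of $F$, and each interval comes with a harmonic representative of its degree. -/

import Mathlib

namespace HarmonicBarcode

noncomputable section

/-! ### Filtrations, chains, cochains and harmonic chains -/

/-- A simplex-wise filtration `∅ = K₀ ⊂ K₁ ⊂ ⋯ ⊂ Kₘ` of abstract simplicial complexes with vertices
in `ℕ`, given by the inserted simplices: `K_{i+1}` is `K_i` together with the new simplex
`simplex i`, all of whose proper faces are already in `K_i`. -/
structure SimplexwiseFiltration (m : ℕ) where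
  simplex : Fin m → Finset ℕ
  nonempty : ∀ i, (simplex i).Nonempty
  injective : Function.Injective simplex
  face_mem : ∀ (i : Fin m) (τ : Finset ℕ), τ.Nonempty → τ ⊂ simplex i → ∃ j < i, simplex j = τ

/-- The chain space of `K = Kₘ` (in all degrees), with the natural basis given by the simplices in
order of insertion; chains and cochains are identified, and chains of `K_i` are the chains
supported on the first `i` simplices. -/
abbrev Chain (m : ℕ) : Type := Fin m → ℝ

/-- The coefficient of `τ` in the boundary of `σ`: it is `(-1)^q` if `τ` is `σ` with its `q`-th vertex
removed (vertices in increasing order, counted from `0`), and `0` otherwise. -/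
def incidence (τ σ : Finset ℕ) : ℝ :=
  ∑ v ∈ σ, if τ = σ.erase v then (-1 : ℝ) ^ (σ.filter (· < v)).card else 0

namespace SimplexwiseFiltration

variable {m : ℕ} (F : SimplexwiseFiltration m)

/-- The simplicial complex `K_i`. -/
def complex (i : ℕ) : PreAbstractSimplicialComplex ℕ where
  faces := {τ | ∃ k : Fin m, (k : ℕ) < i ∧ F.simplex k = τ}
  isRelLowerSet_faces := by
    rintro _ ⟨k, hk, rfl⟩
    refine ⟨F.nonempty k, fun τ hτ hne => ?_⟩
    rcases eq_or_lt_of_le hτ with h | h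
    · exact ⟨k, hk, h.symm⟩
    · obtain ⟨j, hj, hjτ⟩ := F.face_mem k τ hne h
      exact ⟨j, lt_trans (Fin.lt_def.mp hj) hk, hjτ⟩

theorem mem_complex (i : ℕ) (k : Fin m) :
    F.simplex k ∈ (F.complex i).faces ↔ (k : ℕ) < i :=
  ⟨fun ⟨_, hj, h⟩ => F.injective h ▸ hj, fun h => ⟨k, h, rfl⟩⟩

/-- The dimension of the `k`-th simplex. -/
def dim (k : Fin m) : ℕ := (F.simplex k).card - 1

/-- The boundary operator `∂` on `C_*(K)`; it restricts to the boundary operator of every `K_i`. -/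
def boundary : Chain m →ₗ[ℝ] Chain m where
  toFun c := fun k => ∑ l, incidence (F.simplex k) (F.simplex l) * c l
  map_add' c d := by
    funext k; simp only [Pi.add_apply, mul_add, Finset.sum_add_distrib]
  map_smul' a c := by
    funext k
    simp only [Pi.smul_apply, smul_eq_mul, RingHom.id_apply, Finset.mul_sum]
    exact Finset.sum_congr rfl fun l _ => by ring

/-- The coboundary operator `δ` of `K_i`: the transpose of `∂`, restricted to the simplices of
`K_i`. -/
def coboundary (i : ℕ) : Chain m →ₗ[ℝ] Chain m where
  toFun c := fun k =>
    if (k : ℕ) < i then ∑ l, incidence (F.simplex l) (F.simplex k) * c l else 0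
  map_add' c d := by
    funext k
    by_cases h : (k : ℕ) < i
    · simp only [h, if_true, Pi.add_apply, mul_add, Finset.sum_add_distrib]
    · simp [h]
  map_smul' a c := by
    funext k
    by_cases h : (k : ℕ) < i
    · simp only [h, if_true, Pi.smul_apply, smul_eq_mul, RingHom.id_apply, Finset.mul_sum]
      exact Finset.sum_congr rfl fun l _ => by ring
    · simp [h]

/-- `C_p(K_i) = C^p(K_i)`. -/
def chains (i p : ℕ) : Submodule ℝ (Chain m) where
  carrier := {c | ∀ k, c k ≠ 0 → (k : ℕ) < i ∧ F.dim k = p}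
  zero_mem' := fun k h => absurd rfl h
  add_mem' := by
    intro a b ha hb k h
    by_cases h0 : a k = 0
    · exact hb k fun h1 => h (by simp [h0, h1])
    · exact ha k h0
  smul_mem' := by
    intro r a ha k h
    exact ha k fun h1 => h (by simp [h1])

/-- `Z_p(K_i)`. -/
def cycles (i p : ℕ) : Submodule ℝ (Chain m) := F.chains i p ⊓ LinearMap.ker F.boundary

/-- `B_p(K_i)`. -/
def boundaries (i p : ℕ) : Submodule ℝ (Chain m) := (F.chains i (p + 1)).map F.boundary

/-- `Z^p(K_i)`. -/
def cocycles (i p : ℕ) : Submodule ℝ (Chain m) := F.chains i p ⊓ LinearMap.ker (F.coboundary i)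

/-- `B^p(K_i)`. -/
def coboundaries (i : ℕ) : ℕ → Submodule ℝ (Chain m)
  | 0 => ⊥
  | p + 1 => (F.chains i p).map (F.coboundary i)

/-- The `p`-th harmonic chain group of `K_i`. -/
def harmonic (i p : ℕ) : Submodule ℝ (Chain m) := F.cycles i p ⊓ F.cocycles i p

/-- The harmonic chain group of `K_i` in all degrees. -/
def harmonicAll (i : ℕ) : Submodule ℝ (Chain m) := ⨆ p, F.harmonic i p

theorem harmonic_step (i : ℕ) (hi : i < m) :
    (∀ p, F.harmonic i p ≤ F.harmonic (i + 1) p) ∨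
      (∀ p, F.harmonic (i + 1) p ≤ F.harmonic i p) := by
  by_cases hz : ∃ q, ∃ z ∈ F.harmonic (i + 1) q, z ⟨i, hi⟩ ≠ 0
  · obtain ⟨q, z, ⟨⟨hzs, hzb⟩, -⟩, hzi⟩ := hz
    left
    rintro p c ⟨⟨hcs, hcb⟩, -, hcc⟩
    have hs : c ∈ F.chains (i + 1) p := fun k hk => ⟨by have := (hcs k hk).1; omega, (hcs k hk).2⟩
    refine ⟨⟨hs, hcb⟩, hs, ?_⟩
    have hold : ∀ k : Fin m, (k : ℕ) < i →
        ∑ l, incidence (F.simplex l) (F.simplex k) * c l = 0 := by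
      intro k hk
      have h := congrFun (LinearMap.mem_ker.mp hcc) k
      simpa [coboundary, hk] using h
    have hnew : ∑ l, incidence (F.simplex l) (F.simplex ⟨i, hi⟩) * c l = 0 := by
      have h1 : ∑ l, (∑ k, incidence (F.simplex l) (F.simplex k) * z k) * c l = 0 := by
        refine Finset.sum_eq_zero fun l _ => ?_
        have h := congrFun (LinearMap.mem_ker.mp hzb) l
        simp only [boundary, LinearMap.coe_mk, AddHom.coe_mk, Pi.zero_apply] at h
        rw [h, zero_mul]
      have h2 : ∑ k, z k * ∑ l, incidence (F.simplex l) (F.simplex k) * c l = 0 := by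
        rw [← h1]
        simp only [Finset.mul_sum, Finset.sum_mul]
        rw [Finset.sum_comm]
        exact Finset.sum_congr rfl fun l _ => Finset.sum_congr rfl fun k _ => by ring
      rw [Finset.sum_eq_single ⟨i, hi⟩] at h2
      · exact (mul_eq_zero.mp h2).resolve_left hzi
      · intro k _ hk
        by_cases hzk : z k = 0
        · rw [hzk, zero_mul]
        · have h3 := (hzs k hzk).1
          have h4 : (k : ℕ) ≠ i := fun h => hk (Fin.ext h)
          rw [hold k (by omega), mul_zero]
      · intro h; exact absurd (Finset.mem_univ _) h
    refine LinearMap.mem_ker.mpr ?_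
    funext k
    simp only [coboundary, LinearMap.coe_mk, AddHom.coe_mk, Pi.zero_apply]
    split_ifs with hk
    · rcases Nat.lt_succ_iff_lt_or_eq.mp hk with h | h
      · exact hold k h
      · have : k = ⟨i, hi⟩ := Fin.ext h
        rw [this]; exact hnew
    · rfl
  · push Not at hz
    right
    intro p c hc
    have hci := hz p c hc
    obtain ⟨⟨hcs, hcb⟩, -, hcc⟩ := hc
    have hs : c ∈ F.chains i p := by
      intro k hk
      have h3 := (hcs k hk).1
      have h4 : (k : ℕ) ≠ i := fun h => hk (by rw [show k = ⟨i, hi⟩ from Fin.ext h]; exact hci)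
      exact ⟨by omega, (hcs k hk).2⟩
    refine ⟨⟨hs, hcb⟩, hs, ?_⟩
    refine LinearMap.mem_ker.mpr ?_
    funext k
    have h := congrFun (LinearMap.mem_ker.mp hcc) k
    simp only [coboundary, LinearMap.coe_mk, AddHom.coe_mk, Pi.zero_apply] at h ⊢
    split_ifs with hk
    · simpa [Nat.lt_succ_of_lt hk] using h
    · rfl

end SimplexwiseFiltration

/-! ### Zigzag modules and barcodes -/

/-- A zigzag module `V₀ ↔ V₁ ↔ ⋯ ↔ Vₙ` of real vector spaces, where the `i`-th arrow points to the right
if `fwd i` holds and to the left otherwise. -/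
structure ZigzagModule (n : ℕ) (fwd : Fin n → Prop) where
  V : Fin (n + 1) → Type
  instAdd : ∀ i, AddCommGroup (V i)
  instMod : ∀ i, Module ℝ (V i)
  right : ∀ i, fwd i → V i.castSucc →ₗ[ℝ] V i.succ
  left : ∀ i, ¬ fwd i → V i.succ →ₗ[ℝ] V i.castSucc

attribute [instance] ZigzagModule.instAdd ZigzagModule.instMod

namespace ZigzagModule

variable {n : ℕ} {fwd : Fin n → Prop}

/-- Isomorphisms of zigzag modules. -/
structure Iso (M N : ZigzagModule n fwd) where
  equiv : ∀ i, M.V i ≃ₗ[ℝ] N.V i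
  right_comm : ∀ i (h : fwd i) x, equiv i.succ (M.right i h x) = N.right i h (equiv i.castSucc x)
  left_comm : ∀ i (h : ¬ fwd i) x, equiv i.castSucc (M.left i h x) = N.left i h (equiv i.succ x)

/-- The direct sum of finitely many zigzag modules. -/
def directSum {ι : Type} [Fintype ι] (M : ι → ZigzagModule n fwd) : ZigzagModule n fwd where
  V i := ∀ a, (M a).V i
  instAdd _ := inferInstance
  instMod _ := inferInstance
  right i h := LinearMap.pi fun a => (M a).right i h ∘ₗ LinearMap.proj a
  left i h := LinearMap.pi fun a => (M a).left i h ∘ₗ LinearMap.proj a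

/-- The space of the interval module `I[b,d]` at index `i`: it is `ℝ` if `b ≤ i ≤ d`, and `0`
otherwise. -/
def intervalSpace (b d i : ℕ) : Submodule ℝ ℝ where
  carrier := {x | ¬ (b ≤ i ∧ i ≤ d) → x = 0}
  zero_mem' := fun _ => rfl
  add_mem' := fun ha hb h => by rw [ha h, hb h, add_zero]
  smul_mem' := fun r a ha h => by rw [ha h, smul_zero]

/-- The map between two spaces of `I[b,d]`: the identity of `ℝ` if both are `ℝ`, and `0` otherwise. -/
def intervalMap (b d i j : ℕ) : intervalSpace b d i →ₗ[ℝ] intervalSpace b d j where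
  toFun x := ⟨if b ≤ j ∧ j ≤ d then (x : ℝ) else 0, fun h => if_neg h⟩
  map_add' x y := by
    apply Subtype.ext
    by_cases h : b ≤ j ∧ j ≤ d <;> simp [h]
  map_smul' r x := by
    apply Subtype.ext
    by_cases h : b ≤ j ∧ j ≤ d <;> simp [h]

/-- The interval module `I[b,d]`. -/
def intervalModule (fwd : Fin n → Prop) (b d : ℕ) : ZigzagModule n fwd where
  V i := intervalSpace b d i
  instAdd _ := inferInstance
  instMod _ := inferInstance
  right i _ := intervalMap b d i.castSucc i.succ
  left i _ := intervalMap b d i.succ i.castSucc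

/-- `B` is the barcode of `M`: the multiset of the intervals in a decomposition of `M` into interval
modules `I[b,d]`, `0 ≤ b ≤ d ≤ n`. -/
def IsBarcode (M : ZigzagModule n fwd) (B : Multiset (ℕ × ℕ)) : Prop :=
  ∃ (r : ℕ) (I : Fin r → ℕ × ℕ), (Finset.univ : Finset (Fin r)).val.map I = B ∧
    (∀ a, (I a).1 ≤ (I a).2 ∧ (I a).2 ≤ n) ∧
    Nonempty (Iso M (directSum fun a => intervalModule fwd (I a).1 (I a).2))

/-- The zigzag module of a sequence of subspaces in which consecutive ones are comparable, connected
by the inclusions. -/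
def ofSubspaces {W : Type} [AddCommGroup W] [Module ℝ W] (n : ℕ) (S : ℕ → Submodule ℝ W)
    (hS : ∀ i < n, S i ≤ S (i + 1) ∨ S (i + 1) ≤ S i) :
    ZigzagModule n (fun i => S i ≤ S (i + 1)) where
  V i := S i
  instAdd _ := inferInstance
  instMod _ := inferInstance
  right _ h := Submodule.inclusion h
  left i h := Submodule.inclusion ((hS i i.isLt).resolve_left h)

end ZigzagModule

namespace SimplexwiseFiltration

variable {m : ℕ} (F : SimplexwiseFiltration m)

/-- The `p`-th harmonic zigzag module of the filtration. -/
def harmonicZigzag (p : ℕ) :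
    ZigzagModule m (fun i => F.harmonic i p ≤ F.harmonic (i + 1) p) :=
  ZigzagModule.ofSubspaces m (fun i => F.harmonic i p) fun i hi =>
    (F.harmonic_step i hi).imp (fun h => h p) (fun h => h p)

/-- The harmonic zigzag module of the filtration, in all degrees. -/
def harmonicZigzagAll :
    ZigzagModule m (fun i => F.harmonicAll i ≤ F.harmonicAll (i + 1)) :=
  ZigzagModule.ofSubspaces m F.harmonicAll fun i hi =>
    (F.harmonic_step i hi).imp iSup_mono iSup_mono

/-- `z` is a partial harmonic `p`-representative for the interval `[b,e]`: it is harmonic over the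
whole interval and is born at `b`. -/
def IsPartialRep (p b e : ℕ) (z : Chain m) : Prop :=
  0 < b ∧ b ≤ e ∧ e ≤ m ∧ (∀ i, b ≤ i → i ≤ e → z ∈ F.harmonic i p) ∧ z ∉ F.harmonic (b - 1) p

/-- `z` is a harmonic `p`-representative for the interval `[b,d]`: moreover it dies leaving `d`. -/
def IsRep (p b d : ℕ) (z : Chain m) : Prop :=
  F.IsPartialRep p b d z ∧ (d < m → z ∉ F.harmonic (d + 1) p)

/-- The harmonic chain group of degree `p` grows at the index `b`. -/
def IsBirth (p b : ℕ) : Prop := 0 < b ∧ F.harmonic (b - 1) p < F.harmonic b p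

/-- The harmonic chain group of degree `p` shrinks after the index `d`. -/
def IsDeath (p d : ℕ) : Prop := F.harmonic (d + 1) p < F.harmonic d p

theorem boundary_single_mem {i p : ℕ} {k : Fin m} (hk : (k : ℕ) < i ∧ F.dim k = p + 1) :
    F.boundary (Pi.single k 1) ∈ F.boundaries i p := by
  refine Submodule.mem_map_of_mem fun l hl => ?_
  have : l = k := by
    by_contra h
    exact hl (by simp [h])
  rw [this]; exact hk

open Classical in
/-- The coboundary in `K_i` of a `p`-pseudo-cochain `ψ : B_p(K_i) → ℝ`: the `(p+1)`-cochain `ψ ∘ ∂`. -/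
def pseudoCoboundary (i p : ℕ) (ψ : F.boundaries i p →ₗ[ℝ] ℝ) : Chain m := fun k =>
  if hk : (k : ℕ) < i ∧ F.dim k = p + 1 then
    ψ ⟨F.boundary (Pi.single k 1), F.boundary_single_mem hk⟩
  else 0

end SimplexwiseFiltration

/-- The family `v` is a basis of the subspace `S`. -/
def IsBasisOf {m : ℕ} {ι : Type} (v : ι → Chain m) (S : Submodule ℝ (Chain m)) : Prop :=
  LinearIndependent ℝ v ∧ Submodule.span ℝ (Set.range v) = S

/-- `k` is the pivot of `c`, the index of its lowest nonzero entry when `c` is written as a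
column. -/
def IsPivot {m : ℕ} (c : Chain m) (k : Fin m) : Prop := c k ≠ 0 ∧ ∀ l, k < l → c l = 0

/-- The columns have pivots, and these are distinct. -/
def HasDistinctPivots {m : ℕ} {ι : Type} (v : ι → Chain m) : Prop :=
  ∃ f : ι → Fin m, Function.Injective f ∧ ∀ a, IsPivot (v a) (f a)

/-! ### The machine model: a real RAM with arrays

Programs of a while-language act on arrays of natural numbers and arrays of real numbers. The cost of
a run is the number of elementary operations performed. On natural numbers (used as indices,
counters and labels) there are only constants, successor, predecessor and comparison, so that in time
`t` no value grows by more than `t` beyond the input values and the constants in the program. On real numbers there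
is exact arithmetic, with comparison. -/

/-- Names of the arrays of natural numbers. -/
inductive NatArray where
  /-- input: entry `(i,q)` is the `q`-th vertex of the `i`-th simplex -/
  | vertex
  /-- input: entry `(i,0)` is the number of vertices of the `i`-th simplex -/
  | numVertices
  /-- input: entry `(0,0)` is the number of insertions -/
  | size
  /-- entry `(0,0)` is the number of insertions processed so far -/
  | iter
  /-- number of columns of the matrices H (in all degrees) -/
  | numH
  /-- entry `(j,0)` is the degree of the `j`-th column of H -/
  | degH
  /-- entry `(j,0)` is the unpaired birth index of the `j`-th column of H -/
  | birthH
  /-- number of columns of the matrices R (in all degrees) -/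
  | numR
  /-- entry `(j,0)` is the degree of the `j`-th column of R -/
  | degR
  /-- number of columns of the matrices Cob (in all degrees) -/
  | numCob
  /-- entry `(j,0)` is the degree of the `j`-th column of Cob -/
  | degCob
  /-- number of finished bars -/
  | numBars
  /-- entry `(l,0)` is the degree of the `l`-th bar -/
  | degBar
  /-- entry `(l,0)` is the birth index of the `l`-th bar -/
  | birthBar
  /-- entry `(l,0)` is the death index of the `l`-th bar -/
  | deathBar
  /-- working memory -/
  | scratch (k : ℕ)
  deriving DecidableEq

/-- Names of the arrays of real numbers; entry `(j,k)` of a matrix is the `k`-th entry of its `j`-th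
column. -/
inductive RealArray where
  | matH
  | matR
  | matCob
  | matSC
  | matBoC
  /-- the representatives of the finished bars -/
  | repBar
  /-- working memory -/
  | scratch (k : ℕ)
  deriving DecidableEq

/-- The contents of the memory. -/
structure State where
  nat : NatArray → ℕ → ℕ → ℕ
  real : RealArray → ℕ → ℕ → ℝ

/-- Expressions with values in `ℕ`. -/
inductive NatExpr where
  | const (c : ℕ)
  | get (a : NatArray) (i j : NatExpr)
  | succ (e : NatExpr)
  | pred (e : NatExpr)

namespace NatExpr

def eval (s : State) : NatExpr → ℕ
  | const c => c
  | get a i j => s.nat a (i.eval s) (j.eval s)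
  | succ e => e.eval s + 1
  | pred e => e.eval s - 1

/-- The number of elementary operations in an evaluation. -/
def cost : NatExpr → ℕ
  | const _ => 1
  | get _ i j => i.cost + j.cost + 1
  | succ e => e.cost + 1
  | pred e => e.cost + 1

end NatExpr

/-- Expressions with values in `ℝ`; a division by zero has the value `0`. -/
inductive RealExpr where
  | const (c : ℤ)
  | get (a : RealArray) (i j : NatExpr)
  | add (x y : RealExpr)
  | sub (x y : RealExpr)
  | mul (x y : RealExpr)
  | div (x y : RealExpr)

namespace RealExpr

def eval (s : State) : RealExpr → ℝ
  | const c => c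
  | get a i j => s.real a (i.eval s) (j.eval s)
  | add x y => x.eval s + y.eval s
  | sub x y => x.eval s - y.eval s
  | mul x y => x.eval s * y.eval s
  | div x y => x.eval s / y.eval s

def cost : RealExpr → ℕ
  | const _ => 1
  | get _ i j => i.cost + j.cost + 1
  | add x y => x.cost + y.cost + 1
  | sub x y => x.cost + y.cost + 1
  | mul x y => x.cost + y.cost + 1
  | div x y => x.cost + y.cost + 1

end RealExpr

/-- Conditions. -/
inductive Test where
  | natLt (x y : NatExpr)
  | natEq (x y : NatExpr)
  | realLt (x y : RealExpr)
  | realEq (x y : RealExpr)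
  | neg (b : Test)
  | and (b c : Test)

namespace Test

def Holds (s : State) : Test → Prop
  | natLt x y => x.eval s < y.eval s
  | natEq x y => x.eval s = y.eval s
  | realLt x y => x.eval s < y.eval s
  | realEq x y => x.eval s = y.eval s
  | neg b => ¬ b.Holds s
  | and b c => b.Holds s ∧ c.Holds s

def cost : Test → ℕ
  | natLt x y => x.cost + y.cost + 1
  | natEq x y => x.cost + y.cost + 1
  | realLt x y => x.cost + y.cost + 1
  | realEq x y => x.cost + y.cost + 1
  | neg b => b.cost + 1
  | and b c => b.cost + c.cost + 1

end Test

/-- Programs. -/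
inductive Cmd where
  | skip
  /-- `a[i,j] := e` -/
  | setNat (a : NatArray) (i j e : NatExpr)
  /-- `a[i,j] := e` -/
  | setReal (a : RealArray) (i j : NatExpr) (e : RealExpr)
  | seq (P Q : Cmd)
  | ite (b : Test) (P Q : Cmd)
  /-- `while b do P` -/
  | loop (b : Test) (P : Cmd)

namespace State

/-- The memory after writing `x` to `a[i,j]`. -/
def setNat (s : State) (a : NatArray) (i j x : ℕ) : State where
  nat a' i' j' := if a' = a ∧ i' = i ∧ j' = j then x else s.nat a' i' j'
  real := s.real

/-- The memory after writing `x` to `a[i,j]`. -/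
def setReal (s : State) (a : RealArray) (i j : ℕ) (x : ℝ) : State where
  nat := s.nat
  real a' i' j' := if a' = a ∧ i' = i ∧ j' = j then x else s.real a' i' j'

end State

/-- `Exec P s t s'`: the program `P`, started with memory `s`, halts after `t` elementary operations
with memory `s'`. -/
inductive Exec : Cmd → State → ℕ → State → Prop where
  | skip (s : State) : Exec .skip s 1 s
  | setNat (s : State) (a : NatArray) (i j e : NatExpr) :
      Exec (.setNat a i j e) s (i.cost + j.cost + e.cost + 1)
        (s.setNat a (i.eval s) (j.eval s) (e.eval s))
  | setReal (s : State) (a : RealArray) (i j : NatExpr) (e : RealExpr) :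
      Exec (.setReal a i j e) s (i.cost + j.cost + e.cost + 1)
        (s.setReal a (i.eval s) (j.eval s) (e.eval s))
  | seq {P Q : Cmd} {s s' s'' : State} {t t' : ℕ} :
      Exec P s t s' → Exec Q s' t' s'' → Exec (.seq P Q) s (t + t') s''
  | ite_true {b : Test} {P Q : Cmd} {s s' : State} {t : ℕ} :
      b.Holds s → Exec P s t s' → Exec (.ite b P Q) s (b.cost + t) s'
  | ite_false {b : Test} {P Q : Cmd} {s s' : State} {t : ℕ} :
      ¬ b.Holds s → Exec Q s t s' → Exec (.ite b P Q) s (b.cost + t) s'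
  | loop_true {b : Test} {P : Cmd} {s s' s'' : State} {t t' : ℕ} :
      b.Holds s → Exec P s t s' → Exec (.loop b P) s' t' s'' →
        Exec (.loop b P) s (b.cost + t + t') s''
  | loop_false {b : Test} {P : Cmd} {s : State} :
      ¬ b.Holds s → Exec (.loop b P) s b.cost s

/-- A program and an initial memory determine the run. -/
theorem Exec.unique {P : Cmd} {s s₁ : State} {t₁ : ℕ} (h : Exec P s t₁ s₁) :
    ∀ {t₂ : ℕ} {s₂ : State}, Exec P s t₂ s₂ → t₁ = t₂ ∧ s₁ = s₂ := by
  induction h with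
  | skip => intro _ _ h; cases h; simp
  | setNat => intro _ _ h; cases h; simp
  | setReal => intro _ _ h; cases h; simp
  | seq _ _ i1 i2 =>
    intro _ _ h
    cases h with
    | seq a b => obtain ⟨rfl, rfl⟩ := i1 a; obtain ⟨rfl, rfl⟩ := i2 b; simp
  | ite_true hb _ i =>
    intro _ _ h
    cases h with
    | ite_true _ a => obtain ⟨rfl, rfl⟩ := i a; simp
    | ite_false n _ => exact absurd hb n
  | ite_false hb _ i =>
    intro _ _ h
    cases h with
    | ite_false _ a => obtain ⟨rfl, rfl⟩ := i a; simp
    | ite_true n _ => exact absurd n hb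
  | loop_true hb _ _ i1 i2 =>
    intro _ _ h
    cases h with
    | loop_true _ a b => obtain ⟨rfl, rfl⟩ := i1 a; obtain ⟨rfl, rfl⟩ := i2 b; simp
    | loop_false n => exact absurd hb n
  | loop_false hb =>
    intro _ _ h
    cases h with
    | loop_true n => exact absurd n hb
    | loop_false => simp

/-- The initial memory: the list of the inserted simplices, each as the increasing list of its
vertices, and zeros elsewhere. -/
def inputState {m : ℕ} (F : SimplexwiseFiltration m) : State where
  nat
    | .vertex, i, q => if h : i < m then ((F.simplex ⟨i, h⟩).sort (· ≤ ·)).getD q 0 else 0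
    | .numVertices, i, 0 => if h : i < m then (F.simplex ⟨i, h⟩).card else 0
    | .size, 0, 0 => m
    | _, _, _ => 0
  real _ _ _ := 0

/-! ### What the algorithm maintains and returns -/

namespace State

variable (s : State)

/-- The `j`-th column of a matrix, read as a chain of a filtration of size `m`. -/
def col (a : RealArray) (m j : ℕ) : Chain m := fun k => s.real a j k

/-- Positions of the columns of degree `p` of H. -/
abbrev IdxH (p : ℕ) : Type := {j : ℕ // j < s.nat .numH 0 0 ∧ s.nat .degH j 0 = p}

/-- Positions of the columns of degree `p` of R. -/
abbrev IdxR (p : ℕ) : Type := {j : ℕ // j < s.nat .numR 0 0 ∧ s.nat .degR j 0 = p}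

/-- Positions of the columns of degree `p` of Cob; the same positions are those of the columns of
degree `p - 1` of SC and of BoC. -/
abbrev IdxCob (p : ℕ) : Type := {j : ℕ // j < s.nat .numCob 0 0 ∧ s.nat .degCob j 0 = p}

/-- The list of finished bars contains `[b,d]` in degree `p` at position `l`. -/
def IsBar (l p b d : ℕ) : Prop :=
  l < s.nat .numBars 0 0 ∧ s.nat .degBar l 0 = p ∧ s.nat .birthBar l 0 = b ∧ s.nat .deathBar l 0 = d

/-- The multiset of finished bars in all degrees. -/
def barsAll : Multiset (ℕ × ℕ) :=
  (Multiset.range (s.nat .numBars 0 0)).map fun l => (s.nat .birthBar l 0, s.nat .deathBar l 0)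

/-- The multiset of finished bars of degree `p`. -/
def bars (p : ℕ) : Multiset (ℕ × ℕ) :=
  ((Multiset.range (s.nat .numBars 0 0)).filter fun l => s.nat .degBar l 0 = p).map
    fun l => (s.nat .birthBar l 0, s.nat .deathBar l 0)

end State

/-- The properties of the data in memory when the first `i` insertions have been processed. For every
degree `p`, the matrix `Hᵖ`, `Rᵖ` or `Cobᵖ` consists of the columns tagged with `p`; the columns of
`SCᵖ` and `BoCᵖ` correspond to those of `Cobᵖ⁺¹`; the entries of a column of `SCᵖ` are indexed by the
columns of `Rᵖ`. -/
structure Maintained {m : ℕ} (F : SimplexwiseFiltration m) (i : ℕ) (s : State) : Prop where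
  size_eq : s.nat .size 0 0 = m
  iter_eq : s.nat .iter 0 0 = i
  /-- each bar finished so far ends at a death index before `i` and has a representative -/
  bar_rep : ∀ l p b d, s.IsBar l p b d → d < i ∧ F.IsRep p b d (s.col .repBar m l)
  /-- the death indices before `i` are exactly those paired so far -/
  paired_deaths : ∀ p d, (∃ l b, s.IsBar l p b d) ↔ d < i ∧ F.IsDeath p d
  /-- the birth indices attached to the columns of `Hᵖ` are the birth indices that are not paired -/
  unpaired_births : ∀ p b, (∃ j : s.IdxH p, s.nat .birthH j 0 = b) ↔
    (b ≤ i ∧ F.IsBirth p b) ∧ ¬ ∃ l d, s.IsBar l p b d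
  birth_injective : ∀ p, Function.Injective fun j : s.IdxH p => s.nat .birthH j 0
  /-- each column of `Hᵖ` is a partial representative for its birth index -/
  H_rep : ∀ p (j : s.IdxH p), F.IsPartialRep p (s.nat .birthH j 0) i (s.col .matH m j)
  H_basis : ∀ p, IsBasisOf (fun j : s.IdxH p => s.col .matH m j) (F.harmonic i p)
  R_basis : ∀ p, IsBasisOf (fun j : s.IdxR p => s.col .matR m j) (F.boundaries i p)
  R_pivots : ∀ p, HasDistinctPivots fun j : s.IdxR p => s.col .matR m j
  Cob_basis : ∀ p, IsBasisOf (fun j : s.IdxCob p => s.col .matCob m j) (F.coboundaries i p)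
  /-- each column of `SCᵖ` encodes, with respect to the basis `Rᵖ`, a pseudo-cochain whose coboundary
  is the corresponding column of `Cobᵖ⁺¹` -/
  SC_encodes : ∀ p (j : s.IdxCob (p + 1)), ∃ ψ : F.boundaries i p →ₗ[ℝ] ℝ,
    (∀ (l : s.IdxR p) (h : s.col .matR m l ∈ F.boundaries i p),
      ψ ⟨s.col .matR m l, h⟩ = s.real .matSC j l) ∧
    s.col .matCob m j = F.pseudoCoboundary i p ψ
  BoC_eq : ∀ p (j : s.IdxCob (p + 1)), s.col .matBoC m j = F.boundary (s.col .matCob m j)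
  BoC_pivots : ∀ p, HasDistinctPivots fun j : s.IdxCob (p + 1) => s.col .matBoC m j

/-- The list of bars in memory is the harmonic chain barcode of `F`, in every degree and in total, and
each bar comes with a harmonic representative. -/
structure IsOutput {m : ℕ} (F : SimplexwiseFiltration m) (s : State) : Prop where
  barcode : ∀ p, (F.harmonicZigzag p).IsBarcode (s.bars p)
  barcodeAll : F.harmonicZigzagAll.IsBarcode s.barsAll
  rep : ∀ l p b d, s.IsBar l p b d → F.IsRep p b d (s.col .repBar m l)

/-- The program that runs `step` once for each insertion and then `final`. -/
def mainProgram (step final : Cmd) : Cmd :=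
  .seq (.loop (.natLt (.get .iter (.const 0) (.const 0)) (.get .size (.const 0) (.const 0))) step)
    final

end

end HarmonicBarcode

namespace HarmonicBarcode

noncomputable section

/-! ### Incidence numbers and the boundary operator -/

/-! Over the reals, with the standard inner product, the chains of K_i split orthogonally into the
cycles and the coboundaries. The harmonic chains are the cycles orthogonal to the boundaries, and ∂
maps the coboundaries isomorphically onto the boundaries. All degrees are handled together (`cyc`,
`bd`, `harm`, `cob`); every stored chain is homogeneous, so the statements about a single degree can
be read off at the end.

The memory holds a basis Cob of the coboundaries whose boundaries BoC have distinct pivots. By the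
isomorphism above, R can be BoC itself, and SC can be the Gram matrix of Cob: if δφ = Cob[j], then φ
takes on R[l] = ∂Cob[l] the value ⟨Cob[j], Cob[l]⟩. The columns of H are ordered by birth, and the
pivot of each is the simplex inserted at its birth.

When σ_i arrives, ∂σ_i is reduced at the pivots of BoC, with the same operations on Cob. The result
is a chain x that differs from σ_i by a coboundary of K_i and whose boundary vanishes at all pivots
(`IsReduced`). Such an x is orthogonal to all cycles of K_i, hence to all boundaries of K_{i+1}.

If ∂x = 0, then x is a new harmonic chain and the harmonic group grows by its line. The coboundaries
now have to be orthogonal to x as well; projecting Cob away from x leaves BoC unchanged and changes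
the Gram matrix by a term of rank one.

If ∂x ≠ 0, then ∂x is not a boundary of K_i, because its entries at the pivots are zero. No cycle is
created, x joins Cob, and the new harmonic group is the hyperplane of those h with ⟨h, ∂x⟩ = 0. The
earliest born column of H off this hyperplane ends its bar. Multiples of it bring the later columns
into the hyperplane; they do not change the births, since an earlier born chain has a smaller pivot.
This is `harmInv_of_boundary_ne_zero`.

The bars so obtained form the barcode because their representatives are fixed vectors, independent
by their pivots, and those alive at i form a basis of the harmonic group of K_i (`BarList.mem_span`,
`isBarcode_ofSubspaces`). For the time bound, the step is written with loops over m entries nested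
at most twice (`exec_compile`); finding the column with a given pivot is a single array access, and
each incidence number takes one pass over two sorted vertex lists. -/

theorem exists_eq_erase_of_incidence_ne_zero {τ σ : Finset ℕ} (h : incidence τ σ ≠ 0) :
    ∃ v ∈ σ, τ = σ.erase v := by
  obtain ⟨v, hv, h⟩ := Finset.exists_ne_zero_of_sum_ne_zero h
  exact ⟨v, hv, by by_contra hne; exact h (if_neg hne)⟩

/-- Erasing v changes the number of vertices before u exactly when v < u; this sign change is the
source of ∂∂ = 0. -/
theorem neg_one_pow_card_filter_erase {σ : Finset ℕ} {u v : ℕ} (hv : v ∈ σ) :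
    (-1 : ℝ) ^ ((σ.erase v).filter (· < u)).card =
      (if v < u then -1 else 1) * (-1 : ℝ) ^ (σ.filter (· < u)).card := by
  rw [Finset.filter_erase]
  split_ifs with h
  · have hm : v ∈ σ.filter (· < u) := Finset.mem_filter.mpr ⟨hv, h⟩
    rw [← Finset.card_erase_add_one hm, pow_succ]; ring
  · rw [Finset.erase_eq_of_notMem (by simp [h]), one_mul]

/-- Erasing v and then u gives the same face as erasing u and then v, with the opposite sign, so the
double sum equals its own negative. -/
theorem sum_incidence_mul_erase (τ σ : Finset ℕ) :
    ∑ v ∈ σ, (-1 : ℝ) ^ (σ.filter (· < v)).card * incidence τ (σ.erase v) = 0 := by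
  set f : ℕ → ℕ → ℝ := fun v u => (-1 : ℝ) ^ (σ.filter (· < v)).card *
    (if τ = (σ.erase v).erase u then (-1 : ℝ) ^ ((σ.erase v).filter (· < u)).card else 0) with hf
  have hanti : ∀ v ∈ σ, ∀ u ∈ σ.erase v, f v u = - f u v := by
    intro v hv u hu
    obtain ⟨huv, hu⟩ := Finset.mem_erase.mp hu
    simp only [hf]
    rw [Finset.erase_right_comm]
    split_ifs with h
    · rw [neg_one_pow_card_filter_erase hv, neg_one_pow_card_filter_erase hu]
      rcases lt_or_gt_of_ne huv with h | h
      · rw [if_neg (by omega), if_pos h]; ring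
      · rw [if_pos h, if_neg (by omega)]; ring
    · simp
  have h1 : ∑ v ∈ σ, (-1 : ℝ) ^ (σ.filter (· < v)).card * incidence τ (σ.erase v) =
      ∑ v ∈ σ, ∑ u ∈ σ.erase v, f v u := by
    refine Finset.sum_congr rfl fun v _ => ?_
    rw [incidence, Finset.mul_sum]
  have h2 : ∑ v ∈ σ, ∑ u ∈ σ.erase v, f v u = ∑ u ∈ σ, ∑ v ∈ σ.erase u, f v u :=
    Finset.sum_comm' fun x y => by simp only [Finset.mem_erase]; tauto
  have h3 : ∑ v ∈ σ, ∑ u ∈ σ.erase v, f v u = - ∑ v ∈ σ, ∑ u ∈ σ.erase v, f v u := by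
    conv_lhs => rw [h2]
    rw [← Finset.sum_neg_distrib]
    refine Finset.sum_congr rfl fun u hu => ?_
    rw [← Finset.sum_neg_distrib]
    refine Finset.sum_congr rfl fun v hv => ?_
    obtain ⟨hvu, hv⟩ := Finset.mem_erase.mp hv
    exact hanti v hv u (Finset.mem_erase.mpr ⟨fun h => hvu h.symm, hu⟩)
  rw [h1]; linarith

theorem incidence_empty (τ : Finset ℕ) : incidence τ ∅ = 0 := by simp [incidence]

namespace SimplexwiseFiltration

variable {m : ℕ} (F : SimplexwiseFiltration m)

theorem card_eq_dim_add_one (k : Fin m) : (F.simplex k).card = F.dim k + 1 := by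
  have := (F.nonempty k).card_pos
  unfold dim; omega

theorem lt_of_incidence_ne_zero {k l : Fin m} (h : incidence (F.simplex k) (F.simplex l) ≠ 0) :
    k < l ∧ F.dim k + 1 = F.dim l := by
  obtain ⟨v, hv, he⟩ := exists_eq_erase_of_incidence_ne_zero h
  have hss : F.simplex k ⊂ F.simplex l := he ▸ Finset.erase_ssubset hv
  obtain ⟨j, hj, hjk⟩ := F.face_mem l _ (F.nonempty k) hss
  refine ⟨F.injective hjk ▸ hj, ?_⟩
  have h1 := Finset.card_erase_add_one hv
  rw [← he] at h1
  have h2 := F.card_eq_dim_add_one k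
  have h3 := F.card_eq_dim_add_one l
  omega

theorem boundary_apply (x : Chain m) (k : Fin m) :
    F.boundary x k = ∑ l, incidence (F.simplex k) (F.simplex l) * x l := rfl

theorem boundary_single_apply (k l : Fin m) :
    F.boundary (Pi.single l 1) k = incidence (F.simplex k) (F.simplex l) := by
  rw [boundary_apply, Finset.sum_eq_single l] <;> simp +contextual

theorem sum_incidence_mul_incidence (k j : Fin m) :
    ∑ l, incidence (F.simplex k) (F.simplex l) * incidence (F.simplex l) (F.simplex j) = 0 := by
  rw [← sum_incidence_mul_erase (F.simplex k) (F.simplex j)]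
  simp only [incidence.eq_1 _ (F.simplex j), Finset.mul_sum]
  rw [Finset.sum_comm]
  refine Finset.sum_congr rfl fun v hv => ?_
  by_cases hne : ((F.simplex j).erase v).Nonempty
  · obtain ⟨l, -, hl⟩ := F.face_mem j _ hne (Finset.erase_ssubset hv)
    rw [Finset.sum_eq_single l]
    · rw [if_pos hl, hl, mul_comm]
    · intro l' _ hl'
      rw [if_neg fun h => hl' (F.injective (h.trans hl.symm)), mul_zero]
    · simp
  -- The facet of a vertex is empty and is not in the filtration. In unreduced homology it
  -- contributes zero to both sides.
  · rw [Finset.not_nonempty_iff_eq_empty.mp hne, incidence_empty, mul_zero]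
    refine Finset.sum_eq_zero fun l _ => ?_
    rw [if_neg (F.nonempty l).ne_empty, mul_zero]

theorem boundary_boundary (x : Chain m) : F.boundary (F.boundary x) = 0 := by
  funext k
  simp only [boundary_apply, Finset.mul_sum, Pi.zero_apply]
  rw [Finset.sum_comm]
  refine Finset.sum_eq_zero fun j _ => ?_
  rw [← zero_mul (x j), ← F.sum_incidence_mul_incidence k j, Finset.sum_mul]
  exact Finset.sum_congr rfl fun l _ => by ring

end SimplexwiseFiltration

/-! ### Supports, degrees and orthogonality -/

/-- The vectors supported on the first `i` coordinates. -/
def supp (m i : ℕ) : Submodule ℝ (Chain m) where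
  carrier := {x | ∀ k : Fin m, i ≤ k → x k = 0}
  zero_mem' _ _ := rfl
  add_mem' ha hb k h := by rw [Pi.add_apply, ha k h, hb k h, add_zero]
  smul_mem' r a ha k h := by rw [Pi.smul_apply, ha k h, smul_zero]

/-- The vectors orthogonal to `U`. -/
def perp {m : ℕ} (U : Submodule ℝ (Chain m)) : Submodule ℝ (Chain m) where
  carrier := {x | ∀ y ∈ U, x ⬝ᵥ y = 0}
  zero_mem' _ _ := zero_dotProduct _
  add_mem' ha hb y h := by rw [add_dotProduct, ha y h, hb y h, add_zero]
  smul_mem' r a ha y h := by rw [smul_dotProduct, ha y h, smul_zero]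

theorem supp_mono {m i j : ℕ} (h : i ≤ j) : supp m i ≤ supp m j := fun _ hx k hk => hx k (h.trans hk)

/-- Orthogonal projection onto U, transported from `EuclideanSpace`, whose inner product is the dot
product. -/
theorem exists_sub_mem_perp {m : ℕ} (U : Submodule ℝ (Chain m)) (x : Chain m) :
    ∃ u ∈ U, x - u ∈ perp U := by
  let e := WithLp.linearEquiv 2 ℝ (Fin m → ℝ)
  let U' : Submodule ℝ (EuclideanSpace ℝ (Fin m)) := U.comap e.toLinearMap
  obtain ⟨y, hy, z, hz, h⟩ := U'.exists_add_mem_mem_orthogonal (e.symm x)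
  refine ⟨e y, hy, fun v hv => ?_⟩
  have hz' : x - e y = e z := by
    rw [← e.apply_symm_apply x, h, map_add, add_sub_cancel_left]
  have hi := (Submodule.mem_orthogonal' U' z).mp hz (e.symm v) (by simpa [U'] using hv)
  rw [hz', dotProduct_comm]
  simp only [EuclideanSpace.inner_eq_star_dotProduct, star_trivial] at hi
  exact hi

theorem dotProduct_eq_zero_of_mem_span {m : ℕ} {S : Set (Chain m)} {x y : Chain m}
    (hS : ∀ v ∈ S, v ⬝ᵥ y = 0) (hx : x ∈ Submodule.span ℝ S) : x ⬝ᵥ y = 0 := by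
  induction hx using Submodule.span_induction with
  | mem v hv => exact hS v hv
  | zero => exact zero_dotProduct _
  | add a b _ _ ha hb => rw [add_dotProduct, ha, hb, add_zero]
  | smul r a _ ha => rw [smul_dotProduct, ha, smul_zero]

theorem dotProduct_self_pos {m : ℕ} {x : Chain m} {k : Fin m} (h : x k ≠ 0) : x ⬝ᵥ x ≠ 0 := by
  intro h0
  exact h (congrFun (dotProduct_self_eq_zero.mp h0) k)

theorem sub_single_mem_supp {m i : ℕ} (hi : i < m) {x y : Chain m} (hx : x ∈ supp m (i + 1))
    (hx1 : x ⟨i, hi⟩ = 1) (hy : y ∈ supp m (i + 1)) : y - y ⟨i, hi⟩ • x ∈ supp m i := by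
  intro k hk
  rcases hk.eq_or_lt with h | h
  · have : k = ⟨i, hi⟩ := Fin.ext h.symm
    rw [this, Pi.sub_apply, Pi.smul_apply, hx1, smul_eq_mul, mul_one, sub_self]
  · rw [Pi.sub_apply, Pi.smul_apply, hx k h, hy k h, smul_zero, sub_zero]

/-- A combination of vectors with distinct pivots that vanishes at all the pivots is zero. -/
theorem eq_zero_of_combination_pivots {m n : ℕ} {v : ℕ → Chain m} {pv : ℕ → Fin m}
    (hp : ∀ j < n, IsPivot (v j) (pv j)) (hinj : ∀ j < n, ∀ j' < n, pv j = pv j' → j = j')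
    {c : ℕ → ℝ} (h0 : ∀ j < n, (∑ l ∈ Finset.range n, c l • v l) (pv j) = 0) :
    ∀ j < n, c j = 0 := by
  by_contra! hne
  obtain ⟨j₀, hj₀, hc₀⟩ := hne
  have hs : ((Finset.range n).filter fun j => c j ≠ 0).Nonempty :=
    ⟨j₀, by simp [hj₀, hc₀]⟩
  -- Among the terms with nonzero coefficient take the one with the largest pivot. At that entry all
  -- the other terms vanish, so the sum cannot be zero there.
  obtain ⟨j, hj, hmax⟩ := Finset.exists_max_image _ pv hs
  obtain ⟨hjn, hcj⟩ := Finset.mem_filter.mp hj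
  have hjn' := Finset.mem_range.mp hjn
  have h := h0 j hjn'
  rw [Finset.sum_apply, Finset.sum_eq_single j] at h
  · exact (mul_ne_zero hcj (hp j hjn').1) h
  · intro l hl hlj
    have hl' := Finset.mem_range.mp hl
    rw [Pi.smul_apply, smul_eq_mul]
    by_cases hcl : c l = 0
    · rw [hcl, zero_mul]
    · have hle := hmax l (Finset.mem_filter.mpr ⟨hl, hcl⟩)
      have hlt : pv l < pv j := lt_of_le_of_ne hle fun he => hlj (hinj l hl' j hjn' he)
      rw [(hp l hl').2 _ hlt, mul_zero]
  · intro h; exact absurd hjn h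

theorem linearIndependent_of_pivots {m : ℕ} {ι : Type} {v : ι → Chain m}
    (h : HasDistinctPivots v) : LinearIndependent ℝ v := by
  obtain ⟨f, hinj, hp⟩ := h
  rw [linearIndependent_iff']
  intro s c h0
  by_contra! hne
  obtain ⟨j₀, hj₀, hc₀⟩ := hne
  have hs : (s.filter fun j => c j ≠ 0).Nonempty := ⟨j₀, by simp [hj₀, hc₀]⟩
  obtain ⟨j, hj, hmax⟩ := Finset.exists_max_image _ f hs
  obtain ⟨hjs, hcj⟩ := Finset.mem_filter.mp hj
  have h := congrFun h0 (f j)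
  rw [Finset.sum_apply, Finset.sum_eq_single j] at h
  · exact (mul_ne_zero hcj (hp j).1) h
  · intro l hl hlj
    rw [Pi.smul_apply, smul_eq_mul]
    by_cases hcl : c l = 0
    · rw [hcl, zero_mul]
    · have hlt : f l < f j := lt_of_le_of_ne (hmax l (Finset.mem_filter.mpr ⟨hl, hcl⟩))
        fun he => hlj (hinj he)
      rw [(hp l).2 _ hlt, mul_zero]
  · intro h; exact absurd hjs h

theorem mem_span_image_Iio {m n : ℕ} {v : ℕ → Chain m} {x : Chain m}
    (hx : x ∈ Submodule.span ℝ (v '' Set.Iio n)) : ∃ c : ℕ → ℝ, x = ∑ l ∈ Finset.range n, c l • v l := by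
  induction hx using Submodule.span_induction with
  | mem y hy =>
    obtain ⟨j, hj, rfl⟩ := hy
    refine ⟨Pi.single j 1, ?_⟩
    rw [Finset.sum_eq_single j]
    · simp
    · intro b _ hb; simp [hb]
    · intro h; exact absurd (Finset.mem_range.mpr hj) h
  | zero => exact ⟨0, by simp⟩
  | add a b _ _ ha hb =>
    obtain ⟨c, rfl⟩ := ha
    obtain ⟨d, rfl⟩ := hb
    exact ⟨c + d, by simp [add_smul, Finset.sum_add_distrib]⟩
  | smul r a _ ha =>
    obtain ⟨c, rfl⟩ := ha
    exact ⟨r • c, by simp [Finset.smul_sum, mul_smul]⟩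

namespace SimplexwiseFiltration

variable {m : ℕ} (F : SimplexwiseFiltration m)

/-- The chains of degree `p`. -/
def homog (p : ℕ) : Submodule ℝ (Chain m) where
  carrier := {x | ∀ k, F.dim k ≠ p → x k = 0}
  zero_mem' _ _ := rfl
  add_mem' ha hb k h := by rw [Pi.add_apply, ha k h, hb k h, add_zero]
  smul_mem' r a ha k h := by rw [Pi.smul_apply, ha k h, smul_zero]

/-- The cycles of `K_i` in all degrees. -/
def cyc (i : ℕ) : Submodule ℝ (Chain m) := supp m i ⊓ LinearMap.ker F.boundary

/-- The boundaries of `K_i` in all degrees. -/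
def bd (i : ℕ) : Submodule ℝ (Chain m) := (supp m i).map F.boundary

/-- The harmonic chains of `K_i` in all degrees. -/
def harm (i : ℕ) : Submodule ℝ (Chain m) := F.cyc i ⊓ perp (F.bd i)

/-- The coboundaries of `K_i` in all degrees. -/
def cob (i : ℕ) : Submodule ℝ (Chain m) := supp m i ⊓ perp (F.cyc i)

variable {F}

theorem mem_cyc {i : ℕ} {x : Chain m} : x ∈ F.cyc i ↔ x ∈ supp m i ∧ F.boundary x = 0 := Iff.rfl

theorem mem_harm {i : ℕ} {x : Chain m} :
    x ∈ F.harm i ↔ (x ∈ supp m i ∧ F.boundary x = 0) ∧ ∀ y ∈ supp m i, x ⬝ᵥ F.boundary y = 0 := by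
  refine and_congr Iff.rfl ⟨fun h y hy => h _ (Submodule.mem_map_of_mem hy), ?_⟩
  rintro h _ ⟨y, hy, rfl⟩
  exact h y hy

theorem cyc_mono {i j : ℕ} (h : i ≤ j) : F.cyc i ≤ F.cyc j := fun _ hx => ⟨supp_mono h hx.1, hx.2⟩

/-- Faces are inserted strictly before their cofaces, so even the boundary of the newest simplex
lies in K_i. Together with ∂∂ = 0 it makes the boundaries of K_{i+1} cycles of K_i. -/
theorem boundary_mem_supp {i : ℕ} {x : Chain m} (hx : x ∈ supp m (i + 1)) :
    F.boundary x ∈ supp m i := by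
  intro k hk
  rw [boundary_apply]
  refine Finset.sum_eq_zero fun l _ => ?_
  by_cases h : incidence (F.simplex k) (F.simplex l) = 0
  · rw [h, zero_mul]
  · have := Fin.lt_def.mp (F.lt_of_incidence_ne_zero h).1
    rw [hx l (by omega), mul_zero]

theorem boundary_mem_cyc {i : ℕ} {x : Chain m} (hx : x ∈ supp m (i + 1)) :
    F.boundary x ∈ F.cyc i := ⟨boundary_mem_supp hx, F.boundary_boundary x⟩

theorem boundary_ne_zero_dim {p : ℕ} {x : Chain m} (hx : x ∈ F.homog p) {k : Fin m}
    (hk : F.boundary x k ≠ 0) : F.dim k + 1 = p := by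
  rw [boundary_apply] at hk
  obtain ⟨l, -, hl⟩ := Finset.exists_ne_zero_of_sum_ne_zero hk
  rw [(F.lt_of_incidence_ne_zero (left_ne_zero_of_mul hl)).2]
  by_contra hne
  exact right_ne_zero_of_mul hl (hx l hne)

theorem dotProduct_eq_zero_of_homog {p q : ℕ} (h : p ≠ q) {x y : Chain m} (hx : x ∈ F.homog p)
    (hy : y ∈ F.homog q) : x ⬝ᵥ y = 0 := by
  refine Finset.sum_eq_zero fun k _ => ?_
  by_cases hk : F.dim k = p
  · rw [hy k (by omega), mul_zero]
  · rw [hx k hk, zero_mul]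

theorem boundary_mem_homog {p : ℕ} {x : Chain m} (hx : x ∈ F.homog (p + 1)) :
    F.boundary x ∈ F.homog p := fun k hk => by
  by_contra h
  exact hk (by have := boundary_ne_zero_dim hx h; omega)

end SimplexwiseFiltration
end

noncomputable section

namespace SimplexwiseFiltration

variable {m : ℕ} {F : SimplexwiseFiltration m}

/-! ### The groups of one degree in terms of those of all degrees -/

theorem coboundary_apply (i : ℕ) (x : Chain m) (k : Fin m) :
    F.coboundary i x k =
      if (k : ℕ) < i then ∑ l, incidence (F.simplex l) (F.simplex k) * x l else 0 := rfl

/-- Adjointness of ∂ and δ. The support of y matters because the coboundary of K_i is truncated to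
the first i simplices. -/
theorem dotProduct_boundary {i : ℕ} (x : Chain m) {y : Chain m} (hy : y ∈ supp m i) :
    x ⬝ᵥ F.boundary y = F.coboundary i x ⬝ᵥ y := by
  simp only [dotProduct, boundary_apply, coboundary_apply, Finset.mul_sum]
  rw [Finset.sum_comm]
  refine Finset.sum_congr rfl fun l _ => ?_
  split_ifs with h
  · rw [Finset.sum_mul]
    exact Finset.sum_congr rfl fun k _ => by ring
  · simp [hy l (not_lt.mp h)]

theorem single_mem_supp {i : ℕ} {k : Fin m} (hk : (k : ℕ) < i) :
    (Pi.single k 1 : Chain m) ∈ supp m i := fun l hl =>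
  Pi.single_eq_of_ne (fun h => by subst h; omega) _

theorem coboundary_eq_zero_iff {i : ℕ} {x : Chain m} :
    F.coboundary i x = 0 ↔ x ∈ perp (F.bd i) := by
  constructor
  · rintro h _ ⟨y, hy, rfl⟩
    rw [dotProduct_boundary x hy, h, zero_dotProduct]
  · intro h
    funext k
    by_cases hk : (k : ℕ) < i
    · have h1 := h _ (Submodule.mem_map_of_mem (single_mem_supp hk))
      rw [dotProduct_boundary x (single_mem_supp hk), dotProduct_single_one] at h1
      exact h1
    · rw [coboundary_apply, if_neg hk]; rfl

theorem chains_eq (i p : ℕ) : F.chains i p = supp m i ⊓ F.homog p := by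
  ext x
  refine ⟨fun h => ⟨fun k hk => ?_, fun k hk => ?_⟩, fun h k hk => ⟨?_, ?_⟩⟩
  · by_contra hne; have := (h k hne).1; omega
  · by_contra hne; exact hk (h k hne).2
  · by_contra hlt; exact hk (h.1 k (not_lt.mp hlt))
  · by_contra hne; exact hk (h.2 k hne)

theorem mem_harmonic_iff {i p : ℕ} {x : Chain m} :
    x ∈ F.harmonic i p ↔ x ∈ F.harm i ∧ x ∈ F.homog p := by
  simp only [harmonic, cycles, cocycles, chains_eq, harm, cyc, Submodule.mem_inf,
    LinearMap.mem_ker, coboundary_eq_zero_iff]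
  tauto

/-- The part of degree `p` of a chain. -/
def part (F : SimplexwiseFiltration m) (p : ℕ) : Chain m →ₗ[ℝ] Chain m where
  toFun x k := if F.dim k = p then x k else 0
  map_add' x y := by funext k; by_cases h : F.dim k = p <;> simp [h]
  map_smul' r x := by funext k; by_cases h : F.dim k = p <;> simp [h]

theorem part_apply (p : ℕ) (x : Chain m) (k : Fin m) :
    F.part p x k = if F.dim k = p then x k else 0 := rfl

theorem part_of_homog {p : ℕ} {x : Chain m} (hx : x ∈ F.homog p) : F.part p x = x := by
  funext k
  rw [part_apply]
  split_ifs with h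
  · rfl
  · exact (hx k h).symm

theorem part_of_homog_ne {p q : ℕ} (hpq : p ≠ q) {x : Chain m} (hx : x ∈ F.homog q) :
    F.part p x = 0 := by
  funext k
  rw [part_apply]
  split_ifs with h
  · exact hx k (h ▸ hpq)
  · rfl

theorem part_mem_homog (p : ℕ) (x : Chain m) : F.part p x ∈ F.homog p := fun _ hk => if_neg hk

theorem part_mem_supp {i : ℕ} (p : ℕ) {x : Chain m} (hx : x ∈ supp m i) : F.part p x ∈ supp m i :=
  fun k hk => by rw [part_apply, hx k hk, ite_self]

/-- The boundary lowers degrees by exactly one. This lets a preimage of a homogeneous boundary be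
replaced by its part of the right degree. -/
theorem boundary_part (p : ℕ) (x : Chain m) :
    F.boundary (F.part (p + 1) x) = F.part p (F.boundary x) := by
  funext k
  rw [part_apply, boundary_apply, boundary_apply]
  split_ifs with h
  · refine Finset.sum_congr rfl fun l _ => ?_
    by_cases h0 : incidence (F.simplex k) (F.simplex l) = 0
    · rw [h0, zero_mul, zero_mul]
    · rw [part_apply, if_pos]
      rw [← (F.lt_of_incidence_ne_zero h0).2, h]
  · refine Finset.sum_eq_zero fun l _ => ?_
    by_cases h0 : incidence (F.simplex k) (F.simplex l) = 0
    · rw [h0, zero_mul]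
    · rw [part_apply, if_neg, mul_zero]
      have := (F.lt_of_incidence_ne_zero h0).2
      omega

theorem mem_boundaries_iff {i p : ℕ} {x : Chain m} :
    x ∈ F.boundaries i p ↔ x ∈ F.bd i ∧ x ∈ F.homog p := by
  constructor
  · rintro ⟨y, hy, rfl⟩
    rw [SetLike.mem_coe, chains_eq] at hy
    exact ⟨Submodule.mem_map_of_mem hy.1, boundary_mem_homog hy.2⟩
  · rintro ⟨⟨y, hy, rfl⟩, hp⟩
    refine ⟨F.part (p + 1) y, ?_, ?_⟩
    · rw [SetLike.mem_coe, chains_eq]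
      exact ⟨part_mem_supp _ hy, part_mem_homog _ _⟩
    · rw [boundary_part, part_of_homog hp]

/-- Finite-dimensional Hodge argument. Split off from x its projection u onto the coboundaries; the
remainder v is orthogonal to δ∂v, so ∂v · ∂v = 0 and v is a cycle. Both x and u are orthogonal to
cycles, hence v · v = 0 and x = u. -/
theorem mem_coboundaries_iff {i p : ℕ} {x : Chain m} :
    x ∈ F.coboundaries i (p + 1) ↔ x ∈ F.cob i ∧ x ∈ F.homog (p + 1) := by
  have hle : ∀ y ∈ F.coboundaries i (p + 1), y ∈ F.cob i ∧ y ∈ F.homog (p + 1) := by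
    rintro _ ⟨φ, hφ, rfl⟩
    rw [SetLike.mem_coe, chains_eq] at hφ
    refine ⟨⟨fun k hk => ?_, fun y hy => ?_⟩, fun k hk => ?_⟩
    · rw [coboundary_apply, if_neg (by omega)]
    · rw [← dotProduct_boundary φ hy.1, (mem_cyc.mp hy).2, dotProduct_zero]
    · rw [coboundary_apply]
      split_ifs with h
      · refine Finset.sum_eq_zero fun l _ => ?_
        by_cases h0 : incidence (F.simplex l) (F.simplex k) = 0
        · rw [h0, zero_mul]
        · rw [hφ.2 l, mul_zero]
          have := (F.lt_of_incidence_ne_zero h0).2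
          omega
      · rfl
  refine ⟨hle x, fun ⟨hx, hp⟩ => ?_⟩
  obtain ⟨u, hu, hv⟩ := exists_sub_mem_perp (F.coboundaries i (p + 1)) x
  have hu' := hle u hu
  have hvs : x - u ∈ supp m i := sub_mem hx.1 hu'.1.1
  have hvh : x - u ∈ F.homog (p + 1) := sub_mem hp hu'.2
  have hb : F.boundary (x - u) = 0 := by
    have hmem : F.boundary (x - u) ∈ F.chains i p := by
      rw [chains_eq]
      exact ⟨boundary_mem_supp (supp_mono (Nat.le_succ i) hvs), boundary_mem_homog hvh⟩
    have h := hv _ (Submodule.mem_map_of_mem hmem)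
    rw [dotProduct_comm, ← dotProduct_boundary _ hvs] at h
    exact dotProduct_self_eq_zero.mp h
  have hc : x - u ∈ F.cyc i := ⟨hvs, hb⟩
  have h1 := hx.2 _ hc
  have h2 := hu'.1.2 _ hc
  have h3 : (x - u) ⬝ᵥ (x - u) = 0 := by
    conv_lhs => rw [sub_dotProduct]
    rw [h1, h2, sub_zero]
  rw [sub_eq_zero.mp (dotProduct_self_eq_zero.mp h3)]
  exact hu

end SimplexwiseFiltration

/-! ### One insertion -/

/-- `C 0, …, C (n-1)` is a basis of the coboundaries of `K_i` that consists of chains of degree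
`d j`; the pivots of their boundaries are distinct, and `own k = j + 1` says that `k` is the `j`-th
pivot. -/
structure CobInv {m : ℕ} (F : SimplexwiseFiltration m) (i n : ℕ) (d : ℕ → ℕ) (C : ℕ → Chain m)
    (own : ℕ → ℕ) : Prop where
  mem : ∀ j < n, C j ∈ F.cob i
  homog : ∀ j < n, C j ∈ F.homog (d j)
  pivot : ∀ j < n, ∃ k : Fin m, own k = j + 1
  own_pivot : ∀ (k : Fin m) (j : ℕ), own k = j + 1 → j < n ∧ IsPivot (F.boundary (C j)) k
  span : ∀ x ∈ F.cob i, x ∈ Submodule.span ℝ (C '' Set.Iio n)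

/-- `H 0, …, H (n-1)` is a basis of the harmonic chains of `K_i` that consists of chains of degree
`d j` which are born at the indices `b j`. -/
structure HarmInv {m : ℕ} (F : SimplexwiseFiltration m) (i n : ℕ) (d b : ℕ → ℕ)
    (H : ℕ → Chain m) : Prop where
  mem : ∀ j < n, H j ∈ F.harm i
  homog : ∀ j < n, H j ∈ F.homog (d j)
  pivot : ∀ j < n, ∃ k : Fin m, (k : ℕ) + 1 = b j ∧ IsPivot (H j) k
  mono : ∀ j j', j < j' → j' < n → b j < b j'
  span : ∀ x ∈ F.harm i, x ∈ Submodule.span ℝ (H '' Set.Iio n)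

theorem HarmInv.birth_le {m : ℕ} {F : SimplexwiseFiltration m} {i n : ℕ} {d b : ℕ → ℕ}
    {H : ℕ → Chain m} (h : HarmInv F i n d b H) {j : ℕ} (hj : j < n) : b j ≤ i := by
  obtain ⟨k, hk, hp⟩ := h.pivot j hj
  rw [← hk]
  by_contra hlt
  exact hp.1 ((h.mem j hj).1.1 k (by omega))

/-- The reduction of the new simplex against the coboundaries of `K_i`. -/
structure IsReduced {m : ℕ} (F : SimplexwiseFiltration m) (i : ℕ) (hi : i < m) (n : ℕ)
    (C : ℕ → Chain m) (own : ℕ → ℕ) (x : Chain m) : Prop where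
  mem : x - Pi.single ⟨i, hi⟩ 1 ∈ Submodule.span ℝ (C '' Set.Iio n)
  homog : x ∈ F.homog (F.dim ⟨i, hi⟩)
  own : ∀ k : Fin m, own k ≠ 0 → F.boundary x k = 0

open SimplexwiseFiltration

namespace IsReduced

variable {m : ℕ} {F : SimplexwiseFiltration m} {i n : ℕ} {hi : i < m} {d : ℕ → ℕ} {C : ℕ → Chain m}
  {own : ℕ → ℕ} {x : Chain m}

theorem degree_of_dotProduct_ne_zero (hx : IsReduced F i hi n C own x) {p : ℕ} {h : Chain m} (hh : h ∈ F.homog p)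
    (h0 : h ⬝ᵥ F.boundary x ≠ 0) : p + 1 = F.dim ⟨i, hi⟩ := by
  obtain ⟨k, -, hk⟩ := Finset.exists_ne_zero_of_sum_ne_zero h0
  rw [← boundary_ne_zero_dim hx.homog (right_ne_zero_of_mul hk)]
  by_contra hne
  exact left_ne_zero_of_mul hk (hh k fun h => hne (by rw [h]))

section
variable (hx : IsReduced F i hi n C own x) (hC : CobInv F i n d C own)
include hC hx

theorem sub_mem_cob : x - Pi.single ⟨i, hi⟩ 1 ∈ F.cob i :=
  Submodule.span_le.mpr (by rintro _ ⟨j, hj, rfl⟩; exact hC.mem j hj) hx.mem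

theorem mem_supp : x ∈ supp m (i + 1) := by
  have h := add_mem (supp_mono (Nat.le_succ i) (hx.sub_mem_cob hC).1)
    (single_mem_supp (m := m) (k := ⟨i, hi⟩) (Nat.lt_succ_self i))
  rwa [sub_add_cancel] at h

theorem apply_eq_one : x ⟨i, hi⟩ = 1 := by
  have h := (hx.sub_mem_cob hC).1 ⟨i, hi⟩ le_rfl
  rw [Pi.sub_apply, Pi.single_eq_same] at h
  linarith

/-- The chain x is a coboundary of K_i plus the new simplex; coboundaries are orthogonal to cycles,
and a cycle of K_i has no entry at the new simplex. Everything about x rests on this orthogonality.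
-/
theorem dotProduct_cyc {y : Chain m} (hy : y ∈ F.cyc i) : x ⬝ᵥ y = 0 := by
  have h := (hx.sub_mem_cob hC).2 y hy
  rw [sub_dotProduct, single_dotProduct, hy.1 ⟨i, hi⟩ le_rfl, mul_zero, sub_zero] at h
  exact h

theorem dotProduct_boundary_eq_zero {y : Chain m} (hy : y ∈ supp m (i + 1)) :
    x ⬝ᵥ F.boundary y = 0 := hx.dotProduct_cyc hC (boundary_mem_cyc hy)

theorem sub_mem_supp {y : Chain m} (hy : y ∈ supp m (i + 1)) : y - y ⟨i, hi⟩ • x ∈ supp m i :=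
  sub_single_mem_supp hi (hx.mem_supp hC) (hx.apply_eq_one hC) hy

theorem dotProduct_self_ne_zero : x ⬝ᵥ x ≠ 0 :=
  dotProduct_self_pos (k := ⟨i, hi⟩) (by rw [hx.apply_eq_one hC]; exact one_ne_zero)

/-- Modulo x, a chain of K_{i+1} is a chain of K_i, whose boundary is orthogonal to h. Hence staying
harmonic in K_{i+1} is the single linear condition h · ∂x = 0. -/
theorem dotProduct_boundary_eq {h y : Chain m} (hh : h ∈ F.harm i) (hy : y ∈ supp m (i + 1)) :
    h ⬝ᵥ F.boundary y = y ⟨i, hi⟩ * (h ⬝ᵥ F.boundary x) := by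
  have h1 := (mem_harm.mp hh).2 _ (hx.sub_mem_supp hC hy)
  rw [map_sub, map_smul, dotProduct_sub, dotProduct_smul, smul_eq_mul] at h1
  linarith

/-! The case of a birth. -/

theorem mem_harm_of_boundary_eq_zero (hr : F.boundary x = 0) : x ∈ F.harm (i + 1) :=
  mem_harm.mpr ⟨⟨hx.mem_supp hC, hr⟩, fun _ hy => hx.dotProduct_boundary_eq_zero hC hy⟩

theorem harm_le_of_boundary_eq_zero (hr : F.boundary x = 0) : F.harm i ≤ F.harm (i + 1) := by
  intro h hh
  refine mem_harm.mpr ⟨⟨supp_mono (Nat.le_succ i) hh.1.1, hh.1.2⟩, fun y hy => ?_⟩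
  rw [hx.dotProduct_boundary_eq hC hh hy, hr, dotProduct_zero, mul_zero]

theorem sub_mem_harm (hr : F.boundary x = 0) {y : Chain m} (hy : y ∈ F.harm (i + 1)) :
    y - y ⟨i, hi⟩ • x ∈ F.harm i := by
  have h := sub_mem hy (Submodule.smul_mem _ (y ⟨i, hi⟩) (hx.mem_harm_of_boundary_eq_zero hC hr))
  exact mem_harm.mpr ⟨⟨hx.sub_mem_supp hC hy.1.1, h.1.2⟩,
    fun z hz => (mem_harm.mp h).2 z (supp_mono (Nat.le_succ i) hz)⟩

/-- The only new cycle direction is x, so the old coboundaries are projected onto the complement of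
x. Since ∂x = 0, their boundaries, and with them the pivots and `own`, stay the same. -/
theorem cobInv_of_boundary_eq_zero (hr : F.boundary x = 0) {C' : ℕ → Chain m}
    (hC' : ∀ j < n, C' j = C j - (C j ⬝ᵥ x / x ⬝ᵥ x) • x) : CobInv F (i + 1) n d C' own := by
  have hxx := hx.dotProduct_self_ne_zero hC
  have horth : ∀ j < n, C' j ⬝ᵥ x = 0 := fun j hj => by
    rw [hC' j hj, sub_dotProduct, smul_dotProduct, smul_eq_mul, div_mul_cancel₀ _ hxx, sub_self]
  have hbd : ∀ j < n, F.boundary (C' j) = F.boundary (C j) := fun j hj => by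
    rw [hC' j hj, map_sub, map_smul, hr, smul_zero, sub_zero]
  have hxZ : x ∈ F.cyc (i + 1) := ⟨hx.mem_supp hC, hr⟩
  have hsub : ∀ y ∈ F.cyc (i + 1), y - y ⟨i, hi⟩ • x ∈ F.cyc i := fun y hy =>
    ⟨hx.sub_mem_supp hC hy.1, sub_mem hy.2 (Submodule.smul_mem _ _ hr)⟩
  refine ⟨fun j hj => ⟨?_, fun y hy => ?_⟩, fun j hj => ?_, hC.pivot, fun k j hk => ?_, fun y hy => ?_⟩
  · rw [hC' j hj]
    exact sub_mem (supp_mono (Nat.le_succ i) (hC.mem j hj).1)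
      (Submodule.smul_mem _ _ (hx.mem_supp hC))
  · have h1 := (hC.mem j hj).2 _ (hsub y hy)
    have h2 := hx.dotProduct_cyc hC (hsub y hy)
    have h3 : C' j ⬝ᵥ (y - y ⟨i, hi⟩ • x) = 0 := by
      rw [hC' j hj, sub_dotProduct, smul_dotProduct, h1, h2, smul_zero, sub_zero]
    rwa [dotProduct_sub, dotProduct_smul, horth j hj, smul_zero, sub_zero] at h3
  · rw [hC' j hj]
    by_cases hd : d j = F.dim ⟨i, hi⟩
    · exact sub_mem (hC.homog j hj) (Submodule.smul_mem _ _ (hd ▸ hx.homog))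
    -- A column of another degree is orthogonal to x, so its projection does not alter it and
    -- homogeneity survives.
    · rw [dotProduct_eq_zero_of_homog hd (hC.homog j hj) hx.homog, zero_div, zero_smul, sub_zero]
      exact hC.homog j hj
  · obtain ⟨hj, hp⟩ := hC.own_pivot k j hk
    exact ⟨hj, (hbd j hj).symm ▸ hp⟩
  · have h1 : y - y ⟨i, hi⟩ • x ∈ F.cob i := by
      refine ⟨hx.sub_mem_supp hC hy.1, fun z hz => ?_⟩
      rw [sub_dotProduct, smul_dotProduct, hy.2 z (cyc_mono (Nat.le_succ i) hz),
        hx.dotProduct_cyc hC hz, smul_zero, sub_zero]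
    have h2 : ∀ z ∈ Submodule.span ℝ (C '' Set.Iio n),
        ∃ c : ℝ, z - c • x ∈ Submodule.span ℝ (C' '' Set.Iio n) := by
      intro z hz
      induction hz using Submodule.span_induction with
      | mem v hv =>
        obtain ⟨j, hj, rfl⟩ := hv
        refine ⟨C j ⬝ᵥ x / x ⬝ᵥ x, ?_⟩
        rw [← hC' j hj]
        exact Submodule.subset_span ⟨j, hj, rfl⟩
      | zero => exact ⟨0, by simp⟩
      | add a b _ _ ha hb =>
        obtain ⟨c, hc⟩ := ha
        obtain ⟨e, he⟩ := hb
        refine ⟨c + e, ?_⟩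
        rw [add_smul, add_sub_add_comm]
        exact add_mem hc he
      | smul r a _ ha =>
        obtain ⟨c, hc⟩ := ha
        refine ⟨r * c, ?_⟩
        rw [mul_smul, ← smul_sub]
        exact Submodule.smul_mem _ _ hc
    -- This writes y as a combination of the new columns plus a multiple of x. Both y and the new
    -- columns are orthogonal to x, so that multiple is zero.
    obtain ⟨c, hc⟩ := h2 _ (hC.span _ h1)
    have h3 := dotProduct_eq_zero_of_mem_span (y := x)
      (by rintro _ ⟨j, hj, rfl⟩; exact horth j hj) hc
    rw [sub_sub, ← add_smul, sub_dotProduct, smul_dotProduct, hy.2 x hxZ, zero_sub, neg_eq_zero,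
      smul_eq_mul] at h3
    rw [sub_sub, ← add_smul, (mul_eq_zero.mp h3).resolve_right hxx, zero_smul, sub_zero] at hc
    exact hc

theorem harmInv_of_boundary_eq_zero (hr : F.boundary x = 0) {nH : ℕ} {dH bH dH' bH' : ℕ → ℕ}
    {H H' : ℕ → Chain m} (hH : HarmInv F i nH dH bH H) (hd : ∀ j < nH, dH' j = dH j)
    (hb : ∀ j < nH, bH' j = bH j) (hH' : ∀ j < nH, H' j = H j) (hdn : dH' nH = F.dim ⟨i, hi⟩)
    (hbn : bH' nH = i + 1) (hHn : H' nH = x) : HarmInv F (i + 1) (nH + 1) dH' bH' H' := by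
  have hxm := hx.mem_harm_of_boundary_eq_zero hC hr
  refine ⟨fun j hj => ?_, fun j hj => ?_, fun j hj => ?_, fun j j' hjj hj' => ?_, fun y hy => ?_⟩
  · rcases Nat.lt_succ_iff_lt_or_eq.mp hj with h | rfl
    · rw [hH' j h]; exact hx.harm_le_of_boundary_eq_zero hC hr (hH.mem j h)
    · rw [hHn]; exact hxm
  · rcases Nat.lt_succ_iff_lt_or_eq.mp hj with h | rfl
    · rw [hH' j h, hd j h]; exact hH.homog j h
    · rw [hHn, hdn]; exact hx.homog
  · rcases Nat.lt_succ_iff_lt_or_eq.mp hj with h | rfl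
    · rw [hH' j h, hb j h]; exact hH.pivot j h
    · rw [hHn, hbn]
      refine ⟨⟨i, hi⟩, rfl, ?_, fun l hl => hxm.1.1 l (Fin.lt_def.mp hl)⟩
      rw [hx.apply_eq_one hC]; exact one_ne_zero
  · rcases Nat.lt_succ_iff_lt_or_eq.mp hj' with h | rfl
    · rw [hb j (hjj.trans h), hb j' h]; exact hH.mono j j' hjj h
    · rw [hbn, hb j hjj]; have := hH.birth_le hjj; omega
  · have h1 : y - y ⟨i, hi⟩ • x ∈ Submodule.span ℝ (H' '' Set.Iio (nH + 1)) := by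
      refine Submodule.span_mono ?_ (hH.span _ (hx.sub_mem_harm hC hr hy))
      rintro _ ⟨j, hj, rfl⟩
      exact ⟨j, Nat.lt_succ_of_lt hj, hH' j hj⟩
    have h2 : x ∈ Submodule.span ℝ (H' '' Set.Iio (nH + 1)) :=
      Submodule.subset_span ⟨nH, Nat.lt_succ_self nH, hHn⟩
    have h3 := add_mem h1 (Submodule.smul_mem _ (y ⟨i, hi⟩) h2)
    rwa [sub_add_cancel] at h3

/-! The case of a death. -/

/-- Subtracting the projection onto the cycles shows that every boundary of K_i is the boundary of a
coboundary, hence a combination of columns with distinct pivots. Since ∂x vanishes at all these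
pivots, such a combination would be zero. -/
theorem boundary_notMem_bd (hr : F.boundary x ≠ 0) : F.boundary x ∉ F.bd i := by
  rintro ⟨y, hy, hyx⟩
  obtain ⟨v, hv, hu⟩ := exists_sub_mem_perp (F.cyc i) y
  have hu' : y - v ∈ F.cob i := ⟨sub_mem hy hv.1, hu⟩
  obtain ⟨c, hc⟩ := mem_span_image_Iio (hC.span _ hu')
  have hsum : F.boundary x = ∑ l ∈ Finset.range n, c l • F.boundary (C l) := by
    rw [← hyx, ← sub_add_cancel y v, map_add, (mem_cyc.mp hv).2, add_zero, hc, map_sum]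
    simp only [map_smul]
  have : Nonempty (Fin m) := ⟨⟨i, hi⟩⟩
  choose! pv hpv using hC.pivot
  have hp : ∀ j < n, IsPivot (F.boundary (C j)) (pv j) := fun j hj =>
    (hC.own_pivot (pv j) j (hpv j hj)).2
  have hinj : ∀ j < n, ∀ j' < n, pv j = pv j' → j = j' := fun j hj j' hj' h => by
    have h1 := hpv j hj
    rw [h, hpv j' hj'] at h1
    omega
  have h0 := eq_zero_of_combination_pivots hp hinj (c := c) fun j hj => by
    rw [← hsum]
    exact hx.own _ (by rw [hpv j hj]; exact Nat.succ_ne_zero j)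
  apply hr
  rw [hsum]
  exact Finset.sum_eq_zero fun l hl => by rw [h0 l (Finset.mem_range.mp hl), zero_smul]

/-- A cycle y using the new simplex with coefficient a ≠ 0 would exhibit ∂x as the boundary of -(y -
a x)/a, a chain of K_i. -/
theorem cyc_le_of_boundary_ne_zero (hr : F.boundary x ≠ 0) : F.cyc (i + 1) ≤ F.cyc i := by
  intro y hy
  by_cases h : y ⟨i, hi⟩ = 0
  · have h1 := hx.sub_mem_supp hC hy.1
    rw [h, zero_smul, sub_zero] at h1
    exact ⟨h1, hy.2⟩
  · exfalso
    refine hx.boundary_notMem_bd hC hr ⟨-((y ⟨i, hi⟩)⁻¹ • (y - y ⟨i, hi⟩ • x)),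
      neg_mem (Submodule.smul_mem _ _ (hx.sub_mem_supp hC hy.1)), ?_⟩
    rw [map_neg, map_smul, map_sub, map_smul, (mem_cyc.mp hy).2, zero_sub, smul_neg, neg_neg,
      smul_smul, inv_mul_cancel₀ h, one_smul]

theorem mem_harm_succ_iff (hr : F.boundary x ≠ 0) {h : Chain m} :
    h ∈ F.harm (i + 1) ↔ h ∈ F.harm i ∧ h ⬝ᵥ F.boundary x = 0 := by
  constructor
  · intro hh
    exact ⟨mem_harm.mpr ⟨hx.cyc_le_of_boundary_ne_zero hC hr hh.1,
      fun y hy => (mem_harm.mp hh).2 y (supp_mono (Nat.le_succ i) hy)⟩,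
      (mem_harm.mp hh).2 x (hx.mem_supp hC)⟩
  · rintro ⟨hh, h0⟩
    refine mem_harm.mpr ⟨cyc_mono (Nat.le_succ i) hh.1, fun y hy => ?_⟩
    rw [hx.dotProduct_boundary_eq hC hh hy, h0, mul_zero]

/-- The component of ∂x orthogonal to the boundaries of K_i is harmonic. If it were also orthogonal
to ∂x, it would be orthogonal to itself, hence zero, and ∂x would be a boundary of K_i. -/
theorem exists_dotProduct_ne_zero (hr : F.boundary x ≠ 0) :
    ∃ h ∈ F.harm i, h ⬝ᵥ F.boundary x ≠ 0 := by
  by_contra! hne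
  obtain ⟨b, hb, hp⟩ := exists_sub_mem_perp (F.bd i) (F.boundary x)
  have hbZ : b ∈ F.cyc i := by
    obtain ⟨y, hy, rfl⟩ := hb
    exact boundary_mem_cyc (supp_mono (Nat.le_succ i) hy)
  have hh : F.boundary x - b ∈ F.harm i :=
    ⟨sub_mem (boundary_mem_cyc (hx.mem_supp hC)) hbZ, hp⟩
  have h1 := hne _ hh
  have h2 := hp b hb
  have h3 : (F.boundary x - b) ⬝ᵥ (F.boundary x - b) = 0 := by
    conv_lhs => rw [dotProduct_sub]
    rw [h1, h2, sub_zero]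
  exact hx.boundary_notMem_bd hC hr (sub_eq_zero.mp (dotProduct_self_eq_zero.mp h3) ▸ hb)

/-- The cycles do not grow, so the old columns remain orthogonal to them, and x accounts for the one
new dimension. -/
theorem cobInv_of_boundary_ne_zero (hr : F.boundary x ≠ 0) {k₀ : Fin m}
    (hk₀ : IsPivot (F.boundary x) k₀) {d' : ℕ → ℕ} {C' : ℕ → Chain m} {own' : ℕ → ℕ}
    (hd : ∀ j < n, d' j = d j) (hdn : d' n = F.dim ⟨i, hi⟩) (hC' : ∀ j < n, C' j = C j)
    (hCn : C' n = x) (ho₀ : own' k₀ = n + 1) (ho : ∀ k : Fin m, k ≠ k₀ → own' k = own k) :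
    CobInv F (i + 1) (n + 1) d' C' own' := by
  have hZ := hx.cyc_le_of_boundary_ne_zero hC hr
  refine ⟨fun j hj => ?_, fun j hj => ?_, fun j hj => ?_, fun k j hk => ?_, fun y hy => ?_⟩
  · rcases Nat.lt_succ_iff_lt_or_eq.mp hj with h | rfl
    · rw [hC' j h]
      exact ⟨supp_mono (Nat.le_succ i) (hC.mem j h).1, fun y hy => (hC.mem j h).2 y (hZ hy)⟩
    · rw [hCn]
      exact ⟨hx.mem_supp hC, fun y hy => hx.dotProduct_cyc hC (hZ hy)⟩
  · rcases Nat.lt_succ_iff_lt_or_eq.mp hj with h | rfl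
    · rw [hC' j h, hd j h]; exact hC.homog j h
    · rw [hCn, hdn]; exact hx.homog
  · rcases Nat.lt_succ_iff_lt_or_eq.mp hj with h | rfl
    · obtain ⟨k, hk⟩ := hC.pivot j h
      refine ⟨k, ?_⟩
      rw [ho k, hk]
      rintro rfl
      -- The new pivot is not taken by an old column, since ∂x vanishes wherever `own` is nonzero.
      exact hk₀.1 (hx.own k (by omega))
    · exact ⟨k₀, ho₀⟩
  · by_cases hkk : k = k₀
    · subst hkk
      obtain rfl : n = j := by omega
      rw [hCn]
      exact ⟨Nat.lt_succ_self n, hk₀⟩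
    · rw [ho k hkk] at hk
      obtain ⟨hj, hp⟩ := hC.own_pivot k j hk
      rw [hC' j hj]
      exact ⟨Nat.lt_succ_of_lt hj, hp⟩
  · have h1 : y - y ⟨i, hi⟩ • x ∈ F.cob i := by
      refine ⟨hx.sub_mem_supp hC hy.1, fun z hz => ?_⟩
      rw [sub_dotProduct, smul_dotProduct, hy.2 z (cyc_mono (Nat.le_succ i) hz),
        hx.dotProduct_cyc hC hz, smul_zero, sub_zero]
    have h1 : y - y ⟨i, hi⟩ • x ∈ Submodule.span ℝ (C' '' Set.Iio (n + 1)) := by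
      refine Submodule.span_mono ?_ (hC.span _ h1)
      rintro _ ⟨j, hj, rfl⟩
      exact ⟨j, Nat.lt_succ_of_lt hj, hC' j hj⟩
    have h2 : x ∈ Submodule.span ℝ (C' '' Set.Iio (n + 1)) :=
      Submodule.subset_span ⟨n, Nat.lt_succ_self n, hCn⟩
    have h3 := add_mem h1 (Submodule.smul_mem _ (y ⟨i, hi⟩) h2)
    rwa [sub_add_cancel] at h3

theorem exists_first_dotProduct_ne_zero (hr : F.boundary x ≠ 0) {nH : ℕ} {dH bH : ℕ → ℕ}
    {H : ℕ → Chain m} (hH : HarmInv F i nH dH bH H) : ∃ j < nH, H j ⬝ᵥ F.boundary x ≠ 0 := by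
  by_contra! hne
  obtain ⟨h, hh, h0⟩ := hx.exists_dotProduct_ne_zero hC hr
  exact h0 (dotProduct_eq_zero_of_mem_span (by rintro _ ⟨j, hj, rfl⟩; exact hne j hj)
    (hH.span h hh))

/-- Subtracting multiples of the column j₀ puts the later columns on the hyperplane orthogonal to
∂x. Births increase along H, so the pivot of column j₀ is smaller than those of the columns it is
subtracted from, which therefore keep their pivots and births. Positions after j₀ move down by one
to close the gap. -/
theorem harmInv_of_boundary_ne_zero (hr : F.boundary x ≠ 0) {nH j₀ : ℕ} {dH bH dH' bH' : ℕ → ℕ}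
    {H H' : ℕ → Chain m} (hH : HarmInv F i (nH + 1) dH bH H) (hj₀ : j₀ < nH + 1)
    (h0 : H j₀ ⬝ᵥ F.boundary x ≠ 0) (hfirst : ∀ j < j₀, H j ⬝ᵥ F.boundary x = 0)
    (hd : ∀ j < j₀, dH' j = dH j) (hb : ∀ j < j₀, bH' j = bH j) (hH' : ∀ j < j₀, H' j = H j)
    (hd' : ∀ j, j₀ ≤ j → j < nH → dH' j = dH (j + 1))
    (hb' : ∀ j, j₀ ≤ j → j < nH → bH' j = bH (j + 1))
    (hH'' : ∀ j, j₀ ≤ j → j < nH → H' j = H (j + 1) -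
      (H (j + 1) ⬝ᵥ F.boundary x / H j₀ ⬝ᵥ F.boundary x) • H j₀) :
    HarmInv F (i + 1) nH dH' bH' H' := by
  have horth : ∀ j < nH, H' j ⬝ᵥ F.boundary x = 0 := fun j hj => by
    rcases lt_or_ge j j₀ with h | h
    · rw [hH' j h, hfirst j h]
    · rw [hH'' j h hj, sub_dotProduct, smul_dotProduct, smul_eq_mul, div_mul_cancel₀ _ h0, sub_self]
  refine ⟨fun j hj => (hx.mem_harm_succ_iff hC hr).mpr ⟨?_, horth j hj⟩, fun j hj => ?_,
    fun j hj => ?_, fun j j' hjj hj' => ?_, fun y hy => ?_⟩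
  · rcases lt_or_ge j j₀ with h | h
    · rw [hH' j h]; exact hH.mem j (by omega)
    · rw [hH'' j h hj]
      exact sub_mem (hH.mem _ (by omega)) (Submodule.smul_mem _ _ (hH.mem _ hj₀))
  · rcases lt_or_ge j j₀ with h | h
    · rw [hH' j h, hd j h]; exact hH.homog j (by omega)
    · rw [hH'' j h hj, hd' j h hj]
      have h1 := hH.homog (j + 1) (by omega)
      -- Either nothing is subtracted, or both columns pair nontrivially with ∂x and so have the
      -- same degree, one less than the dimension of the new simplex.
      by_cases hz : H (j + 1) ⬝ᵥ F.boundary x = 0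
      · rw [hz, zero_div, zero_smul, sub_zero]; exact h1
      · have e1 := hx.degree_of_dotProduct_ne_zero h1 hz
        have e2 := hx.degree_of_dotProduct_ne_zero (hH.homog j₀ hj₀) h0
        have e3 : dH j₀ = dH (j + 1) := by omega
        exact sub_mem h1 (Submodule.smul_mem _ _ (e3 ▸ hH.homog j₀ hj₀))
  · rcases lt_or_ge j j₀ with h | h
    · rw [hH' j h, hb j h]; exact hH.pivot j (by omega)
    · rw [hH'' j h hj, hb' j h hj]
      obtain ⟨k, hk, hp⟩ := hH.pivot (j + 1) (by omega)
      obtain ⟨k₀, hk₀, hp₀⟩ := hH.pivot j₀ hj₀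
      have hlt := hH.mono j₀ (j + 1) (by omega) (by omega)
      refine ⟨k, hk, ?_, fun l hl => ?_⟩
      · rw [Pi.sub_apply, Pi.smul_apply, hp₀.2 k (Fin.lt_def.mpr (by omega)), smul_zero, sub_zero]
        exact hp.1
      · rw [Pi.sub_apply, Pi.smul_apply, hp.2 l hl,
          hp₀.2 l (lt_trans (Fin.lt_def.mpr (by omega)) hl), smul_zero, sub_zero]
  · rcases lt_or_ge j' j₀ with h | h
    · rw [hb j (hjj.trans h), hb j' h]; exact hH.mono j j' hjj (by omega)
    · rw [hb' j' h hj']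
      rcases lt_or_ge j j₀ with h1 | h1
      · rw [hb j h1]; exact hH.mono j (j' + 1) (by omega) (by omega)
      · rw [hb' j h1 (by omega)]; exact hH.mono (j + 1) (j' + 1) (by omega) (by omega)
  · obtain ⟨hy, hyr⟩ := (hx.mem_harm_succ_iff hC hr).mp hy
    have h2 : ∀ z ∈ Submodule.span ℝ (H '' Set.Iio (nH + 1)),
        ∃ c : ℝ, z - c • H j₀ ∈ Submodule.span ℝ (H' '' Set.Iio nH) := by
      intro z hz
      induction hz using Submodule.span_induction with
      | mem v hv =>
        obtain ⟨j, hj, rfl⟩ := hv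
        have hj : j < nH + 1 := hj
        rcases lt_trichotomy j j₀ with h | rfl | h
        · refine ⟨0, ?_⟩
          rw [zero_smul, sub_zero, ← hH' j h]
          exact Submodule.subset_span ⟨j, by simp only [Set.mem_Iio]; omega, rfl⟩
        · exact ⟨1, by simp⟩
        · obtain ⟨j, rfl⟩ : ∃ l, j = l + 1 := ⟨j - 1, by omega⟩
          refine ⟨H (j + 1) ⬝ᵥ F.boundary x / H j₀ ⬝ᵥ F.boundary x, ?_⟩
          rw [← hH'' j (by omega) (by omega)]
          exact Submodule.subset_span ⟨j, by simp only [Set.mem_Iio]; omega, rfl⟩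
      | zero => exact ⟨0, by simp⟩
      | add a b _ _ ha hb =>
        obtain ⟨c, hc⟩ := ha
        obtain ⟨e, he⟩ := hb
        refine ⟨c + e, ?_⟩
        rw [add_smul, add_sub_add_comm]
        exact add_mem hc he
      | smul r a _ ha =>
        obtain ⟨c, hc⟩ := ha
        refine ⟨r * c, ?_⟩
        rw [mul_smul, ← smul_sub]
        exact Submodule.smul_mem _ _ hc
    -- Modulo column j₀ the old and new columns have the same span. Pairing with ∂x, which is
    -- nonzero only on column j₀, forces c = 0.
    obtain ⟨c, hc⟩ := h2 _ (hH.span y hy)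
    have h3 := dotProduct_eq_zero_of_mem_span (y := F.boundary x)
      (by rintro _ ⟨j, hj, rfl⟩; exact horth j hj) hc
    rw [sub_dotProduct, smul_dotProduct, hyr, zero_sub, neg_eq_zero, smul_eq_mul] at h3
    rw [(mul_eq_zero.mp h3).resolve_right h0, zero_smul, sub_zero] at hc
    exact hc

end
end IsReduced

end

noncomputable section

/-! ### Programs with bounded loops -/

/-- Programs whose only loops run over `0, …, m-1` or `m-1, …, 0`, where `m` is the size of the
input. -/
inductive Prog where
  | skip
  | nat (a : NatArray) (i j e : NatExpr)
  | real (a : RealArray) (i j : NatExpr) (e : RealExpr)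
  | seq (P Q : Prog)
  | ite (b : Test) (P Q : Prog)
  /-- the counter, which is the entry `(0,0)` of the `x`-th working array, goes up from `0` -/
  | up (x : ℕ) (P : Prog)
  /-- the counter, which is the entry `(0,0)` of the `x`-th working array, goes down to `0` -/
  | down (x : ℕ) (P : Prog)

/-- The entry `(0,0)` of an array of natural numbers. -/
abbrev NatExpr.scalar (a : NatArray) : NatExpr := .get a (.const 0) (.const 0)

/-- The entry `(0,0)` of the `x`-th working array of natural numbers. -/
abbrev NatExpr.var (x : ℕ) : NatExpr := .scalar (.scratch x)

/-- `(f 0, …, f (n-1))` applied one after the other. -/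
def ascend (f : ℕ → State → State) : ℕ → State → State
  | 0, s => s
  | n + 1, s => f n (ascend f n s)

/-- `(f (n-1), …, f 0)` applied one after the other. -/
def descend (f : ℕ → State → State) : ℕ → State → State
  | 0, s => s
  | n + 1, s => descend f n (f n s)

namespace Prog

/-- The program of the while-language. -/
def compile : Prog → Cmd
  | skip => .skip
  | nat a i j e => .setNat a i j e
  | real a i j e => .setReal a i j e
  | seq P Q => .seq P.compile Q.compile
  | ite b P Q => .ite b P.compile Q.compile
  | up x P => .seq (.setNat (.scratch x) (.const 0) (.const 0) (.const 0))
      (.loop (.natLt (.var x) (.scalar .size))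
        (.seq P.compile (.setNat (.scratch x) (.const 0) (.const 0) (.succ (.var x)))))
  | down x P => .seq (.setNat (.scratch x) (.const 0) (.const 0) (.scalar .size))
      (.loop (.natLt (.const 0) (.var x))
        (.seq (.setNat (.scratch x) (.const 0) (.const 0) (.pred (.var x))) P.compile))

open Classical in
/-- The memory after the run of a program, if the input has size `m`. -/
def run (m : ℕ) : Prog → State → State
  | skip, s => s
  | nat a i j e, s => s.setNat a (i.eval s) (j.eval s) (e.eval s)
  | real a i j e, s => s.setReal a (i.eval s) (j.eval s) (e.eval s)
  | seq P Q, s => Q.run m (P.run m s)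
  | ite b P Q, s => if b.Holds s then P.run m s else Q.run m s
  | up x P, s => ascend (fun k s => (P.run m s).setNat (.scratch x) 0 0 (k + 1)) m
      (s.setNat (.scratch x) 0 0 0)
  | down x P, s => descend (fun k s => P.run m (s.setNat (.scratch x) 0 0 k)) m
      (s.setNat (.scratch x) 0 0 m)

/-- The arrays of natural numbers to which a program writes. -/
def natWrites : Prog → List NatArray
  | skip => []
  | nat a _ _ _ => [a]
  | real _ _ _ _ => []
  | seq P Q => P.natWrites ++ Q.natWrites
  | ite _ P Q => P.natWrites ++ Q.natWrites
  | up x P => .scratch x :: P.natWrites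
  | down x P => .scratch x :: P.natWrites

/-- The arrays of real numbers to which a program writes. -/
def realWrites : Prog → List RealArray
  | skip => []
  | nat _ _ _ _ => []
  | real a _ _ _ => [a]
  | seq P Q => P.realWrites ++ Q.realWrites
  | ite _ P Q => P.realWrites ++ Q.realWrites
  | up _ P => P.realWrites
  | down _ P => P.realWrites

/-- The loops do not write to their counters or to the size of the input. -/
def WellFormed : Prog → Prop
  | skip => True
  | nat _ _ _ _ => True
  | real _ _ _ _ => True
  | seq P Q => P.WellFormed ∧ Q.WellFormed
  | ite _ P Q => P.WellFormed ∧ Q.WellFormed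
  | up x P => .scratch x ∉ P.natWrites ∧ P.WellFormed
  | down x P => .scratch x ∉ P.natWrites ∧ P.WellFormed

/-- The depth of the nesting of loops. -/
def depth : Prog → ℕ
  | skip => 0
  | nat _ _ _ _ => 0
  | real _ _ _ _ => 0
  | seq P Q => max P.depth Q.depth
  | ite _ P Q => max P.depth Q.depth
  | up _ P => P.depth + 1
  | down _ P => P.depth + 1

/-- A constant for the bound of the running time. -/
def coef : Prog → ℕ
  | skip => 1
  | nat _ i j e => i.cost + j.cost + e.cost + 1
  | real _ i j e => i.cost + j.cost + e.cost + 1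
  | seq P Q => P.coef + Q.coef
  | ite b P Q => b.cost + P.coef + Q.coef
  | up _ P => P.coef + 20
  | down _ P => P.coef + 20

theorem setNat_nat_of_ne {s : State} {a a' : NatArray} {i j x : ℕ} (h : a' ≠ a) :
    (s.setNat a i j x).nat a' = s.nat a' := by
  funext i' j'
  simp [State.setNat, h]

theorem setReal_real_of_ne {s : State} {a a' : RealArray} {i j : ℕ} {x : ℝ} (h : a' ≠ a) :
    (s.setReal a i j x).real a' = s.real a' := by
  funext i' j'
  simp [State.setReal, h]

theorem ascend_induction (f : ℕ → State → State) (I : ℕ → State → Prop) {n : ℕ} {s : State}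
    (h0 : I 0 s) (hs : ∀ k < n, ∀ s, I k s → I (k + 1) (f k s)) : I n (ascend f n s) := by
  induction n with
  | zero => exact h0
  | succ n ih => exact hs n n.lt_succ_self _ (ih fun k hk => hs k (hk.trans n.lt_succ_self))

theorem descend_induction (f : ℕ → State → State) (I : ℕ → State → Prop) {n : ℕ} {s : State}
    (h0 : I n s) (hs : ∀ k < n, ∀ s, I (k + 1) s → I k (f k s)) : I 0 (descend f n s) := by
  induction n generalizing s with
  | zero => exact h0
  | succ n ih => exact ih (hs n n.lt_succ_self _ h0) fun k hk => hs k (hk.trans n.lt_succ_self)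

/-- Frame rule: with this and its real counterpart, the specifications below only have to describe
the arrays that a program writes. -/
theorem run_nat_of_notMem (m : ℕ) {a : NatArray} (P : Prog) (h : a ∉ P.natWrites) (s : State) :
    (P.run m s).nat a = s.nat a := by
  induction P generalizing s with
  | skip => rfl
  | nat a' i j e => exact setNat_nat_of_ne (by simpa [natWrites] using h)
  | real => rfl
  | seq P Q hP hQ =>
    simp only [natWrites, List.mem_append, not_or] at h
    rw [run, hQ h.2, hP h.1]
  | ite b P Q hP hQ =>
    simp only [natWrites, List.mem_append, not_or] at h
    rw [run]
    split_ifs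
    · exact hP h.1 s
    · exact hQ h.2 s
  | up x P hP =>
    simp only [natWrites, List.mem_cons, not_or] at h
    rw [run]
    refine ascend_induction _ (fun _ s' => s'.nat a = s.nat a) (setNat_nat_of_ne h.1) ?_
    intro k _ s' hs'
    rw [setNat_nat_of_ne h.1, hP h.2, hs']
  | down x P hP =>
    simp only [natWrites, List.mem_cons, not_or] at h
    refine descend_induction _ (fun _ s' => s'.nat a = s.nat a) (setNat_nat_of_ne h.1) ?_
    intro k _ s' hs'
    rw [hP h.2, setNat_nat_of_ne h.1, hs']

theorem run_real_of_notMem (m : ℕ) {a : RealArray} (P : Prog) (h : a ∉ P.realWrites) (s : State) :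
    (P.run m s).real a = s.real a := by
  induction P generalizing s with
  | skip => rfl
  | nat a' i j e => rfl
  | real a' i j e => exact setReal_real_of_ne (by simpa [realWrites] using h)
  | seq P Q hP hQ =>
    simp only [realWrites, List.mem_append, not_or] at h
    rw [run, hQ h.2, hP h.1]
  | ite b P Q hP hQ =>
    simp only [realWrites, List.mem_append, not_or] at h
    rw [run]
    split_ifs
    · exact hP h.1 s
    · exact hQ h.2 s
  | up x P hP =>
    refine ascend_induction _ (fun _ s' => s'.real a = s.real a) rfl ?_
    intro k _ s' hs'
    rw [← hs']
    exact hP h s'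
  | down x P hP =>
    refine descend_induction _ (fun _ s' => s'.real a = s.real a) rfl ?_
    intro k _ s' hs'
    rw [← hs']
    exact hP h _

/-- Induction over an ascending loop. -/
theorem run_up_induction {m x : ℕ} {P : Prog} {s : State} (I : ℕ → State → Prop)
    (h0 : I 0 (s.setNat (.scratch x) 0 0 0))
    (hs : ∀ k < m, ∀ s', s'.nat (.scratch x) 0 0 = k →
      (∀ a, a ∉ (up x P).natWrites → s'.nat a = s.nat a) →
      (∀ a, a ∉ P.realWrites → s'.real a = s.real a) →
      I k s' → I (k + 1) ((P.run m s').setNat (.scratch x) 0 0 (k + 1))) :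
    I m ((up x P).run m s) := by
  rw [run]
  refine (ascend_induction (n := m) (s := s.setNat (.scratch x) 0 0 0) _ (fun k s' => s'.nat (.scratch x) 0 0 = k ∧
    ((∀ a, a ∉ (up x P).natWrites → s'.nat a = s.nat a) ∧
      (∀ a, a ∉ P.realWrites → s'.real a = s.real a)) ∧ I k s')
    ⟨by simp [State.setNat], ⟨fun a ha => ?_, fun a _ => rfl⟩, h0⟩ ?_).2.2
  · simp only [natWrites, List.mem_cons, not_or] at ha
    exact setNat_nat_of_ne ha.1
  · rintro k hk s' ⟨h1, ⟨h2, h3⟩, h4⟩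
    refine ⟨by simp [State.setNat], ⟨fun a ha => ?_, fun a ha => ?_⟩, hs k hk s' h1 h2 h3 h4⟩
    · rw [← h2 a ha]
      simp only [natWrites, List.mem_cons, not_or] at ha
      rw [setNat_nat_of_ne ha.1, run_nat_of_notMem m P ha.2]
    · rw [← h3 a ha]
      exact run_real_of_notMem m P ha s'

/-- Induction over a descending loop. -/
theorem run_down_induction {m x : ℕ} {P : Prog} {s : State} (I : ℕ → State → Prop)
    (h0 : I m (s.setNat (.scratch x) 0 0 m))
    (hs : ∀ k < m, ∀ s',
      (∀ a, a ∉ (down x P).natWrites → s'.nat a = s.nat a) →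
      (∀ a, a ∉ P.realWrites → s'.real a = s.real a) →
      I (k + 1) s' → I k (P.run m (s'.setNat (.scratch x) 0 0 k))) :
    I 0 ((down x P).run m s) := by
  rw [run]
  refine (descend_induction (n := m) (s := s.setNat (.scratch x) 0 0 m) _ (fun k s' =>
    ((∀ a, a ∉ (down x P).natWrites → s'.nat a = s.nat a) ∧
      (∀ a, a ∉ P.realWrites → s'.real a = s.real a)) ∧ I k s')
    ⟨⟨fun a ha => ?_, fun a _ => rfl⟩, h0⟩ ?_).2
  · simp only [natWrites, List.mem_cons, not_or] at ha
    exact setNat_nat_of_ne ha.1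
  · rintro k hk s' ⟨⟨h2, h3⟩, h4⟩
    refine ⟨⟨fun a ha => ?_, fun a ha => ?_⟩, hs k hk s' h2 h3 h4⟩
    · rw [← h2 a ha]
      simp only [natWrites, List.mem_cons, not_or] at ha
      rw [run_nat_of_notMem m P ha.2, setNat_nat_of_ne ha.1]
    · rw [← h3 a ha]
      exact run_real_of_notMem m P ha _

theorem time_seq_le {m t u c e d f : ℕ} (h₁ : t ≤ c * (m + 1) ^ d) (h₂ : u ≤ e * (m + 1) ^ f) :
    t + u ≤ (c + e) * (m + 1) ^ max d f := by
  rw [add_mul]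
  exact add_le_add
    (h₁.trans (Nat.mul_le_mul_left _ (Nat.pow_le_pow_right (Nat.succ_pos m) (le_max_left _ _))))
    (h₂.trans (Nat.mul_le_mul_left _ (Nat.pow_le_pow_right (Nat.succ_pos m) (le_max_right _ _))))

/-- The 14 bounds the test and the counter update of one round; the 11 is the initial assignment and
the last, failing test. Since 14 m + 11 ≤ 20 (m + 1), an overhead of 20 in the coefficient suffices.
-/
theorem time_loop_le {m t c d : ℕ} (h : t ≤ m * (c * (m + 1) ^ d + 14) + 11) :
    t ≤ (c + 20) * (m + 1) ^ (d + 1) := by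
  have h1 : 1 ≤ (m + 1) ^ d := Nat.one_le_pow _ _ (Nat.succ_pos m)
  rw [pow_succ]
  nlinarith

/-- A program with bounded loops halts, and its running time is bounded by a polynomial whose degree
is the depth of the nesting of its loops. -/
theorem exec_compile {m : ℕ} (P : Prog) (hP : P.WellFormed) (hz : .size ∉ P.natWrites) (s : State)
    (hs : s.nat .size 0 0 = m) :
    ∃ t ≤ P.coef * (m + 1) ^ P.depth, Exec P.compile s t (P.run m s) := by
  induction P generalizing s with
  | skip => exact ⟨1, by simp [coef, depth], .skip s⟩
  | nat a i j e => exact ⟨_, by simp [coef, depth], .setNat s a i j e⟩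
  | real a i j e => exact ⟨_, by simp [coef, depth], .setReal s a i j e⟩
  | seq P Q iP iQ =>
    simp only [natWrites, List.mem_append, not_or] at hz
    obtain ⟨t, ht, hPe⟩ := iP hP.1 hz.1 s hs
    obtain ⟨u, hu, hQe⟩ := iQ hP.2 hz.2 _ (by rw [run_nat_of_notMem m P hz.1, hs])
    exact ⟨t + u, time_seq_le ht hu, .seq hPe hQe⟩
  | ite b P Q iP iQ =>
    simp only [natWrites, List.mem_append, not_or] at hz
    have hb : b.cost ≤ b.cost * (m + 1) ^ 0 := by simp
    rw [run]
    split_ifs with h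
    · obtain ⟨t, ht, hPe⟩ := iP hP.1 hz.1 s hs
      refine ⟨b.cost + t, ?_, .ite_true h hPe⟩
      have := time_seq_le (time_seq_le hb ht) (Nat.zero_le (Q.coef * (m + 1) ^ Q.depth))
      simpa [coef, depth] using this
    · obtain ⟨t, ht, hQe⟩ := iQ hP.2 hz.2 s hs
      refine ⟨b.cost + t, ?_, .ite_false h hQe⟩
      have := time_seq_le (time_seq_le hb (Nat.zero_le (P.coef * (m + 1) ^ P.depth))) ht
      simpa [coef, depth] using this
  | up x P iP =>
    obtain ⟨hx, hP⟩ := hP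
    simp only [natWrites, List.mem_cons, not_or] at hz
    set f : ℕ → State → State := fun k s => (P.run m s).setNat (.scratch x) 0 0 (k + 1) with hf
    set s₀ := s.setNat (.scratch x) 0 0 0 with hs₀
    have hinv : ∀ k, (ascend f k s₀).nat .size 0 0 = m ∧
        (ascend f k s₀).nat (.scratch x) 0 0 = k := by
      intro k
      induction k with
      | zero => exact ⟨by rw [ascend, hs₀, setNat_nat_of_ne hz.1, hs], by simp [ascend, hs₀, State.setNat]⟩
      | succ k ih =>
        rw [ascend, hf]
        exact ⟨by rw [setNat_nat_of_ne hz.1, run_nat_of_notMem m P hz.2]; exact ih.1,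
          by simp [State.setNat]⟩
    -- Here n is the number of rounds still to run. The test and the increment cost 7 each, and the
    -- failing test costs another 7.
    have key : ∀ n k, k + n = m → ∃ t ≤ n * (P.coef * (m + 1) ^ P.depth + 14) + 7,
          Exec (.loop (.natLt (.var x) (.scalar .size)) (.seq P.compile
            (.setNat (.scratch x) (.const 0) (.const 0) (.succ (.var x))))) (ascend f k s₀) t
            (ascend f m s₀) := by
      intro n
      induction n with
      | zero =>
        intro k hk
        obtain rfl : k = m := hk
        refine ⟨_, ?_, .loop_false ?_⟩
        · simp [Test.cost, NatExpr.cost]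
        · simp only [Test.Holds, NatExpr.eval, (hinv k).1, (hinv k).2, lt_irrefl, not_false_iff]
      | succ n ih =>
        intro k hk
        obtain ⟨t, ht, he⟩ := iP hP hz.2 _ (hinv k).1
        have h1 : (P.run m (ascend f k s₀)).nat (.scratch x) 0 0 = k := by
          rw [run_nat_of_notMem m P hx, (hinv k).2]
        have hset := Exec.setNat (P.run m (ascend f k s₀)) (.scratch x) (.const 0) (.const 0)
          (.succ (.var x))
        simp only [NatExpr.eval, h1] at hset
        obtain ⟨t', ht', he'⟩ := ih (k + 1) (by omega)
        refine ⟨_, ?_, .loop_true ?_ (.seq he hset) he'⟩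
        · simp only [Test.cost, NatExpr.cost]
          rw [Nat.succ_mul]
          omega
        · simp only [Test.Holds, NatExpr.eval, (hinv k).1, (hinv k).2]; omega
    obtain ⟨t, ht, he⟩ := key m 0 (by omega)
    refine ⟨_, ?_, .seq (.setNat s (.scratch x) (.const 0) (.const 0) (.const 0)) he⟩
    apply time_loop_le
    simp only [NatExpr.cost]
    omega
  | down x P iP =>
    obtain ⟨hx, hP⟩ := hP
    simp only [natWrites, List.mem_cons, not_or] at hz
    set f : ℕ → State → State := fun k s => P.run m (s.setNat (.scratch x) 0 0 k) with hf
    -- A test costs 5 and the decrement 7, rounded up to the 14 of the ascending loop; the failing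
    -- test costs 5.
    have key : ∀ n, ∀ s : State, s.nat .size 0 0 = m → s.nat (.scratch x) 0 0 = n →
        ∃ t ≤ n * (P.coef * (m + 1) ^ P.depth + 14) + 5,
          Exec (.loop (.natLt (.const 0) (.var x)) (.seq (.setNat (.scratch x) (.const 0) (.const 0)
            (.pred (.var x))) P.compile)) s t (descend f n s) := by
      intro n
      induction n with
      | zero =>
        intro s hs hxs
        refine ⟨_, ?_, .loop_false ?_⟩
        · simp [Test.cost, NatExpr.cost]
        · simp only [Test.Holds, NatExpr.eval, hxs, lt_irrefl, not_false_iff]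
      | succ n ih =>
        intro s hs hxs
        have hset := Exec.setNat s (.scratch x) (.const 0) (.const 0) (.pred (.var x))
        simp only [NatExpr.eval, hxs, Nat.add_sub_cancel] at hset
        have hs1 : (s.setNat (.scratch x) 0 0 n).nat .size 0 0 = m := by
          rw [setNat_nat_of_ne hz.1, hs]
        obtain ⟨t, ht, he⟩ := iP hP hz.2 _ hs1
        obtain ⟨t', ht', he'⟩ := ih (f n s)
          (by rw [hf]; dsimp only; rw [run_nat_of_notMem m P hz.2, hs1])
          (by rw [hf]; dsimp only; rw [run_nat_of_notMem m P hx]; simp [State.setNat])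
        refine ⟨_, ?_, .loop_true ?_ (.seq hset he) he'⟩
        · simp only [Test.cost, NatExpr.cost]
          rw [Nat.succ_mul]
          omega
        · simp only [Test.Holds, NatExpr.eval, hxs]; omega
    have hset := Exec.setNat s (.scratch x) (.const 0) (.const 0) (.scalar .size)
    simp only [NatExpr.eval, hs] at hset
    obtain ⟨t, ht, he⟩ := key m (s.setNat (.scratch x) 0 0 m) (by rw [setNat_nat_of_ne hz.1, hs])
      (by simp [State.setNat])
    refine ⟨_, ?_, .seq hset he⟩
    apply time_loop_le
    simp only [NatExpr.cost]
    omega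

end Prog

end

noncomputable section

/-! ### Barcodes of sequences of subspaces -/

namespace ZigzagModule

variable {W : Type} [AddCommGroup W] [Module ℝ W]

theorem exists_combination_of_mem_span_image {r : ℕ} {z : Fin r → W} {A : Set (Fin r)} {x : W}
    (hx : x ∈ Submodule.span ℝ (z '' A)) :
    ∃ c : Fin r → ℝ, (∀ a, a ∉ A → c a = 0) ∧ ∑ a, c a • z a = x := by
  induction hx using Submodule.span_induction with
  | mem y hy =>
    obtain ⟨j, hj, rfl⟩ := hy
    refine ⟨Pi.single j 1, fun a ha => Pi.single_eq_of_ne (by rintro rfl; exact ha hj) _, ?_⟩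
    rw [Finset.sum_eq_single j]
    · simp
    · intro b _ hb; simp [hb]
    · intro h; exact absurd (Finset.mem_univ _) h
  | zero => exact ⟨0, fun _ _ => rfl, by simp⟩
  | add a b _ _ ha hb =>
    obtain ⟨c, hc, rfl⟩ := ha
    obtain ⟨d, hd, rfl⟩ := hb
    exact ⟨c + d, fun a ha => by simp [hc a ha, hd a ha],
      by simp [add_smul, Finset.sum_add_distrib]⟩
  | smul t a _ ha =>
    obtain ⟨c, hc, rfl⟩ := ha
    exact ⟨t • c, fun a ha => by simp [hc a ha], by simp [Finset.smul_sum, mul_smul]⟩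

/-- Vectors that form a basis of every subspace of the sequence over which they extend, and that
leave the subspaces at the ends of their intervals, give the barcode. -/
theorem isBarcode_ofSubspaces {n r : ℕ} {S : ℕ → Submodule ℝ W}
    (hS : ∀ i < n, S i ≤ S (i + 1) ∨ S (i + 1) ≤ S i) {I : Fin r → ℕ × ℕ} {z : Fin r → W}
    (hI : ∀ a, 0 < (I a).1 ∧ (I a).1 ≤ (I a).2 ∧ (I a).2 ≤ n)
    (hmem : ∀ a i, (I a).1 ≤ i → i ≤ (I a).2 → z a ∈ S i)
    (hb : ∀ a, z a ∉ S ((I a).1 - 1)) (hd : ∀ a, (I a).2 < n → z a ∉ S ((I a).2 + 1))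
    (hli : LinearIndependent ℝ z)
    (hspan : ∀ i ≤ n, ∀ x ∈ S i, x ∈ Submodule.span ℝ (z '' {a | (I a).1 ≤ i ∧ i ≤ (I a).2})) :
    (ofSubspaces n S hS).IsBarcode ((Finset.univ : Finset (Fin r)).val.map I) := by
  refine ⟨r, I, rfl, fun a => ⟨(hI a).2.1, (hI a).2.2⟩, ?_⟩
  let f : ∀ i : ℕ, (∀ a, intervalSpace (I a).1 (I a).2 i) →ₗ[ℝ] S i := fun i =>
    { toFun := fun x => ⟨∑ a, (x a : ℝ) • z a, sum_mem fun a _ => by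
        by_cases h : (I a).1 ≤ i ∧ i ≤ (I a).2
        · exact Submodule.smul_mem _ _ (hmem a i h.1 h.2)
        · rw [(x a).2 h, zero_smul]; exact zero_mem _⟩
      map_add' := fun x y => Subtype.ext (by simp [add_smul, Finset.sum_add_distrib])
      map_smul' := fun t x => Subtype.ext (by simp [Finset.smul_sum, mul_smul]) }
  have hf : ∀ i x, (f i x : W) = ∑ a, (x a : ℝ) • z a := fun i x => rfl
  have hbij : ∀ i ≤ n, Function.Bijective (f i) := by
    intro i hi
    constructor
    · rw [← LinearMap.ker_eq_bot, LinearMap.ker_eq_bot']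
      intro x hx
      have h := congrArg Subtype.val hx
      rw [hf] at h
      funext a
      exact Subtype.ext (Fintype.linearIndependent_iff.mp hli _ h a)
    · rintro ⟨x, hx⟩
      obtain ⟨c, hc, h⟩ := exists_combination_of_mem_span_image (hspan i hi x hx)
      exact ⟨fun a => ⟨c a, fun h => hc a h⟩, Subtype.ext h⟩
  let e : ∀ i, i ≤ n → (∀ a, intervalSpace (I a).1 (I a).2 i) ≃ₗ[ℝ] S i := fun i hi =>
    LinearEquiv.ofBijective (f i) (hbij i hi)
  -- Along an inclusion, a combination of representatives keeps its coefficients. This agrees with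
  -- the maps of the interval modules as soon as every interval present at the source is present at
  -- the target.
  have hcomm : ∀ i j (hi : i ≤ n) (hj : j ≤ n) (hle : S i ≤ S j),
      (∀ a, (I a).1 ≤ i ∧ i ≤ (I a).2 → (I a).1 ≤ j ∧ j ≤ (I a).2) → ∀ x : S i,
      (e j hj).symm (Submodule.inclusion hle x) =
        fun a => intervalMap (I a).1 (I a).2 i j ((e i hi).symm x a) := by
    intro i j hi hj hle hact x
    obtain ⟨y, rfl⟩ := (e i hi).surjective x
    rw [LinearEquiv.symm_apply_apply]
    refine (e j hj).injective ?_
    rw [LinearEquiv.apply_symm_apply]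
    refine Subtype.ext ?_
    change ∑ a, (y a : ℝ) • z a = ∑ a, (if (I a).1 ≤ j ∧ j ≤ (I a).2 then (y a : ℝ) else 0) • z a
    refine Finset.sum_congr rfl fun a _ => ?_
    split_ifs with h
    · rfl
    · rw [(y a).2 fun h' => h (hact a h')]
  refine ⟨{ equiv := fun i => (e i (Nat.lt_succ_iff.mp i.2)).symm, right_comm := ?_, left_comm := ?_ }⟩
  · intro i h x
    refine hcomm i (i + 1) i.2.le i.2 h (fun a ⟨h1, h2⟩ => ⟨h1.trans (Nat.le_succ _), ?_⟩) x
    -- An interval ending at the source of a right arrow would have its representative in the next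
    -- subspace, against `hd`. For left arrows the same argument works with births and `hb`.
    by_contra h3
    have h3 : (I a).2 = (i : ℕ) := by omega
    exact hd a (h3 ▸ i.2) (h3 ▸ h (hmem a i h1 h2))
  · intro i h x
    have hle := (hS i i.2).resolve_left h
    refine hcomm (i + 1) i i.2 i.2.le hle (fun a ⟨h1, h2⟩ => ⟨?_, by omega⟩) x
    by_contra h3
    have h3 : (I a).1 - 1 = (i : ℕ) := by omega
    exact hb a (h3 ▸ hle (hmem a _ h1 h2))

end ZigzagModule

/-! ### Births, deaths and bars -/

open SimplexwiseFiltration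

namespace SimplexwiseFiltration

variable {m : ℕ} {F : SimplexwiseFiltration m}

/-- Without an entry at the new simplex the chain lives in K_i, where there are fewer boundaries to
be orthogonal to. Consequently the group of one degree grows by at most one dimension per insertion.
-/
theorem harmonic_of_apply_eq_zero {i p : ℕ} (hi : i < m) {y : Chain m}
    (hy : y ∈ F.harmonic (i + 1) p) (h0 : y ⟨i, hi⟩ = 0) : y ∈ F.harmonic i p := by
  rw [mem_harmonic_iff] at hy ⊢
  refine ⟨mem_harm.mpr ⟨⟨fun k hk => ?_, hy.1.1.2⟩, fun z hz =>
    (mem_harm.mp hy.1).2 z (supp_mono (Nat.le_succ i) hz)⟩, hy.2⟩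
  rcases hk.eq_or_lt with h | h
  · rw [show k = ⟨i, hi⟩ from Fin.ext h.symm, h0]
  · exact hy.1.1.1 k h

/-- A chain harmonic in K_b but not in K_{b-1} must use the simplex inserted last, which has index b
- 1. So births are pivots shifted by one, and distinct births make representatives independent. -/
theorem IsPartialRep.isPivot {p b e : ℕ} {z : Chain m} (h : F.IsPartialRep p b e z) :
    ∃ k : Fin m, (k : ℕ) + 1 = b ∧ IsPivot z k := by
  obtain ⟨h1, h2, h3, h4, h5⟩ := h
  obtain ⟨i, rfl⟩ : ∃ i, b = i + 1 := ⟨b - 1, by omega⟩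
  have hz := h4 (i + 1) le_rfl h2
  refine ⟨⟨i, by omega⟩, rfl, fun h0 => h5 (harmonic_of_apply_eq_zero (by omega) hz h0), ?_⟩
  intro l hl
  exact (mem_harmonic_iff.mp hz).1.1.1 l (Fin.lt_def.mp hl)

theorem harm_of_supp {i j : ℕ} (hij : j ≤ i) {z : Chain m} (hz : z ∈ F.harm i)
    (hs : z ∈ supp m j) : z ∈ F.harm j :=
  mem_harm.mpr ⟨⟨hs, hz.1.2⟩, fun y hy => (mem_harm.mp hz).2 y (supp_mono hij hy)⟩

/-- Harmonicity in K_i descends to every earlier complex that contains the support, so the pivot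
alone determines the birth. -/
theorem isPartialRep_of_isPivot {i p : ℕ} (hi : i ≤ m) {z : Chain m} (hz : z ∈ F.harm i)
    (hp : z ∈ F.homog p) {k : Fin m} (hk : IsPivot z k) : F.IsPartialRep p (k + 1) i z := by
  have hki : (k : ℕ) + 1 ≤ i := by
    by_contra h
    exact hk.1 (hz.1.1 k (by omega))
  refine ⟨Nat.succ_pos _, hki, hi, fun j h1 h2 => ?_, fun h => ?_⟩
  · exact mem_harmonic_iff.mpr ⟨harm_of_supp h2 hz fun l hl => hk.2 l (Fin.lt_def.mpr (by omega)), hp⟩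
  · exact hk.1 ((mem_harmonic_iff.mp h).1.1.1 k (by simp))

theorem harmonic_zero_eq_bot (p : ℕ) : F.harmonic 0 p = ⊥ := by
  refine (Submodule.eq_bot_iff _).mpr fun x hx => ?_
  funext k
  exact (mem_harmonic_iff.mp hx).1.1.1 k (Nat.zero_le _)

theorem harmonicAll_le_harm (i : ℕ) : F.harmonicAll i ≤ F.harm i :=
  iSup_le fun _ _ hx => (mem_harmonic_iff.mp hx).1

theorem mem_harmonic_of_mem_harmonicAll {i p : ℕ} {x : Chain m} (hx : x ∈ F.harmonicAll i)
    (hp : x ∈ F.homog p) : x ∈ F.harmonic i p :=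
  mem_harmonic_iff.mpr ⟨harmonicAll_le_harm i hx, hp⟩

end SimplexwiseFiltration

/-- A complete list of bars, with degrees `d`, births `b`, ends `e` and representatives `z`. -/
structure BarList {m : ℕ} (F : SimplexwiseFiltration m) (N : ℕ) (d b e : ℕ → ℕ)
    (z : ℕ → Chain m) : Prop where
  rep : ∀ l < N, F.IsRep (d l) (b l) (e l) (z l)
  birth : ∀ p i, i ≤ m → F.IsBirth p i → ∃ l < N, d l = p ∧ b l = i
  birth_inj : ∀ l < N, ∀ l' < N, b l = b l' → l = l'
  death_inj : ∀ l < N, ∀ l' < N, e l < m → e l = e l' → l = l'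

namespace BarList

variable {m N : ℕ} {F : SimplexwiseFiltration m} {d b e : ℕ → ℕ} {z : ℕ → Chain m}

/-- Induction on i. A growing group gains the bar born there; a shrinking one loses at most one of
the representatives alive. -/
theorem mem_span (h : BarList F N d b e z) (p : ℕ) {i : ℕ} (hi : i ≤ m) :
    ∀ x ∈ F.harmonic i p, x ∈ Submodule.span ℝ (z '' {l | l < N ∧ d l = p ∧ b l ≤ i ∧ i ≤ e l}) := by
  induction i with
  | zero =>
    intro x hx
    rw [harmonic_zero_eq_bot, Submodule.mem_bot] at hx
    rw [hx]; exact zero_mem _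
  | succ i ih =>
    have hi' : i < m := hi
    have ih := ih hi'.le
    intro x hx
    rcases F.harmonic_step i hi' with hle | hle
    · have hsub : ∀ y ∈ F.harmonic i p,
          y ∈ Submodule.span ℝ (z '' {l | l < N ∧ d l = p ∧ b l ≤ i + 1 ∧ i + 1 ≤ e l}) := by
        intro y hy
        refine Submodule.span_mono (Set.image_mono ?_) (ih y hy)
        rintro l ⟨h1, h2, h3, h4⟩
        refine ⟨h1, h2, by omega, ?_⟩
        by_contra h5
        have h6 : e l = i := by omega
        have hr := h.rep l h1
        rw [h2, h6] at hr
        exact hr.2 hi' (hle p (hr.1.2.2.2.1 i h3 le_rfl))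
      by_cases hx' : x ∈ F.harmonic i p
      · exact hsub x hx'
      · obtain ⟨l, hl, hlp, hlb⟩ := h.birth p (i + 1) hi
          ⟨Nat.succ_pos i, lt_of_le_of_ne (hle p) fun he => hx' (by
            have he : F.harmonic i p = F.harmonic (i + 1) p := he
            rwa [he])⟩
        have hr := (h.rep l hl).1
        rw [hlp, hlb] at hr
        obtain ⟨k, hk, hkp⟩ := hr.isPivot
        obtain rfl : k = ⟨i, hi'⟩ := Fin.ext (Nat.succ_injective hk)
        have hz := hr.2.2.2.1 (i + 1) le_rfl hr.2.1
        -- The representative born at i + 1 has a nonzero entry at the new simplex and is used to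
        -- cancel the entry of x there.
        have h1 : x - (x ⟨i, hi'⟩ / z l ⟨i, hi'⟩) • z l ∈ F.harmonic i p := by
          refine harmonic_of_apply_eq_zero hi' (sub_mem hx (Submodule.smul_mem _ _ hz)) ?_
          rw [Pi.sub_apply, Pi.smul_apply, smul_eq_mul, div_mul_cancel₀ _ hkp.1, sub_self]
        have h2 := add_mem (hsub _ h1) (Submodule.smul_mem _ (x ⟨i, hi'⟩ / z l ⟨i, hi'⟩)
          (Submodule.subset_span ⟨l, ⟨hl, hlp, hlb.le, hr.2.1⟩, rfl⟩))
        rwa [sub_add_cancel] at h2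
    · by_cases hex : ∃ l₀ < N, d l₀ = p ∧ e l₀ = i
      · obtain ⟨l₀, hl₀, hp₀, he₀⟩ := hex
        -- By `death_inj` all bars alive at i other than l₀ continue to i + 1. If x had a nonzero
        -- coefficient c at l₀, then z l₀ would be harmonic in K_{i+1}, contrary to its bar ending
        -- at i.
        have key : ∀ y ∈ Submodule.span ℝ (z '' {l | l < N ∧ d l = p ∧ b l ≤ i ∧ i ≤ e l}),
            ∃ c : ℝ, y - c • z l₀ ∈ F.harmonic (i + 1) p ⊓
              Submodule.span ℝ (z '' {l | l < N ∧ d l = p ∧ b l ≤ i + 1 ∧ i + 1 ≤ e l}) := by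
          intro y hy
          induction hy using Submodule.span_induction with
          | mem v hv =>
            obtain ⟨l, ⟨h1, h2, h3, h4⟩, rfl⟩ := hv
            by_cases hl : l = l₀
            · refine ⟨1, ?_⟩
              rw [hl, one_smul, sub_self]; exact zero_mem _
            · have h5 : i + 1 ≤ e l := by
                by_contra h5
                have h6 : e l = i := by omega
                exact hl (h.death_inj l h1 l₀ hl₀ (by omega) (by omega))
              refine ⟨0, ?_⟩
              rw [zero_smul, sub_zero]
              refine ⟨?_, Submodule.subset_span ⟨l, ⟨h1, h2, by omega, h5⟩, rfl⟩⟩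
              exact h2 ▸ (h.rep l h1).1.2.2.2.1 (i + 1) (by omega) h5
          | zero => exact ⟨0, by simp⟩
          | add a b _ _ ha hb =>
            obtain ⟨c, hc⟩ := ha
            obtain ⟨e, he⟩ := hb
            refine ⟨c + e, ?_⟩
            rw [add_smul, add_sub_add_comm]
            exact add_mem hc he
          | smul r a _ ha =>
            obtain ⟨c, hc⟩ := ha
            refine ⟨r * c, ?_⟩
            rw [mul_smul, ← smul_sub]
            exact Submodule.smul_mem _ _ hc
        obtain ⟨c, hc⟩ := key x (ih x (hle p hx))
        by_cases hc0 : c = 0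
        · rw [hc0, zero_smul, sub_zero] at hc
          exact hc.2
        · exfalso
          have hr := h.rep l₀ hl₀
          rw [hp₀, he₀] at hr
          refine hr.2 hi' ?_
          have h1 := Submodule.smul_mem _ c⁻¹ (sub_mem hx hc.1)
          rwa [sub_sub_cancel, smul_smul, inv_mul_cancel₀ hc0, one_smul] at h1
      · refine Submodule.span_mono (Set.image_mono ?_) (ih x (hle p hx))
        rintro l ⟨h1, h2, h3, h4⟩
        refine ⟨h1, h2, by omega, ?_⟩
        by_contra h5
        exact hex ⟨l, h1, h2, by omega⟩

theorem mem_homog (h : BarList F N d b e z) {l : ℕ} (hl : l < N) : z l ∈ F.homog (d l) :=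
  (mem_harmonic_iff.mp ((h.rep l hl).1.2.2.2.1 (b l) le_rfl (h.rep l hl).1.2.1)).2

/-- Common to the barcode of one degree and the barcode of all degrees: L selects the bars, and S
only has to agree with the harmonic groups on homogeneous chains of the selected degrees. -/
theorem isBarcode_ofList (h : BarList F N d b e z) {L : List ℕ} (hL : L.Nodup)
    (hN : ∀ l ∈ L, l < N) {S : ℕ → Submodule ℝ (Chain m)}
    (hS : ∀ i < m, S i ≤ S (i + 1) ∨ S (i + 1) ≤ S i)
    (hle : ∀ l ∈ L, ∀ i, F.harmonic i (d l) ≤ S i)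
    (hge : ∀ l ∈ L, ∀ i, ∀ x ∈ S i, x ∈ F.homog (d l) → x ∈ F.harmonic i (d l))
    (hspan : ∀ i ≤ m, ∀ x ∈ S i, x ∈ Submodule.span ℝ (z '' {l | l ∈ L ∧ b l ≤ i ∧ i ≤ e l})) :
    (ZigzagModule.ofSubspaces m S hS).IsBarcode ((L.map fun l => (b l, e l) : List (ℕ × ℕ)) :
      Multiset (ℕ × ℕ)) := by
  have hr : ∀ a : Fin L.length, F.IsRep (d (L.get a)) (b (L.get a)) (e (L.get a)) (z (L.get a)) :=
    fun a => h.rep _ (hN _ (L.get_mem a))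
  have hh : ∀ a : Fin L.length, z (L.get a) ∈ F.homog (d (L.get a)) :=
    fun a => h.mem_homog (hN _ (L.get_mem a))
  have key := ZigzagModule.isBarcode_ofSubspaces (n := m) (r := L.length) hS
    (I := fun a => (b (L.get a), e (L.get a))) (z := fun a => z (L.get a))
    (fun a => ⟨(hr a).1.1, (hr a).1.2.1, (hr a).1.2.2.1⟩)
    (fun a i h1 h2 => hle _ (L.get_mem a) i ((hr a).1.2.2.2.1 i h1 h2))
    (fun a hm => (hr a).1.2.2.2.2 (hge _ (L.get_mem a) _ _ hm (hh a)))
    (fun a hlt hm => (hr a).2 hlt (hge _ (L.get_mem a) _ _ hm (hh a)))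
    (by
      -- The pivots are the births minus one, and births are distinct across all degrees.
      refine linearIndependent_of_pivots ?_
      choose f hf hp using fun a => (hr a).1.isPivot
      refine ⟨f, fun a a' haa => ?_, hp⟩
      have h1 := h.birth_inj _ (hN _ (L.get_mem a)) _ (hN _ (L.get_mem a'))
        (by rw [← hf a, ← hf a', haa])
      exact hL.injective_get h1)
    (fun i hi x hx => by
      refine Submodule.span_mono ?_ (hspan i hi x hx)
      rintro _ ⟨l, ⟨h1, h2⟩, rfl⟩
      obtain ⟨a, rfl⟩ := List.get_of_mem h1
      exact ⟨a, h2, rfl⟩)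
  rw [Fin.univ_val_map] at key
  convert key using 2
  refine List.ext_getElem (by simp) fun k h1 h2 => ?_
  simp

theorem isBarcode (h : BarList F N d b e z) (p : ℕ) :
    (F.harmonicZigzag p).IsBarcode
      (((Multiset.range N).filter fun l => d l = p).map fun l => (b l, e l)) := by
  refine h.isBarcode_ofList (L := (List.range N).filter fun l => d l = p)
    (List.nodup_range.filter _) (fun l hl => ?_) _ (fun l hl i => ?_) (fun l hl i x hx _ => ?_)
    (fun i hi x hx => ?_)
  · exact List.mem_range.mp (List.mem_filter.mp hl).1
  · rw [of_decide_eq_true (List.mem_filter.mp hl).2]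
  · rwa [of_decide_eq_true (List.mem_filter.mp hl).2]
  · refine Submodule.span_mono (Set.image_mono ?_) (h.mem_span p hi x hx)
    rintro l ⟨h1, h2, h3⟩
    exact ⟨List.mem_filter.mpr ⟨List.mem_range.mpr h1, decide_eq_true h2⟩, h3⟩

theorem isBarcode_all (h : BarList F N d b e z) :
    F.harmonicZigzagAll.IsBarcode ((Multiset.range N).map fun l => (b l, e l)) := by
  refine h.isBarcode_ofList (L := List.range N) List.nodup_range (fun l hl => List.mem_range.mp hl) _
    (fun l _ i => le_iSup (fun p => F.harmonic i p) (d l))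
    (fun l hl i x hx hp => mem_harmonic_of_mem_harmonicAll hx hp) (fun i hi x hx => ?_)
  refine (iSup_le fun p y hy => ?_ : F.harmonicAll i ≤ _) hx
  refine Submodule.span_mono (Set.image_mono ?_) (h.mem_span p hi y hy)
  rintro l ⟨h1, -, h3⟩
  exact ⟨List.mem_range.mpr h1, h3⟩

end BarList

end

/-! ### Births and deaths at one insertion, and the invariant of the memory -/

noncomputable section

open SimplexwiseFiltration

namespace IsReduced

variable {m : ℕ} {F : SimplexwiseFiltration m} {i n : ℕ} {hi : i < m} {d : ℕ → ℕ} {C : ℕ → Chain m}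
  {own : ℕ → ℕ} {x : Chain m}

theorem harmonic_le_of_boundary_eq_zero (hx : IsReduced F i hi n C own x) (hC : CobInv F i n d C own)
    (hr : F.boundary x = 0) (p : ℕ) : F.harmonic i p ≤ F.harmonic (i + 1) p := fun y hy => by
  rw [mem_harmonic_iff] at hy ⊢
  exact ⟨hx.harm_le_of_boundary_eq_zero hC hr hy.1, hy.2⟩

/-- A chain of another degree has no entry at the new simplex, so only the degree of that simplex
can grow, and there x is new. -/
theorem isBirth_iff_of_boundary_eq_zero (hx : IsReduced F i hi n C own x)
    (hC : CobInv F i n d C own) (hr : F.boundary x = 0) (p : ℕ) :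
    F.IsBirth p (i + 1) ↔ p = F.dim ⟨i, hi⟩ := by
  rw [IsBirth, Nat.add_sub_cancel]
  constructor
  · rintro ⟨-, hlt⟩
    by_contra hne
    refine hlt.not_ge fun y hy => harmonic_of_apply_eq_zero hi hy ?_
    exact (mem_harmonic_iff.mp hy).2 _ fun h => hne h.symm
  · rintro rfl
    refine ⟨Nat.succ_pos i, lt_of_le_of_ne (hx.harmonic_le_of_boundary_eq_zero hC hr _) fun he => ?_⟩
    have h1 : x ∈ F.harmonic (i + 1) (F.dim ⟨i, hi⟩) :=
      mem_harmonic_iff.mpr ⟨hx.mem_harm_of_boundary_eq_zero hC hr, hx.homog⟩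
    rw [← he] at h1
    have h2 := (mem_harmonic_iff.mp h1).1.1.1 ⟨i, hi⟩ le_rfl
    rw [hx.apply_eq_one hC] at h2
    exact one_ne_zero h2

theorem not_isDeath_of_boundary_eq_zero (hx : IsReduced F i hi n C own x)
    (hC : CobInv F i n d C own) (hr : F.boundary x = 0) (p : ℕ) : ¬ F.IsDeath p i :=
  fun h => h.not_ge (hx.harmonic_le_of_boundary_eq_zero hC hr p)

theorem harmonic_le_of_boundary_ne_zero (hx : IsReduced F i hi n C own x) (hC : CobInv F i n d C own)
    (hr : F.boundary x ≠ 0) (p : ℕ) : F.harmonic (i + 1) p ≤ F.harmonic i p := fun y hy => by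
  rw [mem_harmonic_iff] at hy ⊢
  exact ⟨((hx.mem_harm_succ_iff hC hr).mp hy.1).1, hy.2⟩

theorem not_isBirth_of_boundary_ne_zero (hx : IsReduced F i hi n C own x)
    (hC : CobInv F i n d C own) (hr : F.boundary x ≠ 0) (p : ℕ) : ¬ F.IsBirth p (i + 1) :=
  fun h => h.2.not_ge (hx.harmonic_le_of_boundary_ne_zero hC hr p)

/-- The boundary of x is homogeneous of degree q, so harmonic chains of other degrees satisfy the
new condition automatically, while h violates it. -/
theorem isDeath_iff_of_boundary_ne_zero (hx : IsReduced F i hi n C own x)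
    (hC : CobInv F i n d C own) (hr : F.boundary x ≠ 0) {q : ℕ} {h : Chain m} (hh : h ∈ F.harm i)
    (hq : h ∈ F.homog q) (h0 : h ⬝ᵥ F.boundary x ≠ 0) (p : ℕ) : F.IsDeath p i ↔ p = q := by
  have hq1 := hx.degree_of_dotProduct_ne_zero hq h0
  constructor
  · intro hlt
    by_contra hne
    refine hlt.not_ge fun y hy => ?_
    rw [mem_harmonic_iff] at hy ⊢
    refine ⟨(hx.mem_harm_succ_iff hC hr).mpr ⟨hy.1, ?_⟩, hy.2⟩
    exact dotProduct_eq_zero_of_homog hne hy.2 (boundary_mem_homog (hq1 ▸ hx.homog))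
  · rintro rfl
    refine lt_of_le_of_ne (hx.harmonic_le_of_boundary_ne_zero hC hr _) fun he => ?_
    have h1 : h ∈ F.harmonic i p := mem_harmonic_iff.mpr ⟨hh, hq⟩
    rw [← he] at h1
    exact h0 ((hx.mem_harm_succ_iff hC hr).mp (mem_harmonic_iff.mp h1).1).2

end IsReduced

/-- The bars found in the first `i` insertions, with degrees `d`, births `b`, ends `e` and
representatives `z`, when the unpaired births are `bH j` in degree `dH j`. -/
structure BarInv {m : ℕ} (F : SimplexwiseFiltration m) (i nH : ℕ) (dH bH : ℕ → ℕ) (N : ℕ)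
    (d b e : ℕ → ℕ) (z : ℕ → Chain m) : Prop where
  rep : ∀ l < N, e l < i ∧ F.IsRep (d l) (b l) (e l) (z l)
  death : ∀ p k, (∃ l < N, d l = p ∧ e l = k) ↔ k < i ∧ F.IsDeath p k
  death_inj : ∀ l < N, ∀ l' < N, e l = e l' → l = l'
  birth : ∀ p k, ((∃ j < nH, dH j = p ∧ bH j = k) ∨ ∃ l < N, d l = p ∧ b l = k) ↔
    k ≤ i ∧ F.IsBirth p k
  birth_inj : ∀ l < N, ∀ l' < N, b l = b l' → l = l'
  birth_ne : ∀ j < nH, ∀ l < N, bH j ≠ b l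

namespace BarInv

variable {m : ℕ} {F : SimplexwiseFiltration m} {i nH N : ℕ} {dH bH d b e : ℕ → ℕ} {z : ℕ → Chain m}

theorem of_birth (h : BarInv F i nH dH bH N d b e z) (hi : i < m)
    (hb : ∀ p, F.IsBirth p (i + 1) ↔ p = F.dim ⟨i, hi⟩) (hd : ∀ p, ¬ F.IsDeath p i) {dH' bH' : ℕ → ℕ}
    (hdH : ∀ j < nH, dH' j = dH j) (hbH : ∀ j < nH, bH' j = bH j) (hdn : dH' nH = F.dim ⟨i, hi⟩)
    (hbn : bH' nH = i + 1) : BarInv F (i + 1) (nH + 1) dH' bH' N d b e z := by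
  refine ⟨fun l hl => ⟨(h.rep l hl).1.trans (Nat.lt_succ_self i), (h.rep l hl).2⟩, fun p k => ?_,
    h.death_inj, fun p k => ?_, h.birth_inj, fun j hj l hl => ?_⟩
  · rw [h.death]
    constructor
    · rintro ⟨h1, h2⟩; exact ⟨h1.trans (Nat.lt_succ_self i), h2⟩
    · rintro ⟨h1, h2⟩
      refine ⟨lt_of_le_of_ne (Nat.lt_succ_iff.mp h1) ?_, h2⟩
      rintro rfl
      exact hd p h2
  · have h1 := h.birth p k
    constructor
    · rintro (⟨j, hj, h2, h3⟩ | h2)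
      · rcases Nat.lt_succ_iff_lt_or_eq.mp hj with hlt | rfl
        · rw [hdH j hlt] at h2
          rw [hbH j hlt] at h3
          have h4 := h1.mp (Or.inl ⟨j, hlt, h2, h3⟩)
          exact ⟨h4.1.trans (Nat.le_succ i), h4.2⟩
        · rw [hdn] at h2
          rw [hbn] at h3
          subst h3
          exact ⟨le_rfl, (hb p).mpr h2.symm⟩
      · have h4 := h1.mp (Or.inr h2)
        exact ⟨h4.1.trans (Nat.le_succ i), h4.2⟩
    · rintro ⟨h2, h3⟩
      rcases Nat.le_succ_iff.mp h2 with h4 | rfl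
      · rcases h1.mpr ⟨h4, h3⟩ with ⟨j, hj, h5, h6⟩ | h5
        · exact Or.inl ⟨j, Nat.lt_succ_of_lt hj, (hdH j hj).trans h5, (hbH j hj).trans h6⟩
        · exact Or.inr h5
      · exact Or.inl ⟨nH, Nat.lt_succ_self nH, by rw [hdn, (hb p).mp h3], hbn⟩
  · rcases Nat.lt_succ_iff_lt_or_eq.mp hj with hlt | rfl
    · rw [hbH j hlt]; exact h.birth_ne j hlt l hl
    · rw [hbn]
      have := ((h.birth (d l) (b l)).mp (Or.inr ⟨l, hl, rfl, rfl⟩)).1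
      omega

theorem of_death (h : BarInv F i (nH + 1) dH bH N d b e z) {j₀ : ℕ} (hj₀ : j₀ < nH + 1)
    (hmono : ∀ j j', j < j' → j' < nH + 1 → bH j < bH j')
    (hb : ∀ p, ¬ F.IsBirth p (i + 1)) (hd : ∀ p, F.IsDeath p i ↔ p = dH j₀) {dH' bH' : ℕ → ℕ}
    (hdH : ∀ j < j₀, dH' j = dH j) (hbH : ∀ j < j₀, bH' j = bH j)
    (hdH' : ∀ j, j₀ ≤ j → j < nH → dH' j = dH (j + 1))
    (hbH' : ∀ j, j₀ ≤ j → j < nH → bH' j = bH (j + 1)) {d' b' e' : ℕ → ℕ} {z' : ℕ → Chain m}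
    (hd' : ∀ l < N, d' l = d l) (hb' : ∀ l < N, b' l = b l) (he' : ∀ l < N, e' l = e l)
    (hz' : ∀ l < N, z' l = z l) (hdN : d' N = dH j₀) (hbN : b' N = bH j₀) (heN : e' N = i)
    (hrep : F.IsRep (dH j₀) (bH j₀) i (z' N)) :
    BarInv F (i + 1) nH dH' bH' (N + 1) d' b' e' z' := by
  have hinj : ∀ j < nH + 1, j ≠ j₀ → bH j ≠ bH j₀ := by
    intro j hj hne
    rcases lt_or_gt_of_ne hne with h1 | h1
    · exact (hmono j j₀ h1 hj₀).ne
    · exact (hmono j₀ j h1 hj).ne'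
  -- Together, `hold` and `hnew` say that the new positions enumerate exactly the old positions
  -- other than j₀.
  have hold : ∀ j < nH, ∃ j' < nH + 1, j' ≠ j₀ ∧ dH' j = dH j' ∧ bH' j = bH j' := by
    intro j hj
    rcases lt_or_ge j j₀ with h1 | h1
    · exact ⟨j, by omega, h1.ne, hdH j h1, hbH j h1⟩
    · exact ⟨j + 1, by omega, by omega, hdH' j h1 hj, hbH' j h1 hj⟩
  have hnew : ∀ j' < nH + 1, j' ≠ j₀ → ∃ j < nH, dH' j = dH j' ∧ bH' j = bH j' := by
    intro j' hj' hne
    rcases lt_or_gt_of_ne hne with h1 | h1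
    · exact ⟨j', by omega, hdH j' h1, hbH j' h1⟩
    · obtain ⟨j, rfl⟩ : ∃ j, j' = j + 1 := ⟨j' - 1, by omega⟩
      exact ⟨j, by omega, hdH' j (by omega) (by omega), hbH' j (by omega) (by omega)⟩
  refine ⟨fun l hl => ?_, fun p k => ?_, fun l hl l' hl' hll => ?_, fun p k => ?_,
    fun l hl l' hl' hll => ?_, fun j hj l hl => ?_⟩
  · rcases Nat.lt_succ_iff_lt_or_eq.mp hl with hlt | rfl
    · rw [hd' l hlt, hb' l hlt, he' l hlt, hz' l hlt]
      exact ⟨(h.rep l hlt).1.trans (Nat.lt_succ_self i), (h.rep l hlt).2⟩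
    · rw [hdN, hbN, heN]
      exact ⟨Nat.lt_succ_self i, hrep⟩
  · have h1 := h.death p k
    constructor
    · rintro ⟨l, hl, h2, h3⟩
      rcases Nat.lt_succ_iff_lt_or_eq.mp hl with hlt | rfl
      · rw [hd' l hlt] at h2
        rw [he' l hlt] at h3
        have h4 := h1.mp ⟨l, hlt, h2, h3⟩
        exact ⟨h4.1.trans (Nat.lt_succ_self i), h4.2⟩
      · rw [hdN] at h2
        rw [heN] at h3
        subst h3
        exact ⟨Nat.lt_succ_self _, (hd p).mpr h2.symm⟩
    · rintro ⟨h2, h3⟩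
      rcases Nat.lt_succ_iff_lt_or_eq.mp h2 with h4 | rfl
      · obtain ⟨l, hl, h5, h6⟩ := h1.mpr ⟨h4, h3⟩
        exact ⟨l, Nat.lt_succ_of_lt hl, (hd' l hl).trans h5, (he' l hl).trans h6⟩
      · exact ⟨N, Nat.lt_succ_self N, by rw [hdN, (hd p).mp h3], heN⟩
  · rcases Nat.lt_succ_iff_lt_or_eq.mp hl with hlt | rfl <;>
      rcases Nat.lt_succ_iff_lt_or_eq.mp hl' with hlt' | rfl
    · rw [he' l hlt, he' l' hlt'] at hll
      exact h.death_inj l hlt l' hlt' hll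
    · rw [he' l hlt, heN] at hll
      have := (h.rep l hlt).1
      omega
    · rw [he' l' hlt', heN] at hll
      have := (h.rep l' hlt').1
      omega
    · rfl
  · have h1 := h.birth p k
    -- Nothing is born at i + 1, so the set of births is unchanged; the birth of column j₀ merely
    -- moves from the unpaired to the paired ones.
    have h5 : k ≤ i + 1 ∧ F.IsBirth p k ↔ k ≤ i ∧ F.IsBirth p k := by
      refine ⟨fun ⟨h2, h3⟩ => ⟨?_, h3⟩, fun ⟨h2, h3⟩ => ⟨h2.trans (Nat.le_succ i), h3⟩⟩
      rcases Nat.le_succ_iff.mp h2 with h4 | rfl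
      · exact h4
      · exact absurd h3 (hb p)
    rw [h5, ← h1]
    constructor
    · rintro (⟨j, hj, h2, h3⟩ | ⟨l, hl, h2, h3⟩)
      · obtain ⟨j', hj', -, h6, h7⟩ := hold j hj
        exact Or.inl ⟨j', hj', h6 ▸ h2, h7 ▸ h3⟩
      · rcases Nat.lt_succ_iff_lt_or_eq.mp hl with hlt | rfl
        · exact Or.inr ⟨l, hlt, hd' l hlt ▸ h2, hb' l hlt ▸ h3⟩
        · exact Or.inl ⟨j₀, hj₀, hdN ▸ h2, hbN ▸ h3⟩
    · rintro (⟨j', hj', h2, h3⟩ | ⟨l, hl, h2, h3⟩)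
      · by_cases hne : j' = j₀
        · subst hne
          exact Or.inr ⟨N, Nat.lt_succ_self N, hdN.trans h2, hbN.trans h3⟩
        · obtain ⟨j, hj, h6, h7⟩ := hnew j' hj' hne
          exact Or.inl ⟨j, hj, h6.trans h2, h7.trans h3⟩
      · exact Or.inr ⟨l, Nat.lt_succ_of_lt hl, (hd' l hl).trans h2, (hb' l hl).trans h3⟩
  · rcases Nat.lt_succ_iff_lt_or_eq.mp hl with hlt | rfl <;>
      rcases Nat.lt_succ_iff_lt_or_eq.mp hl' with hlt' | rfl
    · rw [hb' l hlt, hb' l' hlt'] at hll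
      exact h.birth_inj l hlt l' hlt' hll
    · rw [hb' l hlt, hbN] at hll
      exact absurd hll.symm (h.birth_ne j₀ hj₀ l hlt)
    · rw [hb' l' hlt', hbN] at hll
      exact absurd hll (h.birth_ne j₀ hj₀ l' hlt')
    · rfl
  · obtain ⟨j', hj', hne, -, h7⟩ := hold j hj
    rw [h7]
    rcases Nat.lt_succ_iff_lt_or_eq.mp hl with hlt | rfl
    · rw [hb' l hlt]; exact h.birth_ne j' hj' l hlt
    · rw [hbN]; exact hinj j' hj' hne

/-- The unpaired births give the bars that extend to the end. -/
theorem barList (h : BarInv F m nH dH bH N d b e z) {H : ℕ → Chain m}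
    (hH : HarmInv F m nH dH bH H) {d' b' e' : ℕ → ℕ} {z' : ℕ → Chain m}
    (hd' : ∀ l < N, d' l = d l) (hb' : ∀ l < N, b' l = b l) (he' : ∀ l < N, e' l = e l)
    (hz' : ∀ l < N, z' l = z l) (hdN : ∀ j < nH, d' (N + j) = dH j)
    (hbN : ∀ j < nH, b' (N + j) = bH j) (heN : ∀ j < nH, e' (N + j) = m)
    (hzN : ∀ j < nH, z' (N + j) = H j) : BarList F (N + nH) d' b' e' z' := by
  have hcase : ∀ l < N + nH, l < N ∨ ∃ j < nH, l = N + j := fun l hl => by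
    rcases lt_or_ge l N with h1 | h1
    · exact Or.inl h1
    · exact Or.inr ⟨l - N, by omega, by omega⟩
  refine ⟨fun l hl => ?_, fun p k hk hb => ?_, fun l hl l' hl' hll => ?_,
    fun l hl l' hl' hlm hll => ?_⟩
  · rcases hcase l hl with h1 | ⟨j, hj, rfl⟩
    · rw [hd' l h1, hb' l h1, he' l h1, hz' l h1]; exact (h.rep l h1).2
    · rw [hdN j hj, hbN j hj, heN j hj, hzN j hj]
      obtain ⟨k, hk, hp⟩ := hH.pivot j hj
      rw [← hk]
      exact ⟨isPartialRep_of_isPivot le_rfl (hH.mem j hj) (hH.homog j hj) hp,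
        fun h => absurd h (lt_irrefl m)⟩
  · rcases (h.birth p k).mpr ⟨hk, hb⟩ with ⟨j, hj, h1, h2⟩ | ⟨l, hl, h1, h2⟩
    · exact ⟨N + j, by omega, (hdN j hj).trans h1, (hbN j hj).trans h2⟩
    · exact ⟨l, by omega, (hd' l hl).trans h1, (hb' l hl).trans h2⟩
  · rcases hcase l hl with h1 | ⟨j, hj, rfl⟩ <;> rcases hcase l' hl' with h2 | ⟨j', hj', rfl⟩
    · rw [hb' l h1, hb' l' h2] at hll; exact h.birth_inj l h1 l' h2 hll
    · rw [hb' l h1, hbN j' hj'] at hll; exact absurd hll.symm (h.birth_ne j' hj' l h1)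
    · rw [hb' l' h2, hbN j hj] at hll; exact absurd hll (h.birth_ne j hj l' h2)
    · rw [hbN j hj, hbN j' hj'] at hll
      rcases lt_trichotomy j j' with h3 | rfl | h3
      · exact absurd hll (hH.mono j j' h3 hj').ne
      · rfl
      · exact absurd hll (hH.mono j' j h3 hj).ne'
  · rcases hcase l hl with h1 | ⟨j, hj, rfl⟩
    · rcases hcase l' hl' with h2 | ⟨j', hj', rfl⟩
      · rw [he' l h1, he' l' h2] at hll; exact h.death_inj l h1 l' h2 hll
      · rw [hll, heN j' hj'] at hlm; exact absurd hlm (lt_irrefl m)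
    · rw [heN j hj] at hlm; exact absurd hlm (lt_irrefl m)

end BarInv

/-! ### The contents of the memory -/

/-- Entry `(0,k)` is `j + 1` if `k` is the pivot of the `j`-th column of BoC, and `0` if there is no
such column. -/
abbrev NatArray.own : NatArray := .scratch 4

/-- The contents of the memory after `i` insertions. -/
structure MemInv {m : ℕ} (F : SimplexwiseFiltration m) (i : ℕ) (s : State) : Prop where
  size_eq : s.nat .size 0 0 = m
  iter_eq : s.nat .iter 0 0 = i
  le : i ≤ m
  numCob_le : s.nat .numCob 0 0 ≤ i
  numH_le : s.nat .numH 0 0 ≤ i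
  numR_eq : s.nat .numR 0 0 = s.nat .numCob 0 0
  degR_eq : ∀ j < s.nat .numCob 0 0, s.nat .degR j 0 + 1 = s.nat .degCob j 0
  cob : CobInv F i (s.nat .numCob 0 0) (fun j => s.nat .degCob j 0) (fun j => s.col .matCob m j)
    (fun k => s.nat .own 0 k)
  boc : ∀ j < s.nat .numCob 0 0, s.col .matBoC m j = F.boundary (s.col .matCob m j)
  matR : ∀ j < s.nat .numCob 0 0, s.col .matR m j = s.col .matBoC m j
  gram : ∀ j < s.nat .numCob 0 0, ∀ l < s.nat .numCob 0 0,
    s.real .matSC j l = s.col .matCob m j ⬝ᵥ s.col .matCob m l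
  harm : HarmInv F i (s.nat .numH 0 0) (fun j => s.nat .degH j 0) (fun j => s.nat .birthH j 0)
    (fun j => s.col .matH m j)
  bars : BarInv F i (s.nat .numH 0 0) (fun j => s.nat .degH j 0) (fun j => s.nat .birthH j 0)
    (s.nat .numBars 0 0) (fun l => s.nat .degBar l 0) (fun l => s.nat .birthBar l 0)
    (fun l => s.nat .deathBar l 0) (fun l => s.col .repBar m l)
  vertex_eq : s.nat .vertex = (inputState F).nat .vertex
  numVertices_eq : s.nat .numVertices = (inputState F).nat .numVertices

/-- A homogeneous vector in the span of homogeneous vectors is in the span of those of its degree. -/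
theorem mem_span_of_homog {m n p : ℕ} {F : SimplexwiseFiltration m} {v : ℕ → Chain m} {d : ℕ → ℕ}
    (hv : ∀ j < n, v j ∈ F.homog (d j)) {x : Chain m} (hx : x ∈ Submodule.span ℝ (v '' Set.Iio n))
    (hp : x ∈ F.homog p) :
    x ∈ Submodule.span ℝ (Set.range fun j : {j : ℕ // j < n ∧ d j = p} => v j) := by
  rw [← part_of_homog hp]
  clear hp
  induction hx using Submodule.span_induction with
  | mem y hy =>
    obtain ⟨j, hj, rfl⟩ := hy
    by_cases h : d j = p
    · rw [part_of_homog (h ▸ hv j hj)]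
      exact Submodule.subset_span ⟨⟨j, hj, h⟩, rfl⟩
    · rw [part_of_homog_ne (fun he => h he.symm) (hv j hj)]
      exact zero_mem _
  | zero => rw [map_zero]; exact zero_mem _
  | add a b _ _ ha hb => rw [map_add]; exact add_mem ha hb
  | smul r a _ ha => rw [map_smul]; exact Submodule.smul_mem _ _ ha

theorem isBasisOf_of_homog {m n p : ℕ} {F : SimplexwiseFiltration m} {v : ℕ → Chain m} {d : ℕ → ℕ}
    {S : Submodule ℝ (Chain m)} (hv : ∀ j < n, v j ∈ F.homog (d j))
    (hli : LinearIndependent ℝ fun j : {j : ℕ // j < n ∧ d j = p} => v j)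
    (hmem : ∀ j < n, d j = p → v j ∈ S)
    (hspan : ∀ x ∈ S, x ∈ Submodule.span ℝ (v '' Set.Iio n) ∧ x ∈ F.homog p) :
    IsBasisOf (fun j : {j : ℕ // j < n ∧ d j = p} => v j) S := by
  refine ⟨hli, le_antisymm (Submodule.span_le.mpr ?_) fun x hx => ?_⟩
  · rintro _ ⟨⟨j, hj, hd⟩, rfl⟩
    exact hmem j hj hd
  · exact mem_span_of_homog hv (hspan x hx).1 (hspan x hx).2

namespace CobInv

variable {m i n : ℕ} {F : SimplexwiseFiltration m} {d : ℕ → ℕ} {C : ℕ → Chain m} {own : ℕ → ℕ}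

theorem hasDistinctPivots (h : CobInv F i n d C own) {ι : Type} (f : ι → ℕ) (hf : ∀ a, f a < n)
    (hinj : Function.Injective f) : HasDistinctPivots fun a => F.boundary (C (f a)) := by
  choose g hg using fun a => h.pivot (f a) (hf a)
  refine ⟨g, fun a a' haa => hinj ?_, fun a => (h.own_pivot (g a) (f a) (hg a)).2⟩
  have h1 := hg a
  rw [haa, hg a'] at h1
  omega

/-- A vertex has zero boundary, so a column whose boundary has a pivot cannot have degree 0. This
matches the coboundaries of degree 0 being trivial. -/
theorem one_le_degree (h : CobInv F i n d C own) {j : ℕ} (hj : j < n) : 1 ≤ d j := by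
  obtain ⟨k, hk⟩ := h.pivot j hj
  have := boundary_ne_zero_dim (h.homog j hj) (h.own_pivot k j hk).2.1
  omega

theorem linearIndependent (h : CobInv F i n d C own) {ι : Type} (f : ι → ℕ) (hf : ∀ a, f a < n)
    (hinj : Function.Injective f) : LinearIndependent ℝ fun a => C (f a) :=
  LinearIndependent.of_comp F.boundary (linearIndependent_of_pivots (h.hasDistinctPivots f hf hinj))

/-- A chain and its component orthogonal to the cycles have the same boundary, and that component is
a coboundary. -/
theorem bd_mem_span (h : CobInv F i n d C own) {y : Chain m} (hy : y ∈ F.bd i) :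
    y ∈ Submodule.span ℝ ((fun j => F.boundary (C j)) '' Set.Iio n) := by
  obtain ⟨x, hx, rfl⟩ := hy
  obtain ⟨v, hv, hu⟩ := exists_sub_mem_perp (F.cyc i) x
  have hmem := h.span (x - v) ⟨sub_mem hx hv.1, hu⟩
  have h1 : F.boundary x = F.boundary (x - v) := by
    rw [map_sub, (mem_cyc.mp hv).2, sub_zero]
  rw [h1, ← Set.image_image, Submodule.span_image]
  exact Submodule.mem_map_of_mem hmem

end CobInv

theorem MemInv.maintained {m i : ℕ} {F : SimplexwiseFiltration m} {s : State} (h : MemInv F i s) :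
    Maintained F i s where
  size_eq := h.size_eq
  iter_eq := h.iter_eq
  bar_rep := by
    rintro l p b d ⟨hl, rfl, rfl, rfl⟩
    exact h.bars.rep l hl
  paired_deaths p d := by
    rw [← h.bars.death p d]
    constructor
    · rintro ⟨l, b, hl, h1, h2, h3⟩; exact ⟨l, hl, h1, h3⟩
    · rintro ⟨l, hl, h1, h3⟩; exact ⟨l, _, hl, h1, rfl, h3⟩
  unpaired_births p b := by
    rw [← h.bars.birth p b]
    constructor
    · rintro ⟨⟨j, hj, hd⟩, rfl⟩
      refine ⟨Or.inl ⟨j, hj, hd, rfl⟩, ?_⟩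
      rintro ⟨l, d, hl, -, h2, -⟩
      exact h.bars.birth_ne j hj l hl h2.symm
    · rintro ⟨⟨j, hj, hd, hb⟩ | ⟨l, hl, h1, h2⟩, h3⟩
      · exact ⟨⟨j, hj, hd⟩, hb⟩
      · exact absurd ⟨l, _, hl, h1, h2, rfl⟩ h3
  birth_injective p := by
    rintro ⟨j, hj, hd⟩ ⟨j', hj', hd'⟩ hjj
    refine Subtype.ext ?_
    rcases lt_trichotomy j j' with h1 | h1 | h1
    · exact absurd hjj (h.harm.mono j j' h1 hj').ne
    · exact h1
    · exact absurd hjj (h.harm.mono j' j h1 hj).ne'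
  H_rep := by
    rintro p ⟨j, hj, rfl⟩
    obtain ⟨k, hk, hp⟩ := h.harm.pivot j hj
    have := isPartialRep_of_isPivot h.le (h.harm.mem j hj) (h.harm.homog j hj) hp
    rwa [hk] at this
  H_basis p := by
    refine isBasisOf_of_homog (v := fun j => s.col .matH m j) (d := fun j => s.nat .degH j 0)
      h.harm.homog (linearIndependent_of_pivots ?_)
      (fun j hj hd => mem_harmonic_iff.mpr ⟨h.harm.mem j hj, hd ▸ h.harm.homog j hj⟩)
      (fun x hx => ⟨h.harm.span x (mem_harmonic_iff.mp hx).1, (mem_harmonic_iff.mp hx).2⟩)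
    choose g hg hp using fun a : s.IdxH p => h.harm.pivot a.1 a.2.1
    refine ⟨g, fun a a' haa => Subtype.ext ?_, hp⟩
    have h1 := hg a
    rw [haa, hg a'] at h1
    rcases lt_trichotomy a.1 a'.1 with h2 | h2 | h2
    · exact absurd h1.symm (h.harm.mono _ _ h2 a'.2.1).ne
    · exact h2
    · exact absurd h1 (h.harm.mono _ _ h2 a.2.1).ne
  R_basis p := by
    -- The stored R is a copy of BoC, so each of its columns is the boundary of the corresponding
    -- column of Cob.
    have hR : ∀ j < s.nat .numR 0 0, s.col .matR m j = F.boundary (s.col .matCob m j) := fun j hj => by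
      rw [h.numR_eq] at hj
      rw [h.matR j hj, h.boc j hj]
    have hhom : ∀ j < s.nat .numR 0 0, s.col .matR m j ∈ F.homog (s.nat .degR j 0) := fun j hj => by
      rw [hR j hj]
      rw [h.numR_eq] at hj
      exact boundary_mem_homog (by rw [h.degR_eq j hj]; exact h.cob.homog j hj)
    refine isBasisOf_of_homog (v := fun j => s.col .matR m j) (d := fun j => s.nat .degR j 0)
      hhom (linearIndependent_of_pivots ?_)
      (fun j hj hd => mem_boundaries_iff.mpr ⟨?_, hd ▸ hhom j hj⟩)
      (fun x hx => ⟨?_, (mem_boundaries_iff.mp hx).2⟩)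
    · have := h.cob.hasDistinctPivots (fun a : s.IdxR p => a.1) (fun a => h.numR_eq ▸ a.2.1)
        Subtype.val_injective
      convert this using 2 with a
      exact hR a.1 a.2.1
    · simp only [hR j hj]
      rw [h.numR_eq] at hj
      exact Submodule.mem_map_of_mem (h.cob.mem j hj).1
    · have h1 := h.cob.bd_mem_span (mem_boundaries_iff.mp hx).1
      rw [h.numR_eq]
      convert h1 using 2
      refine Set.image_congr fun j hj => ?_
      exact hR j (by rw [h.numR_eq]; exact hj)
  R_pivots p := by
    have := h.cob.hasDistinctPivots (fun a : s.IdxR p => a.1) (fun a => h.numR_eq ▸ a.2.1)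
      Subtype.val_injective
    convert this using 2 with a
    have ha : a.1 < s.nat .numCob 0 0 := h.numR_eq ▸ a.2.1
    rw [h.matR a ha, h.boc a ha]
  Cob_basis p := by
    refine isBasisOf_of_homog (v := fun j => s.col .matCob m j) (d := fun j => s.nat .degCob j 0)
      h.cob.homog (h.cob.linearIndependent (fun a : s.IdxCob p => a.1) (fun a => a.2.1)
        Subtype.val_injective) (fun j hj hd => ?_) (fun x hx => ?_)
    · cases p with
      | zero => have := h.cob.one_le_degree hj; omega
      | succ p => exact mem_coboundaries_iff.mpr ⟨h.cob.mem j hj, hd ▸ h.cob.homog j hj⟩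
    · cases p with
      | zero =>
        rw [show F.coboundaries i 0 = ⊥ from rfl, Submodule.mem_bot] at hx
        rw [hx]
        exact ⟨zero_mem _, zero_mem _⟩
      | succ p =>
        rw [mem_coboundaries_iff] at hx
        exact ⟨h.cob.span x hx.1, hx.2⟩
  SC_encodes := by
    rintro p ⟨j, hj, hd⟩
    have hmem : s.col .matCob m j ∈ F.coboundaries i (p + 1) :=
      mem_coboundaries_iff.mpr ⟨h.cob.mem j hj, hd ▸ h.cob.homog j hj⟩
    obtain ⟨φ, -, hφ⟩ := hmem
    -- Choose φ with δφ = Cob[j] and let ψ be the restriction of φ to boundaries. By adjointness its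
    -- value on R[l] = ∂Cob[l] is Cob[j] · Cob[l], which is the Gram entry kept in SC.
    refine ⟨(dotProductBilin ℝ ℝ φ).comp (F.boundaries i p).subtype, ?_, ?_⟩
    · rintro ⟨l, hl, -⟩ hR
      rw [h.numR_eq] at hl
      change φ ⬝ᵥ s.col .matR m l = s.real .matSC j l
      rw [h.gram j hj l hl, h.matR l hl, h.boc l hl, dotProduct_boundary φ (h.cob.mem l hl).1, hφ]
    · funext k
      rw [pseudoCoboundary]
      split_ifs with hk
      · change _ = φ ⬝ᵥ F.boundary (Pi.single k 1)
        rw [dotProduct_boundary φ (single_mem_supp hk.1), hφ, dotProduct_single_one]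
      · by_contra hne
        refine hk ⟨?_, ?_⟩
        · by_contra hlt
          exact hne ((h.cob.mem j hj).1 k (not_lt.mp hlt))
        · by_contra hdim
          exact hne (h.cob.homog j hj k fun he => hdim (he.trans hd))
  BoC_eq p j := h.boc j.1 j.2.1
  BoC_pivots p := by
    have := h.cob.hasDistinctPivots (fun a : s.IdxCob (p + 1) => a.1) (fun a => a.2.1)
      Subtype.val_injective
    convert this using 2 with a
    exact h.boc a.1 a.2.1

end

noncomputable section

/-! ### Incidence numbers from sorted lists of vertices -/

theorem card_filter_lt_orderEmbOfFin {σ : Finset ℕ} {c : ℕ} (h : σ.card = c) (r : Fin c) :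
    (σ.filter (· < σ.orderEmbOfFin h r)).card = r := by
  have : σ.filter (· < σ.orderEmbOfFin h r) =
      (Finset.univ.filter (· < r)).map (σ.orderEmbOfFin h).toEmbedding := by
    ext x
    simp only [Finset.mem_filter, Finset.mem_map, Finset.mem_univ, true_and]
    constructor
    · rintro ⟨hx, hlt⟩
      have hx' : x ∈ Set.range (σ.orderEmbOfFin h) := by rw [Finset.range_orderEmbOfFin]; exact hx
      obtain ⟨t, rfl⟩ := hx'
      exact ⟨t, (σ.orderEmbOfFin h).lt_iff_lt.mp hlt, rfl⟩
    · rintro ⟨t, ht, rfl⟩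
      exact ⟨Finset.orderEmbOfFin_mem σ h t, (σ.orderEmbOfFin h).lt_iff_lt.mpr ht⟩
  have hI : (Finset.univ.filter (· < r)) = Finset.Iio r := by ext; simp
  rw [this, Finset.card_map, hI, Fin.card_Iio]

/-- The increasing enumeration of a finite set is unique, and erasing the r-th element composes it
with `succAbove r`. -/
theorem eq_erase_orderEmbOfFin_iff {τ σ : Finset ℕ} {c : ℕ} (hτ : τ.card = c) (hσ : σ.card = c + 1)
    (r : Fin (c + 1)) : τ = σ.erase (σ.orderEmbOfFin hσ r) ↔
      ∀ t, τ.orderEmbOfFin hτ t = σ.orderEmbOfFin hσ (r.succAbove t) := by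
  constructor
  · intro he t
    have h := Finset.orderEmbOfFin_unique hτ (f := fun t => σ.orderEmbOfFin hσ (r.succAbove t))
      (fun t => by
        rw [he]
        refine Finset.mem_erase.mpr ⟨fun h => ?_, Finset.orderEmbOfFin_mem _ _ _⟩
        exact Fin.succAbove_ne r t ((σ.orderEmbOfFin hσ).injective h))
      (fun a b hab => (σ.orderEmbOfFin hσ).strictMono (Fin.strictMono_succAbove r hab))
    exact (congrFun h t).symm
  · intro h
    refine Finset.eq_of_subset_of_card_le (fun x hx => ?_) ?_
    · have hx' : x ∈ Set.range (τ.orderEmbOfFin hτ) := by rw [Finset.range_orderEmbOfFin]; exact hx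
      obtain ⟨t, rfl⟩ := hx'
      rw [h t]
      refine Finset.mem_erase.mpr ⟨fun he => ?_, Finset.orderEmbOfFin_mem _ _ _⟩
      exact Fin.succAbove_ne r t ((σ.orderEmbOfFin hσ).injective he)
    · rw [Finset.card_erase_of_mem (Finset.orderEmbOfFin_mem _ _ _), hσ, hτ]; simp

theorem incidence_eq_sum {τ σ : Finset ℕ} {c : ℕ} (hτ : τ.card = c) (hσ : σ.card = c + 1)
    {u v : ℕ → ℕ} (hu : ∀ t : Fin c, u t = τ.orderEmbOfFin hτ t)
    (hv : ∀ t : Fin (c + 1), v t = σ.orderEmbOfFin hσ t) :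
    incidence τ σ = ∑ r ∈ Finset.range (c + 1),
      if (∀ t < c, u t = v (if t < r then t else t + 1)) then (-1 : ℝ) ^ r else 0 := by
  have h1 : incidence τ σ = ∑ r : Fin (c + 1), if τ = σ.erase (σ.orderEmbOfFin hσ r) then
      (-1 : ℝ) ^ (r : ℕ) else 0 := by
    rw [incidence]
    conv_lhs => rw [← Finset.map_orderEmbOfFin_univ σ hσ, Finset.sum_map]
    refine Finset.sum_congr rfl fun r _ => ?_
    have h2 := card_filter_lt_orderEmbOfFin hσ r
    rw [Finset.map_orderEmbOfFin_univ]
    exact if_congr Iff.rfl (by rw [← h2]; rfl) rfl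
  rw [h1, ← Fin.sum_univ_eq_sum_range fun r =>
    if (∀ t < c, u t = v (if t < r then t else t + 1)) then (-1 : ℝ) ^ r else 0]
  refine Finset.sum_congr rfl fun r _ => if_congr ?_ rfl rfl
  rw [eq_erase_orderEmbOfFin_iff hτ hσ]
  have hs : ∀ t : Fin c, ((r.succAbove t : Fin (c + 1)) : ℕ) =
      if (t : ℕ) < r then (t : ℕ) else t + 1 := by
    intro t
    rw [Fin.succAbove]
    by_cases h : (t : ℕ) < r
    · rw [if_pos h, if_pos (Fin.lt_def.mpr h)]; rfl
    · rw [if_neg h, if_neg (fun h' => h (Fin.lt_def.mp h'))]; rfl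
  constructor
  · intro h t ht
    have := h ⟨t, ht⟩
    rw [← hu, ← hv, hs] at this
    exact this
  · intro h t
    rw [← hu, ← hv, hs]
    exact h t t.2

theorem incidence_eq_zero_of_card_ne {τ σ : Finset ℕ} (h : τ.card + 1 ≠ σ.card) :
    incidence τ σ = 0 := by
  by_contra h0
  obtain ⟨v, hv, rfl⟩ := exists_eq_erase_of_incidence_ne_zero h0
  exact h (Finset.card_erase_add_one hv)

/-- The sum of the signs `(-1)^r`, `r < q`, such that the first `q` entries of `u` are those of `v`
with the `r`-th entry removed. -/
def skipSum (u v : ℕ → ℕ) (q : ℕ) : ℝ :=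
  ∑ r ∈ Finset.range q, if (∀ t < q, u t = v (if t < r then t else t + 1)) then (-1 : ℝ) ^ r else 0

open Classical in
/-- The sign `(-1)^q` if the first `q` entries of `u` and `v` agree, and `0` otherwise. -/
def prefixSign (u v : ℕ → ℕ) (q : ℕ) : ℝ := if (∀ t < q, u t = v t) then (-1 : ℝ) ^ q else 0

theorem skipSum_add_prefixSign (u v : ℕ → ℕ) (q : ℕ) : skipSum u v q + prefixSign u v q =
    ∑ r ∈ Finset.range (q + 1),
      if (∀ t < q, u t = v (if t < r then t else t + 1)) then (-1 : ℝ) ^ r else 0 := by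
  rw [Finset.sum_range_succ, skipSum, prefixSign]
  congr 1
  refine if_congr (forall₂_congr fun t ht => ?_) rfl rfl
  rw [if_pos ht]

/-- For a removed position r ≤ q, entry q of u is matched with entry q + 1 of v. The case r = q asks
for agreement of the first q entries and brings in the prefix sign, so two numbers suffice for a
single pass. -/
theorem skipSum_succ (u v : ℕ → ℕ) (q : ℕ) :
    skipSum u v (q + 1) = if u q = v (q + 1) then skipSum u v q + prefixSign u v q else 0 := by
  rw [skipSum_add_prefixSign, skipSum]
  split_ifs with h
  · refine Finset.sum_congr rfl fun r hr => if_congr ⟨fun h1 t ht => h1 t (by omega), ?_⟩ rfl rfl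
    intro h1 t ht
    rcases Nat.lt_succ_iff_lt_or_eq.mp ht with h2 | rfl
    · exact h1 t h2
    · rw [if_neg (by have := Finset.mem_range.mp hr; omega), h]
  · refine Finset.sum_eq_zero fun r hr => if_neg fun h1 => h ?_
    have := h1 q (Nat.lt_succ_self q)
    rwa [if_neg (by have := Finset.mem_range.mp hr; omega)] at this

theorem prefixSign_succ (u v : ℕ → ℕ) (q : ℕ) :
    prefixSign u v (q + 1) = if u q = v q then 0 - prefixSign u v q else 0 := by
  rw [prefixSign, prefixSign]
  by_cases h : u q = v q
  · rw [if_pos h]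
    by_cases h1 : ∀ t < q, u t = v t
    · rw [if_pos h1, if_pos, pow_succ]
      · ring
      · intro t ht
        rcases Nat.lt_succ_iff_lt_or_eq.mp ht with h2 | rfl
        · exact h1 t h2
        · exact h
    · rw [if_neg h1, if_neg fun h2 => h1 fun t ht => h2 t (by omega), sub_zero]
  · rw [if_neg h, if_neg fun h2 => h (h2 q (Nat.lt_succ_self q))]

/-- Each vertex of a simplex is itself a simplex of the filtration. Hence a loop of length m covers
a whole vertex list. -/
theorem SimplexwiseFiltration.card_le {m : ℕ} (F : SimplexwiseFiltration m) (i : Fin m) :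
    (F.simplex i).card ≤ m := by
  have h : ∀ v ∈ F.simplex i, ∃ k, F.simplex k = {v} := by
    intro v hv
    by_cases he : ({v} : Finset ℕ) = F.simplex i
    · exact ⟨i, he.symm⟩
    · obtain ⟨j, -, hj⟩ := F.face_mem i {v} (Finset.singleton_nonempty v)
        (lt_of_le_of_ne (Finset.singleton_subset_iff.mpr hv) he)
      exact ⟨j, hj⟩
  have : Nonempty (Fin m) := ⟨i⟩
  choose! f hf using h
  have := Finset.card_le_card_of_injOn (s := F.simplex i) (t := Finset.univ) f
    (fun _ _ => Finset.mem_coe.mpr (Finset.mem_univ _)) (fun v hv w hw hvw => by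
      have h1 := hf v hv
      rw [hvw, hf w hw] at h1
      exact (Finset.singleton_injective h1).symm)
  simpa using this

theorem inputState_vertex {m : ℕ} (F : SimplexwiseFiltration m) (k : Fin m) {c : ℕ}
    (hc : (F.simplex k).card = c) (t : Fin c) :
    (inputState F).nat .vertex k t = (F.simplex k).orderEmbOfFin hc t := by
  simp [inputState, Finset.orderEmbOfFin_apply, hc]

theorem inputState_numVertices {m : ℕ} (F : SimplexwiseFiltration m) (k : Fin m) :
    (inputState F).nat .numVertices k 0 = (F.simplex k).card := by
  simp [inputState]

theorem incidence_eq_skipSum {m : ℕ} (F : SimplexwiseFiltration m) (k i : Fin m) :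
    incidence (F.simplex k) (F.simplex i) =
      if (F.simplex k).card + 1 = (F.simplex i).card then
        skipSum ((inputState F).nat .vertex k) ((inputState F).nat .vertex i) (F.simplex k).card +
          prefixSign ((inputState F).nat .vertex k) ((inputState F).nat .vertex i)
            (F.simplex k).card
      else 0 := by
  split_ifs with h
  · rw [skipSum_add_prefixSign]
    exact incidence_eq_sum rfl h.symm (fun t => inputState_vertex F k rfl t)
      (fun t => inputState_vertex F i h.symm t)
  · exact incidence_eq_zero_of_card_ne h

end

noncomputable section

/-! ### Operations on rows -/

namespace Prog

/-- Without an alternative. -/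
abbrev when (b : Test) (P : Prog) : Prog := .ite b P .skip

/-- `a[r,k] := e` for all `k`, the counter being the first working array. -/
def row (a : RealArray) (r : NatExpr) (e : RealExpr) : Prog := .up 1 (.real a r (.var 1) e)

/-- `a[0,c] := ∑ e` over all values of the counter, which is the first working array. -/
def total (a : RealArray) (c : NatExpr) (e : RealExpr) : Prog :=
  .seq (.real a (.const 0) c (.const 0)) (.up 1 (.real a (.const 0) c (.add (.get a (.const 0) c) e)))

/-- The hypothesis supplies the entries that round k still finds unchanged: all other rows, and row
R from position k on. So `e` may read the old value of the entry being overwritten. -/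
theorem run_row {m R : ℕ} {s : State} {a : RealArray} {r : NatExpr} {e : RealExpr} {v : ℕ → ℝ}
    (h : ∀ k < m, ∀ s' : State, s'.nat (.scratch 1) 0 0 = k →
      (∀ b, b ≠ .scratch 1 → s'.nat b = s.nat b) → (∀ b, b ≠ a → s'.real b = s.real b) →
      (∀ j l, j ≠ R ∨ k ≤ l → s'.real a j l = s.real a j l) → r.eval s' = R ∧ e.eval s' = v k)
    (j l : ℕ) : ((row a r e).run m s).real a j l = if j = R ∧ l < m then v l else s.real a j l := by
  refine run_up_induction (I := fun k s' => ∀ j l, s'.real a j l =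
    if j = R ∧ l < k then v l else s.real a j l) (fun j l => by simp [State.setNat]) ?_ j l
  intro k hk s' h1 h2 h3 h4 j l
  obtain ⟨h5, h6⟩ := h k hk s' h1 (fun b hb => h2 b (by simpa [natWrites] using hb))
    (fun b hb => h3 b (by simpa [realWrites] using hb)) (fun j l hjl => by
      rw [h4, if_neg]; omega)
  simp only [run, State.setNat, State.setReal, h5, h6, NatExpr.eval, h1, true_and]
  by_cases hj : j = R ∧ l = k
  · rw [if_pos hj, if_pos ⟨hj.1, by omega⟩, hj.2]
  · rw [if_neg hj, h4]
    exact if_congr (by omega) rfl rfl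

theorem run_row_nat {m : ℕ} {s : State} {a : RealArray} {r : NatExpr} {e : RealExpr} {b : NatArray}
    (hb : b ≠ .scratch 1) : ((row a r e).run m s).nat b = s.nat b :=
  run_nat_of_notMem m _ (by simpa [row, natWrites] using hb) s

theorem run_row_real {m : ℕ} {s : State} {a : RealArray} {r : NatExpr} {e : RealExpr}
    {b : RealArray} (hb : b ≠ a) : ((row a r e).run m s).real b = s.real b :=
  run_real_of_notMem m _ (by simpa [row, realWrites] using hb) s

theorem run_total {m c : ℕ} {s : State} {a : RealArray} {ce : NatExpr} {e : RealExpr} {v : ℕ → ℝ}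
    (hc : ∀ s' : State, (∀ b, b ≠ .scratch 1 → s'.nat b = s.nat b) → ce.eval s' = c)
    (h : ∀ k < m, ∀ s' : State, s'.nat (.scratch 1) 0 0 = k →
      (∀ b, b ≠ .scratch 1 → s'.nat b = s.nat b) → (∀ b, b ≠ a → s'.real b = s.real b) →
      e.eval s' = v k) (j l : ℕ) : ((total a ce e).run m s).real a j l =
        if j = 0 ∧ l = c then ∑ k ∈ Finset.range m, v k else s.real a j l := by
  rw [total, run]
  refine run_up_induction (I := fun k s' => ∀ j l, s'.real a j l =
    if j = 0 ∧ l = c then ∑ k ∈ Finset.range k, v k else s.real a j l) (fun j l => ?_) ?_ j l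
  · simp [run, State.setNat, State.setReal, hc s fun _ _ => rfl, NatExpr.eval, RealExpr.eval]
  · intro k hk s' h1 h2 h3 h4 j l
    have h2' : ∀ b, b ≠ .scratch 1 → s'.nat b = s.nat b := fun b hb => by
      rw [h2 b (by simpa [natWrites] using hb)]
      simp only [run, State.setReal]
    have h3' : ∀ b, b ≠ a → s'.real b = s.real b := fun b hb => by
      rw [h3 b (by simpa [realWrites] using hb)]
      simp only [run]
      exact setReal_real_of_ne hb
    have h5 := hc s' h2'
    have h6 := h k hk s' h1 h2' h3'
    simp only [run, State.setNat, State.setReal, h5, h6, NatExpr.eval, RealExpr.eval, true_and]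
    by_cases hj : j = 0 ∧ l = c
    · rw [if_pos hj, if_pos hj, h4, if_pos ⟨rfl, rfl⟩, Finset.sum_range_succ]
    · rw [if_neg hj, h4, if_neg hj, if_neg hj]

end Prog

/-! ### The algorithm -/

namespace Algorithm

open Prog

/-- The index of the new simplex. -/
abbrev new : NatExpr := .scalar .iter
/-- The position of the new column of Cob and BoC. -/
abbrev last : NatExpr := .scalar .numCob
/-- The number of columns of H. -/
abbrev numH : NatExpr := .scalar .numH
/-- The number of bars. -/
abbrev numBars : NatExpr := .scalar .numBars
/-- The counter of the outer loops. -/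
abbrev x : NatExpr := .var 0
/-- The counter of the inner loops. -/
abbrev y : NatExpr := .var 1
/-- One more than the pivot of the new column of BoC. -/
abbrev pivot : NatExpr := .var 2
/-- The first column of H that is not orthogonal to the new boundary. -/
abbrev first : NatExpr := .var 3
/-- The products of the columns of Cob with the new column. -/
abbrev prodC : RealArray := .scratch 0
/-- The products of the columns of H with the new boundary. -/
abbrev prodH : RealArray := .scratch 1
/-- A factor. -/
abbrev factor : RealArray := .scratch 2
/-- A sign. -/
abbrev sign : RealArray := .scratch 3
/-- The entry `(0,0)` of an array of real numbers. -/
abbrev value (a : RealArray) : RealExpr := .get a (.const 0) (.const 0)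
/-- Assignment to the entry `(0,0)`. -/
abbrev assign (a : RealArray) (e : RealExpr) : Prog := .real a (.const 0) (.const 0) e
/-- Assignment to the entry `(0,0)`. -/
abbrev assignNat (a : NatArray) (e : NatExpr) : Prog := .nat a (.const 0) (.const 0) e

/-- One comparison of vertices of the `x`-th and the new simplex. -/
def compareStep : Prog :=
  .when (.natLt y (.get .numVertices x (.const 0))) (.seq
    (.ite (.natEq (.get .vertex x y) (.get .vertex new (.succ y)))
      (assign factor (.add (value factor) (value sign))) (assign factor (.const 0)))
    (.ite (.natEq (.get .vertex x y) (.get .vertex new y))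
      (assign sign (.sub (.const 0) (value sign))) (assign sign (.const 0))))

/-- The incidence number of the `x`-th and the new simplex. -/
def incidenceStep : Prog :=
  .seq (assign factor (.const 0)) (.seq (assign sign (.const 1)) (.seq (.up 1 compareStep)
    (.ite (.natEq (.succ (.get .numVertices x (.const 0))) (.get .numVertices new (.const 0)))
      (.real .matBoC last x (.add (value factor) (value sign)))
      (.real .matBoC last x (.const 0)))))

/-- The new columns of BoC and Cob are the boundary of the new simplex and the new simplex. -/
def load : Prog :=
  .seq (.up 0 incidenceStep) (.seq (row .matCob last (.const 0)) (.real .matCob last new (.const 1)))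

/-- Clear the `x`-th entry of the new column of BoC. -/
def reduceStep : Prog :=
  .when (.and (.neg (.realEq (.get .matBoC last x) (.const 0)))
      (.neg (.natEq (.get .own (.const 0) x) (.const 0)))) (.seq
    (assign factor (.div (.get .matBoC last x) (.get .matBoC (.pred (.get .own (.const 0) x)) x)))
    (.seq
      (row .matCob last (.sub (.get .matCob last y)
        (.mul (value factor) (.get .matCob (.pred (.get .own (.const 0) x)) y))))
      (row .matBoC last (.sub (.get .matBoC last y)
        (.mul (value factor) (.get .matBoC (.pred (.get .own (.const 0) x)) y))))))

/-- Reduce the new column of BoC. -/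
def reduce : Prog := .down 0 reduceStep

/-- Multiply the columns of Cob with the new column. -/
def products : Prog :=
  .up 0 (total prodC x (.mul (.get .matCob x y) (.get .matCob last y)))

/-- Find the pivot of the new column of BoC. -/
def findPivot : Prog :=
  .seq (assignNat (.scratch 2) (.const 0))
    (.up 0 (.when (.neg (.realEq (.get .matBoC last x) (.const 0))) (assignNat (.scratch 2) (.succ x))))

/-- Make the `x`-th columns of SC and Cob orthogonal to the new harmonic chain. -/
def projectStep : Prog :=
  .seq (assign factor (.div (.get prodC (.const 0) x) (.get prodC (.const 0) last)))
    (.seq (row .matSC x (.sub (.get .matSC x y) (.mul (value factor) (.get prodC (.const 0) y))))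
      (row .matCob x (.sub (.get .matCob x y) (.mul (value factor) (.get .matH numH y)))))

/-- The insertion gives birth to a harmonic chain. -/
def birth : Prog :=
  .seq (row .matH numH (.get .matCob last y)) (.seq (.up 0 projectStep)
    (.seq (.nat .degH numH (.const 0) (.pred (.get .numVertices new (.const 0))))
      (.seq (.nat .birthH numH (.const 0) (.succ new)) (assignNat .numH (.succ numH)))))

/-- The new columns become part of the matrices. -/
def extend : Prog :=
  .seq (.nat .own (.const 0) (.pred pivot) (.succ last))
    (.seq (row .matR last (.get .matBoC last y))
      (.seq (row .matSC last (.get prodC (.const 0) y))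
        (.seq (.up 0 (.real .matSC x last (.get prodC (.const 0) x)))
          (.seq (.nat .degCob last (.const 0) (.pred (.get .numVertices new (.const 0))))
            (.nat .degR last (.const 0) (.pred (.pred (.get .numVertices new (.const 0)))))))))

/-- Find the first column of H that is not orthogonal to the new boundary. -/
def findFirst : Prog :=
  .seq (.up 0 (total prodH x (.mul (.get .matH x y) (.get .matBoC last y))))
    (.down 0 (.when (.and (.natLt x numH) (.neg (.realEq (.get prodH (.const 0) x) (.const 0))))
      (assignNat (.scratch 3) x)))

/-- Record a finished bar. -/
def recordBar (j d : NatExpr) : Prog :=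
  .seq (row .repBar numBars (.get .matH j y))
    (.seq (.nat .degBar numBars (.const 0) (.get .degH j (.const 0)))
      (.seq (.nat .birthBar numBars (.const 0) (.get .birthH j (.const 0)))
        (.nat .deathBar numBars (.const 0) d)))

/-- The `x`-th column of H becomes a combination of the next column with the finished bar. -/
def shiftStep : Prog :=
  .when (.neg (.natLt x first)) (.seq
    (assign factor (.div (.get prodH (.const 0) (.succ x)) (.get prodH (.const 0) first)))
    (.seq (row .matH x (.sub (.get .matH (.succ x) y) (.mul (value factor) (.get .repBar numBars y))))
      (.seq (.nat .degH x (.const 0) (.get .degH (.succ x) (.const 0)))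
        (.nat .birthH x (.const 0) (.get .birthH (.succ x) (.const 0))))))

/-- The counts after a death. -/
def recount : Prog :=
  .seq (assignNat .numH (.pred numH)) (.seq (assignNat .numBars (.succ numBars))
    (.seq (assignNat .numCob (.succ last)) (assignNat .numR (.succ (.scalar .numR)))))

/-- The insertion ends a bar. -/
def death : Prog :=
  .seq extend (.seq findFirst (.seq (recordBar first new) (.seq (.up 0 shiftStep) recount)))

/-- The step for one insertion. -/
def step : Prog :=
  .seq load (.seq reduce (.seq products (.seq findPivot
    (.seq (.ite (.natEq pivot (.const 0)) birth death) (assignNat .iter (.succ new))))))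

/-- The unpaired births become bars that extend to the end. -/
def final : Prog :=
  .up 0 (.when (.natLt x numH) (.seq (recordBar x (.scalar .size))
    (assignNat .numBars (.succ numBars))))

theorem wellFormed_step : step.WellFormed := by
  simp [step, load, reduce, products, findPivot, birth, death, extend, findFirst, recordBar, shiftStep,
    recount, projectStep, reduceStep, incidenceStep, compareStep, row, total, WellFormed, natWrites]

theorem wellFormed_final : final.WellFormed := by
  simp [final, recordBar, row, WellFormed, natWrites]

theorem size_notMem_step : .size ∉ step.natWrites := by
  simp [step, load, reduce, products, findPivot, birth, death, extend, findFirst, recordBar, shiftStep,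
    recount, projectStep, reduceStep, incidenceStep, compareStep, row, total, natWrites]

theorem size_notMem_final : .size ∉ final.natWrites := by
  simp [final, recordBar, row, natWrites]

theorem depth_step : step.depth = 2 := rfl

theorem depth_final : final.depth = 2 := rfl

end Algorithm

end

/-! ### Correctness of loading the new simplex -/

noncomputable section

open SimplexwiseFiltration

namespace Prog

theorem col_run_row {m R : ℕ} {s : State} {a : RealArray} {r : NatExpr} {e : RealExpr} {v : ℕ → ℝ}
    (h : ∀ k < m, ∀ s' : State, s'.nat (.scratch 1) 0 0 = k →
      (∀ b, b ≠ .scratch 1 → s'.nat b = s.nat b) → (∀ b, b ≠ a → s'.real b = s.real b) →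
      (∀ j l, j ≠ R ∨ k ≤ l → s'.real a j l = s.real a j l) → r.eval s' = R ∧ e.eval s' = v k) :
    (∀ j, j ≠ R → ((row a r e).run m s).real a j = s.real a j) ∧
      ((row a r e).run m s).col a m R = fun k : Fin m => v k := by
  refine ⟨fun j hj => ?_, ?_⟩
  · funext l; rw [run_row h, if_neg fun h => hj h.1]
  · funext k; rw [State.col, run_row h, if_pos ⟨rfl, k.2⟩]

end Prog

namespace Algorithm

open Prog

variable {m : ℕ} {F : SimplexwiseFiltration m} {i : ℕ}

theorem run_incidenceStep (hi : i < m) {k : ℕ} (hk : k < m) {s : State} (hit : s.nat .iter 0 0 = i)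
    (hx : s.nat (.scratch 0) 0 0 = k) (hv : s.nat .vertex = (inputState F).nat .vertex)
    (hnv : s.nat .numVertices = (inputState F).nat .numVertices) (j l : ℕ) :
    (incidenceStep.run m s).real .matBoC j l = if j = s.nat .numCob 0 0 ∧ l = k then
      incidence (F.simplex ⟨k, hk⟩) (F.simplex ⟨i, hi⟩) else s.real .matBoC j l := by
  set u := (inputState F).nat .vertex k with hu
  set v := (inputState F).nat .vertex i with hv'
  set c := (F.simplex ⟨k, hk⟩).card with hc
  have hck : (inputState F).nat .numVertices k 0 = c := inputState_numVertices F ⟨k, hk⟩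
  have hci : (inputState F).nat .numVertices i 0 = (F.simplex ⟨i, hi⟩).card :=
    inputState_numVertices F ⟨i, hi⟩
  set s₁ := (Prog.seq (assign factor (.const 0)) (assign sign (.const 1))).run m s with hs₁
  have hs₁n : s₁.nat = s.nat := by rw [hs₁]; rfl
  have hs₁r : s₁.real .matBoC = s.real .matBoC := by
    rw [hs₁]
    exact run_real_of_notMem m _ (by simp [realWrites]) s
  set s₂ := (Prog.up 1 compareStep).run m s₁ with hs₂
  have hs₂n : ∀ b, b ≠ .scratch 1 → s₂.nat b = s.nat b := fun b hb => by
    rw [← hs₁n, hs₂]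
    exact run_nat_of_notMem m _ (by simpa [natWrites, compareStep] using hb) s₁
  have hs₂r : s₂.real .matBoC = s.real .matBoC := by
    rw [← hs₁r, hs₂]
    exact run_real_of_notMem m _ (by simp [realWrites, compareStep]) s₁
  -- The guard makes rounds beyond the c vertices idle, hence the minimum. It equals c in the end,
  -- because a simplex has at most m vertices.
  have hloop : s₂.real factor 0 0 = skipSum u v (min m c) ∧
      s₂.real sign 0 0 = prefixSign u v (min m c) := by
    rw [hs₂]
    refine run_up_induction (I := fun q s' => s'.real factor 0 0 = skipSum u v (min q c) ∧
      s'.real sign 0 0 = prefixSign u v (min q c)) ?_ ?_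
    · simp [hs₁, run, State.setReal, State.setNat, skipSum, prefixSign, RealExpr.eval, NatExpr.eval]
    · intro q hq s' h1 h2 h3 ⟨h4, h5⟩
      have e1 : s'.nat .numVertices k 0 = c := by
        rw [h2 _ (by simp [natWrites, compareStep]), hs₁n, hnv, hck]
      have e2 : s'.nat (.scratch 0) 0 0 = k := by
        rw [h2 _ (by simp [natWrites, compareStep]), hs₁n, hx]
      have e3 : s'.nat .iter 0 0 = i := by
        rw [h2 _ (by simp [natWrites, compareStep]), hs₁n, hit]
      have e4 : s'.nat .vertex = (inputState F).nat .vertex := by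
        rw [h2 _ (by simp [natWrites, compareStep]), hs₁n, hv]
      by_cases hqc : q < c
      · rw [min_eq_left hqc.le] at h4 h5
        rw [min_eq_left (Nat.succ_le_of_lt hqc), skipSum_succ, prefixSign_succ]
        by_cases h6 : u q = v (q + 1) <;> by_cases h7 : u q = v q <;>
          simp [compareStep, run, Test.Holds, NatExpr.eval, RealExpr.eval, State.setReal,
            State.setNat, e1, e2, e3, e4, h1, hqc, h4, h5, ← hu, ← hv', h6, h7, -zero_sub]
        all_goals
          try rw [← h6] at h7 ⊢
          try simp_all
      · rw [min_eq_right (not_lt.mp hqc)] at h4 h5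
        rw [min_eq_right ((not_lt.mp hqc).trans (Nat.le_succ q))]
        simp [compareStep, run, Test.Holds, NatExpr.eval, e1, e2, h1, hqc, h4, h5, State.setNat]
  rw [min_eq_right (F.card_le ⟨k, hk⟩)] at hloop
  have hrun : incidenceStep.run m s = (Prog.ite (.natEq (.succ (.get .numVertices x (.const 0)))
      (.get .numVertices new (.const 0))) (.real .matBoC last x (.add (value factor) (value sign)))
      (.real .matBoC last x (.const 0))).run m s₂ := rfl
  have e1 : s₂.nat .numVertices = (inputState F).nat .numVertices := by rw [hs₂n _ (by simp), hnv]
  have e2 : s₂.nat (.scratch 0) 0 0 = k := by rw [hs₂n _ (by simp), hx]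
  have e3 : s₂.nat .iter 0 0 = i := by rw [hs₂n _ (by simp), hit]
  have e4 : s₂.nat .numCob = s.nat .numCob := hs₂n _ (by simp)
  rw [hrun, incidence_eq_skipSum F ⟨k, hk⟩ ⟨i, hi⟩]
  by_cases h : c + 1 = (F.simplex ⟨i, hi⟩).card
  · simp [run, Test.Holds, NatExpr.eval, RealExpr.eval, e1, e2, e3, e4, hck, hci, h, State.setReal,
      hs₂r, hloop, ← hc, ← hu, ← hv']
  · simp [run, Test.Holds, NatExpr.eval, RealExpr.eval, e1, e2, e3, e4, hck, hci, h, State.setReal,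
      hs₂r, ← hc]

theorem load_spec (hi : i < m) {s : State} (hit : s.nat .iter 0 0 = i)
    (hv : s.nat .vertex = (inputState F).nat .vertex)
    (hnv : s.nat .numVertices = (inputState F).nat .numVertices) :
    (∀ j, j ≠ s.nat .numCob 0 0 → (load.run m s).real .matBoC j = s.real .matBoC j ∧
      (load.run m s).real .matCob j = s.real .matCob j) ∧
    (load.run m s).col .matCob m (s.nat .numCob 0 0) = Pi.single ⟨i, hi⟩ 1 ∧
    (load.run m s).col .matBoC m (s.nat .numCob 0 0) = F.boundary (Pi.single ⟨i, hi⟩ 1) := by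
  set n := s.nat .numCob 0 0 with hn
  set s₁ := (Prog.up 0 incidenceStep).run m s with hs₁
  have hs₁n : ∀ b, b ≠ .scratch 0 → b ≠ .scratch 1 → s₁.nat b = s.nat b := fun b hb hb' => by
    rw [hs₁]
    exact run_nat_of_notMem m _
      (by simpa [natWrites, incidenceStep, compareStep] using ⟨hb, hb'⟩) s
  have hs₁r : s₁.real .matCob = s.real .matCob := by
    rw [hs₁]
    exact run_real_of_notMem m _ (by simp [realWrites, incidenceStep, compareStep]) s
  have hboc : ∀ j l, s₁.real .matBoC j l = if h : j = n ∧ l < m then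
      incidence (F.simplex ⟨l, h.2⟩) (F.simplex ⟨i, hi⟩) else s.real .matBoC j l := by
    have key := run_up_induction (m := m) (x := 0) (P := incidenceStep) (s := s)
      (I := fun k s' => k ≤ m → ∀ j l, s'.real .matBoC j l = if h : j = n ∧ l < m ∧ l < k then
        incidence (F.simplex ⟨l, h.2.1⟩) (F.simplex ⟨i, hi⟩) else s.real .matBoC j l)
      (fun _ j l => by rw [dif_neg (by omega)]; rfl) (by
        intro k hk s' h1 h2 h3 h4 _ j l
        have e1 : s'.nat .numCob 0 0 = n := by
          rw [h2 _ (by simp [natWrites, incidenceStep, compareStep])]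
        have h5 := run_incidenceStep (F := F) hi hk (s := s')
          (by rw [h2 _ (by simp [natWrites, incidenceStep, compareStep]), hit]) h1
          (by rw [h2 _ (by simp [natWrites, incidenceStep, compareStep]), hv])
          (by rw [h2 _ (by simp [natWrites, incidenceStep, compareStep]), hnv]) j l
        rw [e1] at h5
        change (incidenceStep.run m s').real .matBoC j l = _
        rw [h5]
        by_cases h6 : j = n ∧ l = k
        · obtain ⟨rfl, rfl⟩ := h6
          rw [if_pos ⟨rfl, rfl⟩, dif_pos ⟨rfl, hk, Nat.lt_succ_self _⟩]
        · rw [if_neg h6, h4 hk.le]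
          by_cases h7 : j = n ∧ l < m ∧ l < k
          · rw [dif_pos h7, dif_pos ⟨h7.1, h7.2.1, by omega⟩]
          · rw [dif_neg h7, dif_neg (by omega)])
    intro j l
    rw [hs₁, key le_rfl]
    by_cases h7 : j = n ∧ l < m
    · rw [dif_pos h7, dif_pos ⟨h7.1, h7.2, h7.2⟩]
    · rw [dif_neg h7, dif_neg (by omega)]
  set s₂ := (row .matCob last (.const 0)).run m s₁ with hs₂
  have hrow := col_run_row (m := m) (R := n) (s := s₁) (a := .matCob) (r := last) (e := .const 0)
    (v := fun _ => 0) (by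
      intro k hk s' h1 h2 h3 h4
      simp [NatExpr.eval, RealExpr.eval, h2 .numCob (by simp), hs₁n .numCob (by simp) (by simp), hn])
  have hlast : load.run m s = s₂.setReal .matCob n i 1 := by
    change (Prog.real .matCob last new (.const 1)).run m s₂ = _
    have e1 : s₂.nat .numCob 0 0 = n := by
      rw [hs₂, run_row_nat (by simp), hs₁n _ (by simp) (by simp)]
    have e2 : s₂.nat .iter 0 0 = i := by
      rw [hs₂, run_row_nat (by simp), hs₁n _ (by simp) (by simp), hit]
    simp [run, NatExpr.eval, RealExpr.eval, e1, e2]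
  have hboc₂ : (load.run m s).real .matBoC = s₁.real .matBoC := by
    rw [hlast, setReal_real_of_ne (by simp), hs₂, run_row_real (by simp)]
  refine ⟨fun j hj => ⟨?_, ?_⟩, ?_, ?_⟩
  · rw [hboc₂]
    funext l
    rw [hboc, dif_neg fun h => hj h.1]
  · rw [hlast]
    funext l
    simp only [State.setReal, true_and]
    rw [if_neg fun h => hj h.1, hs₂, hrow.1 j hj, hs₁r]
  · rw [hlast]
    funext k
    have h1 := congrFun hrow.2 k
    simp only [State.col] at h1
    simp only [State.col, State.setReal, true_and, Pi.single_apply, Fin.ext_iff]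
    rw [hs₂, h1]
  · funext k
    rw [State.col, hboc₂, hboc, dif_pos ⟨rfl, k.2⟩, boundary_single_apply]

end Algorithm

end

/-! ### Correctness of the reduction, the products and the pivot search -/

noncomputable section

open SimplexwiseFiltration

namespace Algorithm

open Prog

variable {m : ℕ} {F : SimplexwiseFiltration m} {i : ℕ}

theorem col_eq_of_real_eq {s t : State} {a : RealArray} {j : ℕ} (h : s.real a j = t.real a j) :
    s.col a m j = t.col a m j := by
  funext k; rw [State.col, h]; rfl

theorem reduceStep_of_not {s : State} {n k : ℕ} (hn : s.nat .numCob 0 0 = n)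
    (hx : s.nat (.scratch 0) 0 0 = k) (h : s.real .matBoC n k = 0 ∨ s.nat .own 0 k = 0) :
    reduceStep.run m s = s := by
  rw [reduceStep, run, if_neg]
  · rfl
  · simp only [Test.Holds, NatExpr.eval, RealExpr.eval, hn, hx, Int.cast_zero]
    tauto

/-- The quotient is stored beforehand, since updating the row destroys the entry from which it is
computed. The condition l ≠ n ensures that the subtracted column is not being modified. -/
theorem run_reduceStep {s : State} {n k l : ℕ} (hn : s.nat .numCob 0 0 = n)
    (hx : s.nat (.scratch 0) 0 0 = k) (hk : s.real .matBoC n k ≠ 0) (hl : s.nat .own 0 k = l + 1)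
    (hln : l ≠ n) :
    (∀ j, j ≠ n → (reduceStep.run m s).real .matBoC j = s.real .matBoC j ∧
      (reduceStep.run m s).real .matCob j = s.real .matCob j) ∧
    (reduceStep.run m s).col .matCob m n = s.col .matCob m n -
      (s.real .matBoC n k / s.real .matBoC l k) • s.col .matCob m l ∧
    (reduceStep.run m s).col .matBoC m n = s.col .matBoC m n -
      (s.real .matBoC n k / s.real .matBoC l k) • s.col .matBoC m l := by
  set f := s.real .matBoC n k / s.real .matBoC l k with hf
  set t₁ := s.setReal factor 0 0 f with ht₁
  set t₂ := (row .matCob last (.sub (.get .matCob last y)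
        (.mul (value factor) (.get .matCob (.pred (.get .own (.const 0) x)) y)))).run m t₁ with ht₂
  have hrun : reduceStep.run m s = (row .matBoC last (.sub (.get .matBoC last y)
        (.mul (value factor) (.get .matBoC (.pred (.get .own (.const 0) x)) y)))).run m t₂ := by
    rw [reduceStep, run, if_pos]
    · simp only [run, NatExpr.eval, RealExpr.eval, hn, hx, hl, Nat.add_sub_cancel, ← hf, ← ht₁,
        ← ht₂]
    · simp only [Test.Holds, NatExpr.eval, RealExpr.eval, hn, hx, Int.cast_zero, hl]
      exact ⟨hk, Nat.succ_ne_zero l⟩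
  have hfac : t₁.real factor 0 0 = f := by simp [ht₁, State.setReal]
  have h₁ : ∀ b, b ≠ factor → t₁.real b = s.real b := fun b hb => setReal_real_of_ne hb
  have hrow₁ := col_run_row (m := m) (R := n) (s := t₁) (a := .matCob) (r := last)
    (e := .sub (.get .matCob last y)
        (.mul (value factor) (.get .matCob (.pred (.get .own (.const 0) x)) y)))
    (v := fun q => s.real .matCob n q - f * s.real .matCob l q) (by
      intro q hq s' h1 h2 h3 h4
      have e1 : s'.nat .numCob 0 0 = n := by rw [h2 _ (by simp)]; exact hn
      have e2 : s'.nat (.scratch 0) 0 0 = k := by rw [h2 _ (by simp)]; exact hx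
      have e3 : s'.nat .own 0 k = l + 1 := by rw [h2 _ (by simp)]; exact hl
      simp only [NatExpr.eval, RealExpr.eval, e1, e2, e3, h1, Nat.add_sub_cancel, true_and]
      rw [h4 n q (Or.inr le_rfl), h4 l q (Or.inl hln), h3 _ (by simp), hfac, h₁ _ (by simp)])
  have hrow₂ := col_run_row (m := m) (R := n) (s := t₂) (a := .matBoC) (r := last)
    (e := .sub (.get .matBoC last y)
        (.mul (value factor) (.get .matBoC (.pred (.get .own (.const 0) x)) y)))
    (v := fun q => s.real .matBoC n q - f * s.real .matBoC l q) (by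
      intro q hq s' h1 h2 h3 h4
      have h2' : ∀ b, b ≠ .scratch 1 → s'.nat b = s.nat b := fun b hb => by
        rw [h2 b hb, ht₂, run_row_nat hb, ht₁]; rfl
      have e1 : s'.nat .numCob 0 0 = n := by rw [h2' _ (by simp)]; exact hn
      have e2 : s'.nat (.scratch 0) 0 0 = k := by rw [h2' _ (by simp)]; exact hx
      have e3 : s'.nat .own 0 k = l + 1 := by rw [h2' _ (by simp)]; exact hl
      have e4 : t₂.real .matBoC = s.real .matBoC := by
        rw [ht₂, run_row_real (by simp), h₁ _ (by simp)]
      have e6 : t₂.real factor 0 0 = f := by rw [ht₂, run_row_real (by simp), hfac]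
      simp only [NatExpr.eval, RealExpr.eval, e1, e2, e3, h1, Nat.add_sub_cancel, true_and]
      rw [h4 n q (Or.inr le_rfl), h4 l q (Or.inl hln), h3 _ (by simp), e6, e4])
  have e4 : t₂.real .matBoC = s.real .matBoC := by rw [ht₂, run_row_real (by simp), h₁ _ (by simp)]
  have e5 : (reduceStep.run m s).real .matCob = t₂.real .matCob := by
    rw [hrun, run_row_real (by simp)]
  refine ⟨fun j hj => ⟨?_, ?_⟩, ?_, ?_⟩
  · rw [hrun, hrow₂.1 j hj, e4]
  · rw [e5, ht₂, hrow₁.1 j hj, h₁ _ (by simp)]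
  · rw [col_eq_of_real_eq (congrFun e5 n), ht₂, hrow₁.2]
    rfl
  · rw [hrun, hrow₂.2]
    rfl

/-- Entries are cleared from the largest index down. A column with pivot k vanishes at larger
indices, so clearing entry k does not disturb those already cleared; doing the same on Cob preserves
BoC = ∂Cob. -/
theorem reduce_spec (hi : i < m) {n : ℕ} {d own : ℕ → ℕ} {C : ℕ → Chain m} {s : State}
    (hC : CobInv F i n d C own) (hn : s.nat .numCob 0 0 = n) (hown : s.nat .own 0 = own)
    (hcob : ∀ j < n, s.col .matCob m j = C j)
    (hboc : ∀ j < n, s.col .matBoC m j = F.boundary (C j))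
    (hcobn : s.col .matCob m n = Pi.single ⟨i, hi⟩ 1)
    (hbocn : s.col .matBoC m n = F.boundary (Pi.single ⟨i, hi⟩ 1)) :
    (∀ j, j ≠ n → (reduce.run m s).real .matBoC j = s.real .matBoC j ∧
      (reduce.run m s).real .matCob j = s.real .matCob j) ∧
    IsReduced F i hi n C own ((reduce.run m s).col .matCob m n) ∧
    (reduce.run m s).col .matBoC m n = F.boundary ((reduce.run m s).col .matCob m n) := by
  have key := run_down_induction (m := m) (x := 0) (P := reduceStep) (s := s) (I := fun k s' =>
    (∀ j, j ≠ n → s'.real .matBoC j = s.real .matBoC j ∧ s'.real .matCob j = s.real .matCob j) ∧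
    s'.col .matBoC m n = F.boundary (s'.col .matCob m n) ∧
    s'.col .matCob m n - Pi.single ⟨i, hi⟩ 1 ∈ Submodule.span ℝ (C '' Set.Iio n) ∧
    s'.col .matCob m n ∈ F.homog (F.dim ⟨i, hi⟩) ∧
    ∀ q : Fin m, k ≤ q → own q ≠ 0 → F.boundary (s'.col .matCob m n) q = 0) ?_ ?_
  · obtain ⟨h1, h2, h3, h4, h5⟩ := key
    exact ⟨h1, ⟨h3, h4, fun q hq => h5 q (Nat.zero_le _) hq⟩, h2⟩
  · have e1 : (s.setNat (.scratch 0) 0 0 m).col .matCob m n = Pi.single ⟨i, hi⟩ 1 := hcobn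
    have e2 : (s.setNat (.scratch 0) 0 0 m).col .matBoC m n = F.boundary (Pi.single ⟨i, hi⟩ 1) := hbocn
    refine ⟨fun j _ => ⟨rfl, rfl⟩, by rw [e1, e2], by rw [e1, sub_self]; exact zero_mem _, ?_,
      fun q hq => absurd q.2 (not_lt.mpr hq)⟩
    rw [e1]
    intro q hq
    exact Pi.single_eq_of_ne (by rintro rfl; exact hq rfl) _
  · intro k hk s' h1 h2 ⟨h3, h4, h5, h6, h7⟩
    set t := s'.setNat (.scratch 0) 0 0 k with ht
    have tx : t.nat (.scratch 0) 0 0 = k := by simp [ht, State.setNat]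
    have tn : ∀ b, b ≠ .scratch 0 → t.nat b = s'.nat b := fun b hb => setNat_nat_of_ne hb
    have tnum : t.nat .numCob 0 0 = n := by
      rw [tn _ (by simp), h1 _ (by simp [natWrites, reduceStep, row]), hn]
    have town : t.nat .own 0 = own := by
      rw [tn _ (by simp), h1 _ (by simp [natWrites, reduceStep, row]), hown]
    have hbk : t.real .matBoC n k = F.boundary (t.col .matCob m n) ⟨k, hk⟩ :=
      congrFun h4 ⟨k, hk⟩
    have h7' : ∀ q : Fin m, k + 1 ≤ q → own q ≠ 0 → F.boundary (t.col .matCob m n) q = 0 := h7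
    by_cases hz : t.real .matBoC n k = 0 ∨ t.nat .own 0 k = 0
    · rw [reduceStep_of_not tnum tx hz]
      refine ⟨h3, h4, h5, h6, fun q hq hq0 => ?_⟩
      rcases hq.eq_or_lt with h8 | h8
      · subst h8
        rcases hz with h9 | h9
        · rw [hbk] at h9; exact h9
        · rw [town] at h9; exact absurd h9 hq0
      · exact h7' q h8 hq0
    · push Not at hz
      obtain ⟨l, hl⟩ := Nat.exists_eq_succ_of_ne_zero hz.2
      have hlk := hC.own_pivot ⟨k, hk⟩ l (by rw [← town]; exact hl)
      obtain ⟨g1, g2, g3⟩ := run_reduceStep (m := m) tnum tx hz.1 hl hlk.1.ne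
      have hcl : t.col .matCob m l = C l := by
        rw [← hcob l hlk.1]
        exact col_eq_of_real_eq (h3 l hlk.1.ne).2
      have hbl : t.col .matBoC m l = F.boundary (C l) := by
        rw [← hboc l hlk.1]
        exact col_eq_of_real_eq (h3 l hlk.1.ne).1
      have hblk : t.real .matBoC l k = F.boundary (C l) ⟨k, hk⟩ := congrFun hbl ⟨k, hk⟩
      have h4' : t.col .matBoC m n = F.boundary (t.col .matCob m n) := h4
      rw [hcl] at g2
      rw [hbl, h4', ← map_smul, ← map_sub, ← g2] at g3
      refine ⟨fun j hj => ⟨(g1 j hj).1.trans (h3 j hj).1, (g1 j hj).2.trans (h3 j hj).2⟩, g3, ?_, ?_,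
        fun q hq hq0 => ?_⟩
      · rw [g2, sub_right_comm]
        exact sub_mem h5 (Submodule.smul_mem _ _ (Submodule.subset_span ⟨l, hlk.1, rfl⟩))
      · rw [g2]
        refine sub_mem h6 (Submodule.smul_mem _ _ ?_)
        -- A nonzero entry at k in both boundaries forces the two columns of Cob to have the same
        -- degree.
        have e1 : F.dim ⟨k, hk⟩ + 1 = F.dim ⟨i, hi⟩ :=
          boundary_ne_zero_dim h6 (k := ⟨k, hk⟩) (by rw [hbk] at hz; exact hz.1)
        have e2 := boundary_ne_zero_dim (hC.homog l hlk.1) hlk.2.1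
        rw [← e1, e2]
        exact hC.homog l hlk.1
      · rw [g2, map_sub, map_smul, Pi.sub_apply, Pi.smul_apply, smul_eq_mul, hbk, hblk]
        rcases hq.eq_or_lt with h8 | h8
        · obtain rfl : q = ⟨k, hk⟩ := Fin.ext h8.symm
          rw [div_mul_cancel₀ _ hlk.2.1, sub_self]
        · rw [h7' q h8 hq0, hlk.2.2 q (Fin.lt_def.mpr h8), mul_zero, sub_zero]

theorem products_spec {n : ℕ} {s : State} (hn : s.nat .numCob 0 0 = n) {j : ℕ} (hj : j < m) :
    (products.run m s).real prodC 0 j = s.col .matCob m j ⬝ᵥ s.col .matCob m n := by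
  refine run_up_induction (m := m) (x := 0) (I := fun k s' => ∀ j < k, s'.real prodC 0 j =
    s.col .matCob m j ⬝ᵥ s.col .matCob m n) (fun j hj => absurd hj (Nat.not_lt_zero j)) ?_ j hj
  intro k hk s' h1 h2 h3 h4 j hj
  have e3 : s'.real .matCob = s.real .matCob := h3 _ (by simp [realWrites, total])
  have h5 := run_total (m := m) (s := s') (c := k) (a := prodC) (ce := x)
    (e := .mul (.get .matCob x y) (.get .matCob last y))
    (v := fun q => s.real .matCob k q * s.real .matCob n q)
    (fun s'' hs'' => by simp only [NatExpr.eval]; rw [hs'' _ (by simp), h1])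
    (fun q hq s'' g1 g2 g3 => by
      simp only [NatExpr.eval, RealExpr.eval]
      rw [g1, g2 _ (by simp), h1, g2 _ (by simp), g3 _ (by simp), e3,
        h2 _ (by simp [natWrites, total]), hn]) 0 j
  change ((total prodC x _).run m s').real prodC 0 j = _
  rw [h5]
  rcases Nat.lt_succ_iff_lt_or_eq.mp hj with h6 | rfl
  · rw [if_neg fun h => h6.ne h.2, h4 j h6]
  · rw [if_pos ⟨rfl, rfl⟩, ← Fin.sum_univ_eq_sum_range fun q => s.real .matCob j q * s.real .matCob n q]
    rfl

/-- The loop ascends and the last write wins, so the largest nonzero position remains. It is stored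
plus one, leaving 0 to signal a zero column. -/
theorem findPivot_spec {n : ℕ} {s : State} (hn : s.nat .numCob 0 0 = n) :
    ((findPivot.run m s).nat (.scratch 2) 0 0 = 0 ∧ s.col .matBoC m n = 0) ∨
      ∃ k : Fin m, (findPivot.run m s).nat (.scratch 2) 0 0 = k + 1 ∧ IsPivot (s.col .matBoC m n) k := by
  have key := run_up_induction (m := m) (x := 0) (s := s.setNat (.scratch 2) 0 0 0)
    (P := .when (.neg (.realEq (.get .matBoC last x) (.const 0))) (assignNat (.scratch 2) (.succ x)))
    (I := fun q s' => (s'.nat (.scratch 2) 0 0 = 0 ∧ ∀ l : Fin m, l < q → s.col .matBoC m n l = 0) ∨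
      ∃ k : Fin m, s'.nat (.scratch 2) 0 0 = k + 1 ∧ s.col .matBoC m n k ≠ 0 ∧
        ∀ l : Fin m, k < l → l < q → s.col .matBoC m n l = 0)
    (Or.inl ⟨by simp [State.setNat], fun l hl => absurd hl (Nat.not_lt_zero l)⟩) (by
      intro q hq s' h1 h2 h3 h4
      have e1 : s'.nat .numCob 0 0 = n := by
        rw [h2 _ (by simp [natWrites]), setNat_nat_of_ne (by simp), hn]
      have e2 : s'.real .matBoC = s.real .matBoC := h3 _ (by simp [realWrites])
      have e3 : s'.real .matBoC n q = s.col .matBoC m n ⟨q, hq⟩ := by rw [e2]; rfl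
      by_cases hz : s.col .matBoC m n ⟨q, hq⟩ = 0
      · simp only [run, Test.Holds, NatExpr.eval, RealExpr.eval, h1, e1, e3, hz, Int.cast_zero,
          not_true_eq_false, if_false]
        rcases h4 with ⟨h5, h6⟩ | ⟨k, h5, h6, h7⟩
        · refine Or.inl ⟨by simpa [State.setNat] using h5, fun l hl => ?_⟩
          rcases Nat.lt_succ_iff_lt_or_eq.mp hl with h8 | h8
          · exact h6 l h8
          · rw [show l = ⟨q, hq⟩ from Fin.ext h8]; exact hz
        · refine Or.inr ⟨k, by simpa [State.setNat] using h5, h6, fun l hkl hl => ?_⟩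
          rcases Nat.lt_succ_iff_lt_or_eq.mp hl with h8 | h8
          · exact h7 l hkl h8
          · rw [show l = ⟨q, hq⟩ from Fin.ext h8]; exact hz
      · simp only [run, Test.Holds, NatExpr.eval, RealExpr.eval, h1, e1, e3, hz, Int.cast_zero,
          not_false_eq_true, if_true]
        refine Or.inr ⟨⟨q, hq⟩, by simp [State.setNat], hz, fun l hkl hl => ?_⟩
        have := Fin.lt_def.mp hkl
        simp only at this
        omega)
  rcases key with ⟨h5, h6⟩ | ⟨k, h5, h6, h7⟩
  · exact Or.inl ⟨h5, by funext l; exact h6 l l.2⟩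
  · exact Or.inr ⟨k, h5, h6, fun l hl => h7 l hl l.2⟩

end Algorithm

end

/-! ### Correctness of the updates of Cob and SC -/

noncomputable section

open SimplexwiseFiltration

namespace Algorithm

open Prog

variable {m : ℕ} {F : SimplexwiseFiltration m} {i : ℕ}

theorem run_projectStep {s : State} {n k : ℕ} (hn : s.nat .numCob 0 0 = n)
    (hx : s.nat (.scratch 0) 0 0 = k) :
    (∀ j, j ≠ k → (projectStep.run m s).real .matSC j = s.real .matSC j ∧
      (projectStep.run m s).real .matCob j = s.real .matCob j) ∧
    (projectStep.run m s).col .matCob m k = s.col .matCob m k -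
      (s.real prodC 0 k / s.real prodC 0 n) • s.col .matH m (s.nat .numH 0 0) ∧
    ∀ l < m, (projectStep.run m s).real .matSC k l = s.real .matSC k l -
      s.real prodC 0 k / s.real prodC 0 n * s.real prodC 0 l := by
  set f := s.real prodC 0 k / s.real prodC 0 n with hf
  set t₁ := s.setReal factor 0 0 f with ht₁
  set t₂ := (row .matSC x (.sub (.get .matSC x y) (.mul (value factor)
    (.get prodC (.const 0) y)))).run m t₁ with ht₂
  have hrun : projectStep.run m s = (row .matCob x (.sub (.get .matCob x y)
      (.mul (value factor) (.get .matH numH y)))).run m t₂ := by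
    simp only [projectStep, run, NatExpr.eval, RealExpr.eval, hn, hx, ← hf, ← ht₁, ← ht₂]
  have hfac : t₁.real factor 0 0 = f := by simp [ht₁, State.setReal]
  have h₁ : ∀ b, b ≠ factor → t₁.real b = s.real b := fun b hb => setReal_real_of_ne hb
  have hrow₁ := col_run_row (m := m) (R := k) (s := t₁) (a := .matSC) (r := x)
    (e := .sub (.get .matSC x y) (.mul (value factor) (.get prodC (.const 0) y)))
    (v := fun q => s.real .matSC k q - f * s.real prodC 0 q) (by
      intro q hq s' h1 h2 h3 h4
      have e2 : s'.nat (.scratch 0) 0 0 = k := by rw [h2 _ (by simp)]; exact hx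
      simp only [NatExpr.eval, RealExpr.eval, e2, h1, true_and]
      rw [h4 k q (Or.inr le_rfl), h3 factor (by simp), h3 prodC (by simp), hfac, h₁ _ (by simp),
        h₁ _ (by simp)])
  have hrow₂ := col_run_row (m := m) (R := k) (s := t₂) (a := .matCob) (r := x)
    (e := .sub (.get .matCob x y) (.mul (value factor) (.get .matH numH y)))
    (v := fun q => s.real .matCob k q - f * s.real .matH (s.nat .numH 0 0) q) (by
      intro q hq s' h1 h2 h3 h4
      have h2' : ∀ b, b ≠ .scratch 1 → s'.nat b = s.nat b := fun b hb => by
        rw [h2 b hb, ht₂, run_row_nat hb, ht₁]; rfl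
      have e2 : s'.nat (.scratch 0) 0 0 = k := by rw [h2' _ (by simp)]; exact hx
      have e4 : t₂.real .matCob = s.real .matCob := by
        rw [ht₂, run_row_real (by simp), h₁ _ (by simp)]
      have e5 : t₂.real .matH = s.real .matH := by
        rw [ht₂, run_row_real (by simp), h₁ _ (by simp)]
      have e6 : t₂.real factor 0 0 = f := by rw [ht₂, run_row_real (by simp), hfac]
      simp only [NatExpr.eval, RealExpr.eval, e2, h1, true_and]
      rw [h4 k q (Or.inr le_rfl), h3 factor (by simp), h3 .matH (by simp), e6, e5, e4,
        h2' _ (by simp)])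
  have e5 : (projectStep.run m s).real .matSC = t₂.real .matSC := by
    rw [hrun, run_row_real (by simp)]
  refine ⟨fun j hj => ⟨?_, ?_⟩, ?_, fun l hl => ?_⟩
  · rw [e5, ht₂, hrow₁.1 j hj, h₁ _ (by simp)]
  · rw [hrun, hrow₂.1 j hj, ht₂, run_row_real (by simp), h₁ _ (by simp)]
  · rw [hrun, hrow₂.2]
    rfl
  · rw [e5, ht₂]
    exact congrFun hrow₁.2 ⟨l, hl⟩

/-- The new chain is copied to H first and read from there: the projection loop also passes over its
row n in Cob, where it subtracts the chain from itself. The products in `prodC` are not touched, so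
every update uses the old values. -/
theorem birth_spec {s : State} {n nH : ℕ} (hn : s.nat .numCob 0 0 = n) (hnH : s.nat .numH 0 0 = nH) :
    (∀ j, j ≠ nH → (birth.run m s).real .matH j = s.real .matH j) ∧
    (birth.run m s).col .matH m nH = s.col .matCob m n ∧
    (∀ j < m, (birth.run m s).col .matCob m j = s.col .matCob m j -
      (s.real prodC 0 j / s.real prodC 0 n) • s.col .matCob m n) ∧
    (∀ j < m, ∀ l < m, (birth.run m s).real .matSC j l = s.real .matSC j l -
      s.real prodC 0 j / s.real prodC 0 n * s.real prodC 0 l) ∧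
    (∀ j, j ≠ nH → (birth.run m s).nat .degH j 0 = s.nat .degH j 0) ∧
    (birth.run m s).nat .degH nH 0 = s.nat .numVertices (s.nat .iter 0 0) 0 - 1 ∧
    (∀ j, j ≠ nH → (birth.run m s).nat .birthH j 0 = s.nat .birthH j 0) ∧
    (birth.run m s).nat .birthH nH 0 = s.nat .iter 0 0 + 1 ∧
    (birth.run m s).nat .numH 0 0 = nH + 1 := by
  set t₁ := (row .matH numH (.get .matCob last y)).run m s with ht₁
  set t₂ := (Prog.up 0 projectStep).run m t₁ with ht₂
  have hrow := col_run_row (m := m) (R := nH) (s := s) (a := .matH) (r := numH)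
    (e := .get .matCob last y) (v := fun q => s.real .matCob n q) (by
      intro q hq s' h1 h2 h3 h4
      simp only [NatExpr.eval, RealExpr.eval, h1]
      rw [h2 _ (by simp), h2 _ (by simp), h3 _ (by simp), hn, hnH]
      exact ⟨rfl, rfl⟩)
  have hH : t₁.col .matH m nH = s.col .matCob m n := hrow.2
  have h₁n : ∀ b, b ≠ .scratch 1 → t₁.nat b = s.nat b := fun b hb => run_row_nat hb
  have h₁r : ∀ b, b ≠ .matH → t₁.real b = s.real b := fun b hb => run_row_real hb
  have h₂n : ∀ b, b ≠ .scratch 0 → b ≠ .scratch 1 → t₂.nat b = s.nat b := fun b hb hb' => by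
    rw [ht₂, run_nat_of_notMem m _ (by simpa [natWrites, projectStep, row] using ⟨hb, hb'⟩), h₁n b hb']
  have h₂H : t₂.real .matH = t₁.real .matH := by
    rw [ht₂]
    exact run_real_of_notMem m _ (by simp [realWrites, projectStep, row]) _
  have hloop := run_up_induction (m := m) (x := 0) (P := projectStep) (s := t₁) (I := fun k s' =>
    (∀ j < m, s'.col .matCob m j = if j < k then s.col .matCob m j -
      (s.real prodC 0 j / s.real prodC 0 n) • s.col .matCob m n else s.col .matCob m j) ∧
    (∀ j < m, ∀ l < m, s'.real .matSC j l = if j < k then s.real .matSC j l -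
      s.real prodC 0 j / s.real prodC 0 n * s.real prodC 0 l else s.real .matSC j l))
    (by
      refine ⟨fun j _ => ?_, fun j _ l _ => ?_⟩
      · rw [if_neg (Nat.not_lt_zero j)]
        exact col_eq_of_real_eq (congrFun (h₁r .matCob (by simp)) j)
      · rw [if_neg (Nat.not_lt_zero j), ← h₁r .matSC (by simp)]; rfl)
    (by
      rintro k hk s' g1 g2 g3 ⟨g4, g5⟩
      have e1 : s'.nat .numCob 0 0 = n := by
        rw [g2 _ (by simp [natWrites, projectStep, row]), h₁n _ (by simp), hn]
      have e2 : s'.nat .numH 0 0 = nH := by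
        rw [g2 _ (by simp [natWrites, projectStep, row]), h₁n _ (by simp), hnH]
      have e3 : s'.real prodC = s.real prodC := by
        rw [g3 _ (by simp [realWrites, projectStep, row]), h₁r _ (by simp)]
      have e4 : s'.col .matH m nH = s.col .matCob m n := by
        rw [← hH]
        exact col_eq_of_real_eq (congrFun (g3 _ (by simp [realWrites, projectStep, row])) nH)
      obtain ⟨h1, h2, h3⟩ := run_projectStep (m := m) e1 g1
      rw [e2, e3, e4] at h2
      rw [e3] at h3
      refine ⟨fun j hj => ?_, fun j hj l hl => ?_⟩
      · change (projectStep.run m s').col .matCob m j = _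
        by_cases hjk : j = k
        · subst hjk
          rw [h2, if_pos (Nat.lt_succ_self j), g4 j hj, if_neg (lt_irrefl j)]
        · rw [col_eq_of_real_eq (h1 j hjk).2, g4 j hj]
          exact if_congr (by omega) rfl rfl
      · change (projectStep.run m s').real .matSC j l = _
        by_cases hjk : j = k
        · subst hjk
          rw [h3 l hl, if_pos (Nat.lt_succ_self j), g5 j hj l hl, if_neg (lt_irrefl j)]
        · rw [(h1 j hjk).1, g5 j hj l hl]
          exact if_congr (by omega) rfl rfl)
  have hrun : birth.run m s = ((t₂.setNat .degH nH 0 (s.nat .numVertices (s.nat .iter 0 0) 0 - 1)).setNat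
      .birthH nH 0 (s.nat .iter 0 0 + 1)).setNat .numH 0 0 (nH + 1) := by
    change (Prog.seq (.nat .degH numH (.const 0) (.pred (.get .numVertices new (.const 0))))
      (.seq (.nat .birthH numH (.const 0) (.succ new)) (assignNat .numH (.succ numH)))).run m t₂ = _
    have e1 : t₂.nat .numH 0 0 = nH := by rw [h₂n _ (by simp) (by simp), hnH]
    have e2 : t₂.nat .iter = s.nat .iter := h₂n _ (by simp) (by simp)
    have e3 : t₂.nat .numVertices = s.nat .numVertices := h₂n _ (by simp) (by simp)
    simp [run, NatExpr.eval, State.setNat, e1, e2, e3]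
  have hreal : (birth.run m s).real = t₂.real := by rw [hrun]; rfl
  refine ⟨fun j hj => ?_, ?_, fun j hj => ?_, fun j hj l hl => ?_, fun j hj => ?_, ?_, fun j hj => ?_,
    ?_, ?_⟩
  · rw [hreal, h₂H, ht₁, hrow.1 j hj]
  · rw [← hH]
    exact col_eq_of_real_eq (by rw [hreal, h₂H])
  · rw [col_eq_of_real_eq (congrFun (congrFun hreal _) j), hloop.1 j hj, if_pos hj]
  · rw [hreal, hloop.2 j hj l hl, if_pos hj]
  · rw [hrun]; simp [State.setNat, hj, h₂n]
  · rw [hrun]; simp [State.setNat]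
  · rw [hrun]; simp [State.setNat, hj, h₂n]
  · rw [hrun]; simp [State.setNat]
  · rw [hrun]; simp [State.setNat]

theorem extend_spec {s : State} {n p : ℕ} (hn : s.nat .numCob 0 0 = n) (hnm : n < m)
    (hp : s.nat (.scratch 2) 0 0 = p + 1) :
    (extend.run m s).nat .own 0 p = n + 1 ∧
    (∀ k, k ≠ p → (extend.run m s).nat .own 0 k = s.nat .own 0 k) ∧
    (∀ j, j ≠ n → (extend.run m s).real .matR j = s.real .matR j) ∧
    (extend.run m s).col .matR m n = s.col .matBoC m n ∧
    (∀ j, j ≠ n → ∀ l, l ≠ n → (extend.run m s).real .matSC j l = s.real .matSC j l) ∧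
    (∀ l < m, (extend.run m s).real .matSC n l = s.real prodC 0 l) ∧
    (∀ j < m, (extend.run m s).real .matSC j n = s.real prodC 0 j) ∧
    (∀ j, j ≠ n → (extend.run m s).nat .degCob j 0 = s.nat .degCob j 0) ∧
    (extend.run m s).nat .degCob n 0 = s.nat .numVertices (s.nat .iter 0 0) 0 - 1 ∧
    (∀ j, j ≠ n → (extend.run m s).nat .degR j 0 = s.nat .degR j 0) ∧
    (extend.run m s).nat .degR n 0 = s.nat .numVertices (s.nat .iter 0 0) 0 - 1 - 1 := by
  set t₀ := s.setNat .own 0 p (n + 1) with ht₀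
  have h₀n : ∀ b, b ≠ .own → t₀.nat b = s.nat b := fun b hb => setNat_nat_of_ne hb
  set t₁ := (row .matR last (.get .matBoC last y)).run m t₀ with ht₁
  set t₂ := (row .matSC last (.get prodC (.const 0) y)).run m t₁ with ht₂
  set t₃ := (Prog.up 0 (.real .matSC x last (.get prodC (.const 0) x))).run m t₂ with ht₃
  have h₁n : ∀ b, b ≠ .scratch 1 → t₁.nat b = t₀.nat b := fun b hb => run_row_nat hb
  have h₂n : ∀ b, b ≠ .scratch 1 → t₂.nat b = t₀.nat b := fun b hb => by
    rw [ht₂, run_row_nat hb, h₁n b hb]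
  have h₃n : ∀ b, b ≠ .scratch 0 → b ≠ .scratch 1 → t₃.nat b = t₀.nat b := fun b hb hb' => by
    rw [ht₃, run_nat_of_notMem m _ (by simpa [natWrites] using hb), h₂n b hb']
  have hrun : extend.run m s = (t₃.setNat .degCob n 0 (s.nat .numVertices (s.nat .iter 0 0) 0 - 1)).setNat
      .degR n 0 (s.nat .numVertices (s.nat .iter 0 0) 0 - 1 - 1) := by
    have e0 : (Prog.nat .own (.const 0) (.pred pivot) (.succ last)).run m s = t₀ := by
      simp [run, NatExpr.eval, hn, hp, ht₀]
    have : extend.run m s = (Prog.seq (.nat .degCob last (.const 0)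
        (.pred (.get .numVertices new (.const 0)))) (.nat .degR last (.const 0)
        (.pred (.pred (.get .numVertices new (.const 0)))))).run m t₃ := by
      rw [ht₃, ht₂, ht₁, ← e0]; rfl
    rw [this]
    have e1 : t₃.nat .numCob 0 0 = n := by rw [h₃n _ (by simp) (by simp), h₀n _ (by simp), hn]
    have e2 : t₃.nat .iter = s.nat .iter := by rw [h₃n _ (by simp) (by simp), h₀n _ (by simp)]
    have e3 : t₃.nat .numVertices = s.nat .numVertices := by
      rw [h₃n _ (by simp) (by simp), h₀n _ (by simp)]
    simp [run, NatExpr.eval, State.setNat, e1, e2, e3]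
  have hreal : (extend.run m s).real = t₃.real := by rw [hrun]; rfl
  have hrow₁ := col_run_row (m := m) (R := n) (s := t₀) (a := .matR) (r := last)
    (e := .get .matBoC last y) (v := fun q => s.real .matBoC n q) (by
      intro q hq s' h1 h2 h3 h4
      simp only [NatExpr.eval, RealExpr.eval, h1]
      rw [h2 _ (by simp), h3 _ (by simp), h₀n _ (by simp), hn]
      exact ⟨rfl, rfl⟩)
  have hrow₂ := col_run_row (m := m) (R := n) (s := t₁) (a := .matSC) (r := last)
    (e := .get prodC (.const 0) y) (v := fun q => s.real prodC 0 q) (by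
      intro q hq s' h1 h2 h3 h4
      simp only [NatExpr.eval, RealExpr.eval, h1]
      rw [h2 _ (by simp), h3 _ (by simp), h₁n _ (by simp), h₀n _ (by simp), hn, ht₁,
        run_row_real (by simp)]
      exact ⟨rfl, rfl⟩)
  have hR : t₃.real .matR = t₁.real .matR := by
    rw [ht₃, run_real_of_notMem m _ (by simp [realWrites]), ht₂, run_row_real (by simp)]
  -- The new row and the new column of the Gram matrix overlap at (n, n), where both writes store
  -- the same product.
  have hSC : ∀ j l, t₃.real .matSC j l = if j < m ∧ l = n then s.real prodC 0 j else
      t₂.real .matSC j l := by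
    refine run_up_induction (m := m) (x := 0) (I := fun k s' => ∀ j l, s'.real .matSC j l =
      if j < k ∧ l = n then s.real prodC 0 j else t₂.real .matSC j l) (fun j l => ?_) ?_
    · rw [if_neg (by omega)]; rfl
    · intro k hk s' g1 g2 g3 g4 j l
      have e1 : s'.nat .numCob 0 0 = n := by
        rw [g2 _ (by simp [natWrites]), h₂n _ (by simp), h₀n _ (by simp), hn]
      have e2 : s'.real prodC = s.real prodC := by
        rw [g3 _ (by simp [realWrites]), ht₂, run_row_real (by simp), ht₁, run_row_real (by simp)]
        rfl
      simp only [run, State.setNat, State.setReal, NatExpr.eval, RealExpr.eval, g1, e1, e2, true_and]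
      by_cases h : j = k ∧ l = n
      · rw [if_pos h, if_pos ⟨by omega, h.2⟩, h.1]
      · rw [if_neg h, g4]
        exact if_congr (by omega) rfl rfl
  have hSC₁ : t₁.real .matSC = s.real .matSC := by rw [ht₁, run_row_real (by simp)]; rfl
  refine ⟨?_, fun k hk => ?_, fun j hj => ?_, ?_, fun j hj l hl => ?_, fun l hl => ?_, fun j hj => ?_,
    fun j hj => ?_, ?_, fun j hj => ?_, ?_⟩
  · rw [hrun]; simp [State.setNat, h₃n, ht₀]
  · rw [hrun]; simp [State.setNat, h₃n, ht₀, hk]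
  · rw [hreal, hR, ht₁, hrow₁.1 j hj]; rfl
  · rw [col_eq_of_real_eq (congrFun (congrFun hreal _) n), col_eq_of_real_eq (congrFun hR n), ht₁,
      hrow₁.2]
    rfl
  · rw [hreal, hSC, if_neg fun h => hl h.2, ht₂, hrow₂.1 j hj, hSC₁]
  · rw [hreal, hSC]
    by_cases hln : l = n
    · rw [if_pos ⟨hnm, hln⟩, hln]
    · rw [if_neg fun h => hln h.2, ht₂]
      exact congrFun hrow₂.2 ⟨l, hl⟩
  · rw [hreal, hSC, if_pos ⟨hj, rfl⟩]
  · rw [hrun]; simp [State.setNat, hj, h₃n, h₀n]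
  · rw [hrun]; simp [State.setNat]
  · rw [hrun]; simp [State.setNat, hj, h₃n, h₀n]
  · rw [hrun]; simp [State.setNat]

end Algorithm

end

/-! ### Correctness of ending a bar -/

noncomputable section

open SimplexwiseFiltration

namespace Algorithm

open Prog

variable {m : ℕ} {F : SimplexwiseFiltration m} {i : ℕ}

/-- The search descends and the last write wins, so the smallest position, that is the earliest
birth, remains. The comparison with the number of columns excludes stale rows. -/
theorem findFirst_spec {s : State} {n nH : ℕ} (hn : s.nat .numCob 0 0 = n)
    (hnH : s.nat .numH 0 0 = nH) (hnm : nH ≤ m)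
    (hex : ∃ j < nH, s.col .matH m j ⬝ᵥ s.col .matBoC m n ≠ 0) :
    (∀ j < m, (findFirst.run m s).real prodH 0 j = s.col .matH m j ⬝ᵥ s.col .matBoC m n) ∧
    ∃ j < nH, (findFirst.run m s).nat (.scratch 3) 0 0 = j ∧
      s.col .matH m j ⬝ᵥ s.col .matBoC m n ≠ 0 ∧
      ∀ j' < j, s.col .matH m j' ⬝ᵥ s.col .matBoC m n = 0 := by
  set a : ℕ → ℝ := fun j => s.col .matH m j ⬝ᵥ s.col .matBoC m n with ha
  set t := (Prog.up 0 (total prodH x (.mul (.get .matH x y) (.get .matBoC last y)))).run m s with ht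
  have hprod : ∀ j < m, t.real prodH 0 j = a j := by
    refine run_up_induction (m := m) (x := 0) (I := fun k s' => ∀ j < k, s'.real prodH 0 j = a j)
      (fun j hj => absurd hj (Nat.not_lt_zero j)) ?_
    intro k hk s' h1 h2 h3 h4 j hj
    have e3 : s'.real .matH = s.real .matH := h3 _ (by simp [realWrites, total])
    have e4 : s'.real .matBoC = s.real .matBoC := h3 _ (by simp [realWrites, total])
    have h5 := run_total (m := m) (s := s') (c := k) (a := prodH) (ce := x)
      (e := .mul (.get .matH x y) (.get .matBoC last y))
      (v := fun q => s.real .matH k q * s.real .matBoC n q)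
      (fun s'' hs'' => by simp only [NatExpr.eval]; rw [hs'' _ (by simp), h1])
      (fun q hq s'' g1 g2 g3 => by
        simp only [NatExpr.eval, RealExpr.eval]
        rw [g1, g2 _ (by simp), h1, g2 _ (by simp), g3 .matH (by simp), g3 .matBoC (by simp), e3, e4,
          h2 _ (by simp [natWrites, total]), hn]) 0 j
    change ((total prodH x _).run m s').real prodH 0 j = _
    rw [h5]
    rcases Nat.lt_succ_iff_lt_or_eq.mp hj with h6 | rfl
    · rw [if_neg fun h => h6.ne h.2, h4 j h6]
    · rw [if_pos ⟨rfl, rfl⟩, ← Fin.sum_univ_eq_sum_range fun q => s.real .matH j q * s.real .matBoC n q]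
      rfl
  have htn : t.nat .numH 0 0 = nH := by
    rw [ht, run_nat_of_notMem m _ (by simp [natWrites, total]), hnH]
  have hrun : findFirst.run m s = (Prog.down 0 (.when (.and (.natLt x numH) (.neg (.realEq
    (.get prodH (.const 0) x) (.const 0)))) (assignNat (.scratch 3) x))).run m t := rfl
  rw [hrun]
  refine ⟨fun j hj => ?_, ?_⟩
  · rw [run_real_of_notMem m _ (by simp [realWrites]), hprod j hj]
  have key := run_down_induction (m := m) (x := 0) (s := t)
    (P := .when (.and (.natLt x numH) (.neg (.realEq (.get prodH (.const 0) x) (.const 0))))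
      (assignNat (.scratch 3) x))
    (I := fun k s' => (∀ j, k ≤ j → j < nH → a j = 0) ∨ ∃ j < nH, s'.nat (.scratch 3) 0 0 = j ∧
      a j ≠ 0 ∧ ∀ j', k ≤ j' → j' < j → a j' = 0)
    (Or.inl fun j h1 h2 => by omega) (by
      intro k hk s' h2 h3 h4
      have e1 : s'.nat .numH 0 0 = nH := by rw [h2 _ (by simp [natWrites]), htn]
      have e2 : s'.real prodH 0 k = a k := by rw [h3 _ (by simp [realWrites]), hprod k hk]
      by_cases hz : k < nH ∧ a k ≠ 0
      · right
        refine ⟨k, hz.1, ?_, hz.2, fun j' h5 h6 => by omega⟩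
        simp [run, Test.Holds, NatExpr.eval, RealExpr.eval, State.setNat, e1, e2, hz]
      · have e3 : (Prog.run m (.when (.and (.natLt x numH) (.neg (.realEq (.get prodH (.const 0) x)
            (.const 0)))) (assignNat (.scratch 3) x)) (s'.setNat (.scratch 0) 0 0 k)).nat
            (.scratch 3) 0 0 = s'.nat (.scratch 3) 0 0 := by
          rw [run, if_neg]
          · simp [run, State.setNat]
          · simpa [Test.Holds, NatExpr.eval, RealExpr.eval, State.setNat, e1, e2] using hz
        have hz' : k < nH → a k = 0 := fun h => by by_contra h'; exact hz ⟨h, h'⟩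
        rcases h4 with h5 | ⟨j, h5, h6, h7, h8⟩
        · left
          intro j h9 h10
          rcases h9.eq_or_lt with rfl | h11
          · exact hz' h10
          · exact h5 j h11 h10
        · right
          refine ⟨j, h5, e3.trans h6, h7, fun j' h9 h10 => ?_⟩
          rcases h9.eq_or_lt with rfl | h11
          · exact hz' (by omega)
          · exact h8 j' h11 h10)
  rcases key with h5 | ⟨j, h5, h6, h7, h8⟩
  · obtain ⟨j, hj, h0⟩ := hex
    exact absurd (h5 j (Nat.zero_le j) hj) h0
  · exact ⟨j, h5, h6, h7, fun j' h9 => h8 j' (Nat.zero_le _) h9⟩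

/-- The position and the end are evaluated again between the writes, so they are assumed to depend
only on arrays that recording leaves alone. This covers both a death and the final step. -/
theorem recordBar_spec {s : State} {je de : NatExpr} {j d N : ℕ} (hN : s.nat .numBars 0 0 = N)
    (hje : ∀ s' : State, s'.nat .numH = s.nat .numH → s'.nat (.scratch 3) = s.nat (.scratch 3) →
      s'.nat (.scratch 0) = s.nat (.scratch 0) → je.eval s' = j)
    (hde : ∀ s' : State, s'.nat .iter = s.nat .iter → s'.nat .size = s.nat .size → de.eval s' = d) :
    (∀ l, l ≠ N → ((recordBar je de).run m s).real .repBar l = s.real .repBar l ∧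
      ((recordBar je de).run m s).nat .degBar l 0 = s.nat .degBar l 0 ∧
      ((recordBar je de).run m s).nat .birthBar l 0 = s.nat .birthBar l 0 ∧
      ((recordBar je de).run m s).nat .deathBar l 0 = s.nat .deathBar l 0) ∧
    ((recordBar je de).run m s).col .repBar m N = s.col .matH m j ∧
    ((recordBar je de).run m s).nat .degBar N 0 = s.nat .degH j 0 ∧
    ((recordBar je de).run m s).nat .birthBar N 0 = s.nat .birthH j 0 ∧
    ((recordBar je de).run m s).nat .deathBar N 0 = d := by
  set t := (row .repBar numBars (.get .matH je y)).run m s with ht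
  have htn : ∀ b, b ≠ .scratch 1 → t.nat b = s.nat b := fun b hb => run_row_nat hb
  have hrow := col_run_row (m := m) (R := N) (s := s) (a := .repBar) (r := numBars)
    (e := .get .matH je y) (v := fun q => s.real .matH j q) (by
      intro q hq s' h1 h2 h3 h4
      simp only [NatExpr.eval, RealExpr.eval, h1]
      rw [h2 _ (by simp), h3 _ (by simp), hN, hje s' (h2 _ (by simp)) (h2 _ (by simp)) (h2 _ (by simp))]
      exact ⟨rfl, rfl⟩)
  have hrun : (recordBar je de).run m s = ((t.setNat .degBar N 0 (s.nat .degH j 0)).setNat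
      .birthBar N 0 (s.nat .birthH j 0)).setNat .deathBar N 0 d := by
    change (Prog.seq (.nat .degBar numBars (.const 0) (.get .degH je (.const 0)))
      (.seq (.nat .birthBar numBars (.const 0) (.get .birthH je (.const 0)))
        (.nat .deathBar numBars (.const 0) de))).run m t = _
    have e1 : t.nat .numBars 0 0 = N := by rw [htn _ (by simp), hN]
    have e2 : t.nat .degH = s.nat .degH := htn _ (by simp)
    have e3 : t.nat .birthH = s.nat .birthH := htn _ (by simp)
    have j1 : je.eval t = j := hje t (htn _ (by simp)) (htn _ (by simp)) (htn _ (by simp))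
    simp only [run, NatExpr.eval, e1, j1, e2]
    set t' := t.setNat .degBar N 0 (s.nat .degH j 0) with ht'
    have htn' : ∀ b, b ≠ .scratch 1 → b ≠ .degBar → t'.nat b = s.nat b := fun b hb hb' => by
      rw [ht', setNat_nat_of_ne hb', htn b hb]
    have j2 : je.eval t' = j := hje t' (htn' _ (by simp) (by simp)) (htn' _ (by simp) (by simp))
      (htn' _ (by simp) (by simp))
    have e4 : t'.nat .numBars 0 0 = N := by rw [htn' _ (by simp) (by simp), hN]
    rw [j2, e4, htn' .birthH (by simp) (by simp)]
    set t'' := t'.setNat .birthBar N 0 (s.nat .birthH j 0) with ht''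
    have htn'' : ∀ b, b ≠ .scratch 1 → b ≠ .degBar → b ≠ .birthBar → t''.nat b = s.nat b :=
      fun b hb hb' hb'' => by rw [ht'', setNat_nat_of_ne hb'', htn' b hb hb']
    rw [hde t'' (htn'' _ (by simp) (by simp) (by simp)) (htn'' _ (by simp) (by simp) (by simp)),
      htn'' .numBars (by simp) (by simp) (by simp), hN]
  have hreal : ((recordBar je de).run m s).real = t.real := by rw [hrun]; rfl
  refine ⟨fun l hl => ⟨?_, ?_, ?_, ?_⟩, ?_, ?_, ?_, ?_⟩
  · rw [hreal, ht, hrow.1 l hl]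
  · rw [hrun]; simp [State.setNat, hl, htn]
  · rw [hrun]; simp [State.setNat, hl, htn]
  · rw [hrun]; simp [State.setNat, hl, htn]
  · rw [col_eq_of_real_eq (congrFun (congrFun hreal _) N), ht, hrow.2]
    rfl
  · rw [hrun]; simp [State.setNat]
  · rw [hrun]; simp [State.setNat]
  · rw [hrun]; simp [State.setNat]

theorem run_shiftStep_of_lt {s : State} {k j₀ : ℕ} (hx : s.nat (.scratch 0) 0 0 = k)
    (hj₀ : s.nat (.scratch 3) 0 0 = j₀) (h : k < j₀) : shiftStep.run m s = s := by
  rw [shiftStep, run, if_neg]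
  · rfl
  · simpa [Test.Holds, NatExpr.eval, hx, hj₀] using h

/-- The ended column is read from the recorded bar, because its own place in H is overwritten in the
round k = j₀. -/
theorem run_shiftStep {s : State} {k j₀ N : ℕ} (hx : s.nat (.scratch 0) 0 0 = k)
    (hj₀ : s.nat (.scratch 3) 0 0 = j₀) (hN : s.nat .numBars 0 0 = N) (h : j₀ ≤ k) :
    (∀ j, j ≠ k → (shiftStep.run m s).real .matH j = s.real .matH j ∧
      (shiftStep.run m s).nat .degH j 0 = s.nat .degH j 0 ∧
      (shiftStep.run m s).nat .birthH j 0 = s.nat .birthH j 0) ∧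
    (shiftStep.run m s).col .matH m k = s.col .matH m (k + 1) -
      (s.real prodH 0 (k + 1) / s.real prodH 0 j₀) • s.col .repBar m N ∧
    (shiftStep.run m s).nat .degH k 0 = s.nat .degH (k + 1) 0 ∧
    (shiftStep.run m s).nat .birthH k 0 = s.nat .birthH (k + 1) 0 := by
  set f := s.real prodH 0 (k + 1) / s.real prodH 0 j₀ with hf
  set t₁ := s.setReal factor 0 0 f with ht₁
  set t₂ := (row .matH x (.sub (.get .matH (.succ x) y) (.mul (value factor)
    (.get .repBar numBars y)))).run m t₁ with ht₂
  have hfac : t₁.real factor 0 0 = f := by simp [ht₁, State.setReal]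
  have h₁ : ∀ b, b ≠ factor → t₁.real b = s.real b := fun b hb => setReal_real_of_ne hb
  have h₂ : ∀ b, b ≠ .scratch 1 → t₂.nat b = s.nat b := fun b hb => run_row_nat hb
  have hrow := col_run_row (m := m) (R := k) (s := t₁) (a := .matH) (r := x)
    (e := .sub (.get .matH (.succ x) y) (.mul (value factor) (.get .repBar numBars y)))
    (v := fun q => s.real .matH (k + 1) q - f * s.real .repBar N q) (by
      intro q hq s' h1 h2 h3 h4
      have h2' : ∀ b, b ≠ .scratch 1 → s'.nat b = s.nat b := h2
      have e2 : s'.nat (.scratch 0) 0 0 = k := by rw [h2' _ (by simp)]; exact hx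
      simp only [NatExpr.eval, RealExpr.eval, e2, h1, true_and]
      rw [h4 (k + 1) q (Or.inl (Nat.succ_ne_self k)), h3 factor (by simp), h3 .repBar (by simp), hfac,
        h₁ _ (by simp), h₁ _ (by simp), h2' _ (by simp), hN])
  have hrun : shiftStep.run m s = (t₂.setNat .degH k 0 (s.nat .degH (k + 1) 0)).setNat .birthH k 0
      (s.nat .birthH (k + 1) 0) := by
    have e1 : t₂.nat (.scratch 0) 0 0 = k := by rw [h₂ _ (by simp), hx]
    have e2 : t₂.nat .degH = s.nat .degH := h₂ _ (by simp)
    have e3 : t₂.nat .birthH = s.nat .birthH := h₂ _ (by simp)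
    rw [shiftStep, run, if_pos]
    · simp only [run, NatExpr.eval, RealExpr.eval, hx, hj₀, ← hf, ← ht₁, ← ht₂]
      simp [State.setNat, e1, e2, e3]
    · simpa [Test.Holds, NatExpr.eval, hx, hj₀] using h
  have hreal : (shiftStep.run m s).real = t₂.real := by rw [hrun]; rfl
  refine ⟨fun j hj => ⟨?_, ?_, ?_⟩, ?_, ?_, ?_⟩
  · rw [hreal, ht₂, hrow.1 j hj, h₁ _ (by simp)]
  · rw [hrun]; simp [State.setNat, hj, h₂]
  · rw [hrun]; simp [State.setNat, hj, h₂]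
  · rw [col_eq_of_real_eq (congrFun (congrFun hreal _) k), ht₂, hrow.2]
    rfl
  · rw [hrun]; simp [State.setNat]
  · rw [hrun]; simp [State.setNat]

/-- Ascending order guarantees that row j + 1 is still the old one when row j is computed. Rows past
the last column are shifted too, which is harmless as they are not counted. -/
theorem shift_spec {s : State} {j₀ N : ℕ} (hj₀ : s.nat (.scratch 3) 0 0 = j₀)
    (hN : s.nat .numBars 0 0 = N) :
    (∀ j < j₀, ((Prog.up 0 shiftStep).run m s).col .matH m j = s.col .matH m j ∧
      ((Prog.up 0 shiftStep).run m s).nat .degH j 0 = s.nat .degH j 0 ∧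
      ((Prog.up 0 shiftStep).run m s).nat .birthH j 0 = s.nat .birthH j 0) ∧
    ∀ j, j₀ ≤ j → j < m → ((Prog.up 0 shiftStep).run m s).col .matH m j = s.col .matH m (j + 1) -
        (s.real prodH 0 (j + 1) / s.real prodH 0 j₀) • s.col .repBar m N ∧
      ((Prog.up 0 shiftStep).run m s).nat .degH j 0 = s.nat .degH (j + 1) 0 ∧
      ((Prog.up 0 shiftStep).run m s).nat .birthH j 0 = s.nat .birthH (j + 1) 0 := by
  have key := run_up_induction (m := m) (x := 0) (s := s) (P := shiftStep) (I := fun k s' =>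
    (∀ j, j < j₀ ∨ k ≤ j → s'.real .matH j = s.real .matH j ∧
      s'.nat .degH j 0 = s.nat .degH j 0 ∧ s'.nat .birthH j 0 = s.nat .birthH j 0) ∧
    ∀ j, j₀ ≤ j → j < k → s'.col .matH m j = s.col .matH m (j + 1) -
        (s.real prodH 0 (j + 1) / s.real prodH 0 j₀) • s.col .repBar m N ∧
      s'.nat .degH j 0 = s.nat .degH (j + 1) 0 ∧ s'.nat .birthH j 0 = s.nat .birthH (j + 1) 0)
    ⟨fun j _ => by simp [State.setNat], fun j _ hj => absurd hj (Nat.not_lt_zero j)⟩ (by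
      rintro k hk s' h1 h2 h3 ⟨h4, h5⟩
      have e1 : s'.nat (.scratch 3) 0 0 = j₀ := by
        rw [h2 _ (by simp [natWrites, shiftStep, row]), hj₀]
      have e2 : s'.nat .numBars 0 0 = N := by
        rw [h2 _ (by simp [natWrites, shiftStep, row]), hN]
      have e3 : s'.real prodH = s.real prodH := h3 _ (by simp [realWrites, shiftStep, row])
      have e4 : s'.col .repBar m N = s.col .repBar m N :=
        col_eq_of_real_eq (congrFun (h3 _ (by simp [realWrites, shiftStep, row])) N)
      set t := shiftStep.run m s' with ht
      have htn : ∀ b, b ≠ .scratch 0 → (t.setNat (.scratch 0) 0 0 (k + 1)).nat b = t.nat b :=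
        fun b hb => setNat_nat_of_ne hb
      rw [htn _ (by simp), htn _ (by simp)]
      change (∀ j, j < j₀ ∨ k + 1 ≤ j → t.real .matH j = s.real .matH j ∧
        t.nat .degH j 0 = s.nat .degH j 0 ∧ t.nat .birthH j 0 = s.nat .birthH j 0) ∧
        ∀ j, j₀ ≤ j → j < k + 1 → t.col .matH m j = s.col .matH m (j + 1) -
          (s.real prodH 0 (j + 1) / s.real prodH 0 j₀) • s.col .repBar m N ∧
        t.nat .degH j 0 = s.nat .degH (j + 1) 0 ∧ t.nat .birthH j 0 = s.nat .birthH (j + 1) 0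
      rcases lt_or_ge k j₀ with h6 | h6
      · rw [ht, run_shiftStep_of_lt h1 e1 h6]
        exact ⟨fun j hj => h4 j (by omega), fun j h7 h8 => by omega⟩
      · obtain ⟨g1, g2, g3, g4⟩ := run_shiftStep (m := m) h1 e1 e2 h6
        refine ⟨fun j hj => ?_, fun j h7 h8 => ?_⟩
        · obtain ⟨g5, g6, g7⟩ := g1 j (by omega)
          obtain ⟨g8, g9, g10⟩ := h4 j (by omega)
          exact ⟨g5.trans g8, g6.trans g9, g7.trans g10⟩
        · rcases Nat.lt_succ_iff_lt_or_eq.mp h8 with h9 | rfl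
          · obtain ⟨g5, g6, g7⟩ := g1 j h9.ne
            obtain ⟨g8, g9, g10⟩ := h5 j h7 h9
            exact ⟨(col_eq_of_real_eq g5).trans g8, g6.trans g9, g7.trans g10⟩
          · obtain ⟨g8, g9, g10⟩ := h4 (j + 1) (Or.inr (Nat.le_succ j))
            rw [e3, e4, col_eq_of_real_eq g8] at g2
            exact ⟨g2, g3.trans g9, g4.trans g10⟩)
  refine ⟨fun j hj => ?_, fun j h1 h2 => key.2 j h1 h2⟩
  obtain ⟨h1, h2, h3⟩ := key.1 j (Or.inl hj)
  exact ⟨col_eq_of_real_eq h1, h2, h3⟩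

end Algorithm

end

/-! ### The invariant at the start and after a birth -/

noncomputable section

open SimplexwiseFiltration

theorem CobInv.congr {m i n : ℕ} {F : SimplexwiseFiltration m} {d own : ℕ → ℕ} {C C' : ℕ → Chain m}
    (h : CobInv F i n d C own) (hC : ∀ j < n, C' j = C j) : CobInv F i n d C' own where
  mem j hj := by rw [hC j hj]; exact h.mem j hj
  homog j hj := by rw [hC j hj]; exact h.homog j hj
  pivot := h.pivot
  own_pivot k j hk := by
    have h1 := h.own_pivot k j hk
    rw [hC j h1.1]
    exact h1
  span y hy := by
    rw [Set.image_congr (fun j (hj : j ∈ Set.Iio n) => hC j hj)]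
    exact h.span y hy

theorem IsReduced.congr {m i n : ℕ} {F : SimplexwiseFiltration m} {hi : i < m}
    {C C' : ℕ → Chain m} {own : ℕ → ℕ} {x : Chain m}
    (h : IsReduced F i hi n C own x) (hC : ∀ j < n, C' j = C j) : IsReduced F i hi n C' own x :=
  ⟨by rw [Set.image_congr (fun j (hj : j ∈ Set.Iio n) => hC j hj)]; exact h.mem, h.homog, h.own⟩

theorem memInv_inputState {m : ℕ} (F : SimplexwiseFiltration m) : MemInv F 0 (inputState F) := by
  have hsupp : ∀ x ∈ supp m 0, x = 0 := fun x hx => funext fun k => hx k (Nat.zero_le _)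
  refine ⟨rfl, rfl, Nat.zero_le m, le_rfl, le_rfl, rfl, fun j hj => absurd hj (Nat.not_lt_zero j),
    ⟨fun j hj => absurd hj (Nat.not_lt_zero j), fun j hj => absurd hj (Nat.not_lt_zero j),
      fun j hj => absurd hj (Nat.not_lt_zero j), fun k j hk => absurd hk (Nat.succ_ne_zero j).symm,
      fun x hx => ?_⟩,
    fun j hj => absurd hj (Nat.not_lt_zero j), fun j hj => absurd hj (Nat.not_lt_zero j),
    fun j hj => absurd hj (Nat.not_lt_zero j),
    ⟨fun j hj => absurd hj (Nat.not_lt_zero j), fun j hj => absurd hj (Nat.not_lt_zero j),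
      fun j hj => absurd hj (Nat.not_lt_zero j), fun j j' _ hj => absurd hj (Nat.not_lt_zero j'),
      fun x hx => ?_⟩,
    ⟨fun l hl => absurd hl (Nat.not_lt_zero l), fun p k => ?_,
      fun l hl => absurd hl (Nat.not_lt_zero l), fun p k => ?_,
      fun l hl => absurd hl (Nat.not_lt_zero l), fun j hj => absurd hj (Nat.not_lt_zero j)⟩, rfl, rfl⟩
  · rw [hsupp x hx.1]; exact zero_mem _
  · rw [hsupp x hx.1.1]; exact zero_mem _
  · refine iff_of_false ?_ fun h => Nat.not_lt_zero k h.1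
    rintro ⟨l, hl, -⟩
    exact Nat.not_lt_zero l hl
  · refine iff_of_false ?_ fun h => absurd h.2.1 (not_lt.mpr h.1)
    rintro (⟨j, hj, -⟩ | ⟨l, hl, -⟩)
    · exact Nat.not_lt_zero j hj
    · exact Nat.not_lt_zero l hl

namespace Algorithm

open Prog

variable {m : ℕ} {F : SimplexwiseFiltration m} {i : ℕ}

/-- The new columns of Cob and BoC have been reduced, and their products and the pivot have been
computed. -/
structure MemReduced (F : SimplexwiseFiltration m) (i : ℕ) (hi : i < m) (s : State) : Prop extends
    MemInv F i s where
  reduced : IsReduced F i hi (s.nat .numCob 0 0) (fun j => s.col .matCob m j)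
    (fun k => s.nat .own 0 k) (s.col .matCob m (s.nat .numCob 0 0))
  boundary_eq : s.col .matBoC m (s.nat .numCob 0 0) = F.boundary (s.col .matCob m (s.nat .numCob 0 0))
  prodC_eq : ∀ j < m, s.real prodC 0 j = s.col .matCob m j ⬝ᵥ s.col .matCob m (s.nat .numCob 0 0)
  pivot_eq : (s.nat (.scratch 2) 0 0 = 0 ∧ s.col .matBoC m (s.nat .numCob 0 0) = 0) ∨
    ∃ k : Fin m, s.nat (.scratch 2) 0 0 = k + 1 ∧ IsPivot (s.col .matBoC m (s.nat .numCob 0 0)) k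

/-- The working columns occupy the position just past the counted columns of Cob and BoC, so the
invariant is undisturbed while they are reduced. -/
theorem memReduced_run (hi : i < m) {s : State} (h : MemInv F i s) :
    MemReduced F i hi (findPivot.run m (products.run m (reduce.run m (load.run m s)))) := by
  obtain ⟨l1, l2, l3⟩ := load_spec hi h.iter_eq h.vertex_eq h.numVertices_eq
  set s₁ := load.run m s with hs₁
  have n₁ : ∀ a, a ≠ .scratch 0 → a ≠ .scratch 1 → s₁.nat a = s.nat a := fun a h0 h1 =>
    run_nat_of_notMem m load (by
      simp [load, incidenceStep, compareStep, row, natWrites, h0, h1]) s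
  have hn₁ : s₁.nat .numCob 0 0 = s.nat .numCob 0 0 := by rw [n₁ _ (by simp) (by simp)]
  have c₁ : ∀ j < s.nat .numCob 0 0, s₁.col .matCob m j = s.col .matCob m j := fun j hj =>
    col_eq_of_real_eq (l1 j hj.ne).2
  have b₁ : ∀ j < s.nat .numCob 0 0, s₁.col .matBoC m j = s.col .matBoC m j := fun j hj =>
    col_eq_of_real_eq (l1 j hj.ne).1
  obtain ⟨r1, r2, r3⟩ := reduce_spec hi h.cob hn₁ (own := fun k => s.nat .own 0 k)
    (by rw [n₁ _ (by simp) (by simp)]) c₁ (fun j hj => by rw [b₁ j hj, h.boc j hj]) l2 l3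
  set s₂ := reduce.run m s₁ with hs₂
  have n₂ : ∀ a, a ≠ .scratch 0 → a ≠ .scratch 1 → s₂.nat a = s.nat a := fun a h0 h1 =>
    (run_nat_of_notMem m reduce (by simp [reduce, reduceStep, row, natWrites, h0, h1]) s₁).trans
      (n₁ a h0 h1)
  have hn₂ : s₂.nat .numCob 0 0 = s.nat .numCob 0 0 := by rw [n₂ _ (by simp) (by simp)]
  have p1 := fun j (hj : j < m) => products_spec hn₂ hj
  set s₃ := products.run m s₂ with hs₃
  have n₃ : ∀ a, a ≠ .scratch 0 → a ≠ .scratch 1 → s₃.nat a = s.nat a := fun a h0 h1 =>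
    (run_nat_of_notMem m products (by simp [products, total, natWrites, h0, h1]) s₂).trans
      (n₂ a h0 h1)
  have e₃ : ∀ a, a ≠ prodC → s₃.real a = s₂.real a := fun a ha =>
    run_real_of_notMem m products (by simpa [products, total, realWrites] using ha) s₂
  have hn₃ : s₃.nat .numCob 0 0 = s.nat .numCob 0 0 := by rw [n₃ _ (by simp) (by simp)]
  have f1 := findPivot_spec (m := m) hn₃
  set u := findPivot.run m s₃ with hu
  have nu : ∀ a, a ≠ .scratch 0 → a ≠ .scratch 1 → a ≠ .scratch 2 → u.nat a = s.nat a :=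
    fun a h0 h1 h2 => (run_nat_of_notMem m findPivot (by simp [findPivot, natWrites, h0, h2]) s₃).trans
      (n₃ a h0 h1)
  have eu : u.real = s₃.real := funext fun a => run_real_of_notMem m findPivot
    (by simp [findPivot, realWrites]) s₃
  have rest : ∀ a, a ≠ prodC → a ≠ factor → a ≠ sign → a ≠ .matCob → a ≠ .matBoC →
      u.real a = s.real a := fun a h1 h2 h3 h4 h5 => by
    rw [eu, e₃ a h1, hs₂, hs₁, run_real_of_notMem m reduce (by
      simp [reduce, reduceStep, row, realWrites, h2, h4, h5]), run_real_of_notMem m load (by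
      simp [load, incidenceStep, compareStep, row, realWrites, h2, h3, h4, h5])]
  have cu : ∀ j, u.col .matCob m j = s₂.col .matCob m j := fun j =>
    col_eq_of_real_eq (by rw [eu, e₃ _ (by simp)])
  have bu : ∀ j, u.col .matBoC m j = s₂.col .matBoC m j := fun j =>
    col_eq_of_real_eq (by rw [eu, e₃ _ (by simp)])
  have b₃ : ∀ j, s₃.col .matBoC m j = s₂.col .matBoC m j := fun j =>
    col_eq_of_real_eq (by rw [e₃ _ (by simp)])
  have cs : ∀ j < s.nat .numCob 0 0, u.col .matCob m j = s.col .matCob m j := fun j hj => by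
    rw [cu, col_eq_of_real_eq (r1 j hj.ne).2, c₁ j hj]
  have bs : ∀ j < s.nat .numCob 0 0, u.col .matBoC m j = s.col .matBoC m j := fun j hj => by
    rw [bu, col_eq_of_real_eq (r1 j hj.ne).1, b₁ j hj]
  have hcol : ∀ a, a ≠ prodC → a ≠ factor → a ≠ sign → a ≠ .matCob → a ≠ .matBoC →
      ∀ j, u.col a m j = s.col a m j := fun a h1 h2 h3 h4 h5 j =>
    col_eq_of_real_eq (by rw [rest a h1 h2 h3 h4 h5])
  have hnu : u.nat .numCob = s.nat .numCob := nu _ (by simp) (by simp) (by simp)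
  refine ⟨⟨?_, ?_, h.le, ?_, ?_, ?_, ?_, ?_, ?_, ?_, ?_, ?_, ?_, ?_, ?_⟩, ?_, ?_, ?_, ?_⟩
  · rw [nu _ (by simp) (by simp) (by simp)]; exact h.size_eq
  · rw [nu _ (by simp) (by simp) (by simp)]; exact h.iter_eq
  · rw [hnu]; exact h.numCob_le
  · rw [nu _ (by simp) (by simp) (by simp)]; exact h.numH_le
  · rw [hnu, nu _ (by simp) (by simp) (by simp)]; exact h.numR_eq
  · rw [hnu, nu .degR (by simp) (by simp) (by simp), nu .degCob (by simp) (by simp) (by simp)]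
    exact h.degR_eq
  · rw [hnu, nu .own (by simp) (by simp) (by simp), nu .degCob (by simp) (by simp) (by simp)]
    exact h.cob.congr cs
  · rw [hnu]
    intro j hj
    rw [bs j hj, cs j hj, h.boc j hj]
  · rw [hnu]
    intro j hj
    rw [bs j hj, hcol _ (by simp) (by simp) (by simp) (by simp) (by simp), h.matR j hj]
  · rw [hnu]
    intro j hj l hl
    rw [cs j hj, cs l hl, rest _ (by simp) (by simp) (by simp) (by simp) (by simp), h.gram j hj l hl]
  · rw [nu .numH (by simp) (by simp) (by simp), nu .degH (by simp) (by simp) (by simp),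
      nu .birthH (by simp) (by simp) (by simp)]
    simp only [hcol .matH (by simp) (by simp) (by simp) (by simp) (by simp)]
    exact h.harm
  · rw [nu .numH (by simp) (by simp) (by simp), nu .degH (by simp) (by simp) (by simp),
      nu .birthH (by simp) (by simp) (by simp), nu .numBars (by simp) (by simp) (by simp),
      nu .degBar (by simp) (by simp) (by simp), nu .birthBar (by simp) (by simp) (by simp),
      nu .deathBar (by simp) (by simp) (by simp)]
    simp only [hcol .repBar (by simp) (by simp) (by simp) (by simp) (by simp)]
    exact h.bars
  · rw [nu _ (by simp) (by simp) (by simp)]; exact h.vertex_eq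
  · rw [nu _ (by simp) (by simp) (by simp)]; exact h.numVertices_eq
  · rw [hnu, nu .own (by simp) (by simp) (by simp), cu]
    exact r2.congr cs
  · rw [hnu, bu, cu]; exact r3
  · intro j hj
    rw [hnu, cu, cu, eu, p1 j hj]
  · rw [hnu, bu, ← b₃]; exact f1

theorem memInv_birth (hi : i < m) {s : State} (h : MemReduced F i hi s)
    (h0 : s.col .matBoC m (s.nat .numCob 0 0) = 0) :
    MemInv F (i + 1) ((assignNat .iter (.succ new)).run m (birth.run m s)) := by
  obtain ⟨b1, b2, b3, b4, b5, b6, b7, b8, b9⟩ :=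
    birth_spec (m := m) (s := s) rfl rfl
  set x := s.col .matCob m (s.nat .numCob 0 0) with hx
  have hr : F.boundary x = 0 := by rw [hx, ← h.boundary_eq, h0]
  have hnm : s.nat .numCob 0 0 < m := h.numCob_le.trans_lt hi
  set u := birth.run m s with hu
  have nu : ∀ a, a ≠ .scratch 0 → a ≠ .scratch 1 → a ≠ .degH → a ≠ .birthH → a ≠ .numH →
      u.nat a = s.nat a := fun a h0 h1 h2 h3 h4 => run_nat_of_notMem m birth (by
        simp [birth, projectStep, row, natWrites, h0, h1, h2, h3, h4]) s
  have eu : ∀ a, a ≠ .matH → a ≠ factor → a ≠ .matSC → a ≠ .matCob → u.real a = s.real a :=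
    fun a h0 h1 h2 h3 => run_real_of_notMem m birth (by
        simp [birth, projectStep, row, realWrites, h0, h1, h2, h3]) s
  set v := (assignNat .iter (.succ new)).run m u with hv
  have nv : ∀ a, a ≠ .iter → v.nat a = u.nat a := fun a ha => setNat_nat_of_ne ha
  have n : ∀ a, a ≠ .scratch 0 → a ≠ .scratch 1 → a ≠ .degH → a ≠ .birthH → a ≠ .numH →
      a ≠ .iter → v.nat a = s.nat a := fun a h0 h1 h2 h3 h4 h5 => (nv a h5).trans (nu a h0 h1 h2 h3 h4)
  have colv : ∀ a j, v.col a m j = u.col a m j := fun _ _ => rfl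
  have realv : ∀ a, v.real a = u.real a := fun _ => rfl
  have colu : ∀ a, a ≠ .matH → a ≠ factor → a ≠ .matSC → a ≠ .matCob → ∀ j,
      v.col a m j = s.col a m j := fun a h0 h1 h2 h3 j => by
    rw [colv]; exact col_eq_of_real_eq (by rw [eu a h0 h1 h2 h3])
  have hnCob : v.nat .numCob = s.nat .numCob := n _ (by simp) (by simp) (by simp) (by simp) (by simp)
    (by simp)
  have hC : ∀ j < s.nat .numCob 0 0, v.col .matCob m j = s.col .matCob m j -
      (s.col .matCob m j ⬝ᵥ x / x ⬝ᵥ x) • x := fun j hj => by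
    rw [colv, b3 j (hj.trans hnm), h.prodC_eq j (hj.trans hnm), h.prodC_eq _ hnm]
  have hdim : s.nat .numVertices (s.nat .iter 0 0) 0 - 1 = F.dim ⟨i, hi⟩ := by
    have := inputState_numVertices F ⟨i, hi⟩
    rw [h.iter_eq, h.numVertices_eq]
    rw [F.card_eq_dim_add_one] at this
    simp only at this
    omega
  rw [hdim] at b6
  rw [h.iter_eq] at b8
  have hH : ∀ j, j ≠ s.nat .numH 0 0 → v.col .matH m j = s.col .matH m j := fun j hj => by
    rw [colv]; exact col_eq_of_real_eq (b1 j hj)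
  refine ⟨?_, ?_, hi, ?_, ?_, ?_, ?_, ?_, ?_, ?_, ?_, ?_, ?_, ?_, ?_⟩
  · rw [n _ (by simp) (by simp) (by simp) (by simp) (by simp) (by simp)]; exact h.size_eq
  · have : u.nat .iter 0 0 = i := by
      rw [nu _ (by simp) (by simp) (by simp) (by simp) (by simp)]; exact h.iter_eq
    simp [hv, run, NatExpr.eval, State.setNat, this]
  · rw [hnCob]; exact h.numCob_le.trans (Nat.le_succ i)
  · rw [nv _ (by simp), b9]; exact Nat.succ_le_succ h.numH_le
  · rw [hnCob, n _ (by simp) (by simp) (by simp) (by simp) (by simp) (by simp)]; exact h.numR_eq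
  · rw [hnCob, n .degR (by simp) (by simp) (by simp) (by simp) (by simp) (by simp),
      n .degCob (by simp) (by simp) (by simp) (by simp) (by simp) (by simp)]
    exact h.degR_eq
  · rw [hnCob, n .degCob (by simp) (by simp) (by simp) (by simp) (by simp) (by simp),
      n .own (by simp) (by simp) (by simp) (by simp) (by simp) (by simp)]
    exact h.reduced.cobInv_of_boundary_eq_zero h.cob hr hC
  · rw [hnCob]
    intro j hj
    rw [colu _ (by simp) (by simp) (by simp) (by simp), hC j hj, map_sub, map_smul, hr, smul_zero,
      sub_zero, h.boc j hj]
  · rw [hnCob]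
    intro j hj
    rw [colu _ (by simp) (by simp) (by simp) (by simp), colu _ (by simp) (by simp) (by simp) (by simp),
      h.matR j hj]
  · rw [hnCob]
    intro j hj l hl
    -- Expanding the product of two projected columns gives the old Gram entry minus (Cob[j] ·
    -- x)(Cob[l] · x)/(x · x).
    have hxx : x ⬝ᵥ x ≠ 0 := h.reduced.dotProduct_self_ne_zero h.cob
    rw [realv, b4 j (hj.trans hnm) l (hl.trans hnm), hC j hj, hC l hl, h.gram j hj l hl,
      h.prodC_eq j (hj.trans hnm), h.prodC_eq l (hl.trans hnm), h.prodC_eq _ hnm, ← hx]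
    simp only [sub_dotProduct, dotProduct_sub, smul_dotProduct, dotProduct_smul, smul_eq_mul,
      dotProduct_comm x (s.col .matCob m l)]
    field_simp
    ring
  · rw [nv .numH (by simp), nv .degH (by simp), nv .birthH (by simp), b9]
    exact h.reduced.harmInv_of_boundary_eq_zero h.cob hr h.harm (fun j hj => b5 j hj.ne)
      (fun j hj => b7 j hj.ne) (fun j hj => hH j hj.ne) b6 b8 ((colv _ _).trans b2)
  · rw [nv .numH (by simp), nv .degH (by simp), nv .birthH (by simp), b9,
      n .numBars (by simp) (by simp) (by simp) (by simp) (by simp) (by simp),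
      n .degBar (by simp) (by simp) (by simp) (by simp) (by simp) (by simp),
      n .birthBar (by simp) (by simp) (by simp) (by simp) (by simp) (by simp),
      n .deathBar (by simp) (by simp) (by simp) (by simp) (by simp) (by simp)]
    simp only [colu .repBar (by simp) (by simp) (by simp) (by simp)]
    exact h.bars.of_birth hi (h.reduced.isBirth_iff_of_boundary_eq_zero h.cob hr)
      (h.reduced.not_isDeath_of_boundary_eq_zero h.cob hr) (fun j hj => b5 j hj.ne)
      (fun j hj => b7 j hj.ne) b6 b8
  · rw [n _ (by simp) (by simp) (by simp) (by simp) (by simp) (by simp)]; exact h.vertex_eq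
  · rw [n _ (by simp) (by simp) (by simp) (by simp) (by simp) (by simp)]; exact h.numVertices_eq

end Algorithm

end

/-! ### The invariant after a death -/

noncomputable section

open SimplexwiseFiltration

namespace Algorithm

open Prog

variable {m : ℕ} {F : SimplexwiseFiltration m} {i : ℕ}

theorem run_recount (s : State) :
    (recount.run m s).nat .numH 0 0 = s.nat .numH 0 0 - 1 ∧
    (recount.run m s).nat .numBars 0 0 = s.nat .numBars 0 0 + 1 ∧
    (recount.run m s).nat .numCob 0 0 = s.nat .numCob 0 0 + 1 ∧
    (recount.run m s).nat .numR 0 0 = s.nat .numR 0 0 + 1 := by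
  simp [recount, run, NatExpr.eval, State.setNat]

theorem memInv_death (hi : i < m) {s : State} (h : MemReduced F i hi s) {k₀ : Fin m}
    (hp : s.nat (.scratch 2) 0 0 = k₀ + 1) (hk₀ : IsPivot (s.col .matBoC m (s.nat .numCob 0 0)) k₀) :
    MemInv F (i + 1) ((assignNat .iter (.succ new)).run m (death.run m s)) := by
  have hnm : s.nat .numCob 0 0 < m := h.numCob_le.trans_lt hi
  set n := s.nat .numCob 0 0 with hn
  set x := s.col .matCob m n with hx
  have hbx : s.col .matBoC m n = F.boundary x := h.boundary_eq
  rw [hbx] at hk₀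
  have hr : F.boundary x ≠ 0 := fun h0 => hk₀.1 (by rw [h0]; rfl)
  obtain ⟨j₁, hj₁, hne₁⟩ := h.reduced.exists_first_dotProduct_ne_zero h.cob hr h.harm
  obtain ⟨nH, hnH⟩ : ∃ nH, s.nat .numH 0 0 = nH + 1 := ⟨s.nat .numH 0 0 - 1, by omega⟩
  have hnHm : nH + 1 ≤ m := by have := h.numH_le; omega
  -- the new columns
  obtain ⟨x1, x2, x3, x4, x5, x6, x7, x8, x9, x10, x11⟩ := extend_spec (m := m) hn.symm hnm hp
  set s₁ := extend.run m s with hs₁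
  have n₁ : ∀ a, a ≠ .own → a ≠ .scratch 0 → a ≠ .scratch 1 → a ≠ .degCob → a ≠ .degR →
      s₁.nat a = s.nat a := fun a h0 h1 h2 h3 h4 => run_nat_of_notMem m extend (by
        simp [extend, row, natWrites, h0, h1, h2, h3, h4]) s
  have e₁ : ∀ a, a ≠ .matR → a ≠ .matSC → s₁.real a = s.real a := fun a h0 h1 =>
    run_real_of_notMem m extend (by simp [extend, row, realWrites, h0, h1]) s
  have c₁ : ∀ a, a ≠ .matR → a ≠ .matSC → ∀ j, s₁.col a m j = s.col a m j := fun a h0 h1 j =>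
    col_eq_of_real_eq (by rw [e₁ a h0 h1])
  -- the first column
  obtain ⟨g1, j₀, hj₀, g2, g3, g4⟩ := findFirst_spec (m := m) (s := s₁) (n := n) (nH := nH + 1)
    (by rw [n₁ _ (by simp) (by simp) (by simp) (by simp) (by simp)])
    (by rw [n₁ _ (by simp) (by simp) (by simp) (by simp) (by simp), hnH]) hnHm
    ⟨j₁, hnH ▸ hj₁, by
      rw [c₁ _ (by simp) (by simp), c₁ _ (by simp) (by simp), hbx]; exact hne₁⟩
  set s₂ := findFirst.run m s₁ with hs₂
  simp only [c₁ .matH (by simp) (by simp), c₁ .matBoC (by simp) (by simp), hbx] at g1 g3 g4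
  have n₂ : ∀ a, a ≠ .scratch 0 → a ≠ .scratch 1 → a ≠ .scratch 3 → s₂.nat a = s₁.nat a :=
    fun a h0 h1 h2 => run_nat_of_notMem m findFirst (by
        simp [findFirst, total, natWrites, h0, h1, h2]) s₁
  have e₂ : ∀ a, a ≠ prodH → s₂.real a = s₁.real a := fun a h0 =>
    run_real_of_notMem m findFirst (by simp [findFirst, total, realWrites, h0]) s₁
  -- the finished bar
  set N := s.nat .numBars 0 0 with hN
  obtain ⟨r1, r2, r3, r4, r5⟩ := recordBar_spec (m := m) (s := s₂) (je := first) (de := new) (j := j₀)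
    (d := i) (N := N)
    (by rw [n₂ _ (by simp) (by simp) (by simp), n₁ _ (by simp) (by simp) (by simp) (by simp) (by simp)])
    (fun s' _ h2 _ => by simp only [NatExpr.eval]; rw [h2, g2])
    (fun s' h1 _ => by
      simp only [NatExpr.eval]
      rw [h1, n₂ _ (by simp) (by simp) (by simp),
        n₁ _ (by simp) (by simp) (by simp) (by simp) (by simp), h.iter_eq])
  set s₃ := (recordBar first new).run m s₂ with hs₃
  have n₃ : ∀ a, a ≠ .scratch 1 → a ≠ .degBar → a ≠ .birthBar → a ≠ .deathBar →
      s₃.nat a = s₂.nat a := fun a h0 h1 h2 h3 => run_nat_of_notMem m (recordBar first new) (by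
        simp [recordBar, row, natWrites, h0, h1, h2, h3]) s₂
  have e₃ : ∀ a, a ≠ .repBar → s₃.real a = s₂.real a := fun a h0 =>
    run_real_of_notMem m (recordBar first new) (by simp [recordBar, row, realWrites, h0]) s₂
  -- the other columns
  obtain ⟨t1, t2⟩ := shift_spec (m := m) (s := s₃) (j₀ := j₀) (N := N)
    (by rw [n₃ _ (by simp) (by simp) (by simp) (by simp), g2])
    (by rw [n₃ _ (by simp) (by simp) (by simp) (by simp), n₂ _ (by simp) (by simp) (by simp),
      n₁ _ (by simp) (by simp) (by simp) (by simp) (by simp)])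
  set s₄ := (Prog.up 0 shiftStep).run m s₃ with hs₄
  have n₄ : ∀ a, a ≠ .scratch 0 → a ≠ .scratch 1 → a ≠ .degH → a ≠ .birthH →
      s₄.nat a = s₃.nat a := fun a h0 h1 h2 h3 => run_nat_of_notMem m (Prog.up 0 shiftStep) (by
        simp [shiftStep, row, natWrites, h0, h1, h2, h3]) s₃
  have e₄ : ∀ a, a ≠ factor → a ≠ .matH → s₄.real a = s₃.real a := fun a h0 h1 =>
    run_real_of_notMem m (Prog.up 0 shiftStep) (by simp [shiftStep, row, realWrites, h0, h1]) s₃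
  set v := (assignNat .iter (.succ new)).run m (death.run m s) with hv
  have hvr : ∀ a, v.real a = s₄.real a := fun _ => rfl
  have nv' : ∀ a, a ≠ .numH → a ≠ .numBars → a ≠ .numCob → a ≠ .numR → a ≠ .iter →
      v.nat a = s₄.nat a := fun a h0 h1 h2 h3 h4 =>
    run_nat_of_notMem m (.seq recount (assignNat .iter (.succ new))) (by
      simp [recount, natWrites, h0, h1, h2, h3, h4]) s₄
  -- frames
  have nat4 : ∀ a ∈ [NatArray.size, .iter, .numH, .numR, .numCob, .numBars, .vertex, .numVertices],
      s₄.nat a = s.nat a := fun a ha => by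
    rw [n₄ a, n₃ a, n₂ a, n₁ a] <;> rintro rfl <;> simp at ha
  have natv : ∀ a ∈ [NatArray.size, .vertex, .numVertices], v.nat a = s.nat a := fun a ha => by
    rw [nv' a, nat4 a] <;> revert ha <;> simp <;> rintro (rfl | rfl | rfl) <;> simp
  have natv1 : ∀ a ∈ [NatArray.own, .degCob, .degR], v.nat a = s₁.nat a := fun a ha => by
    rw [nv' a, n₄ a, n₃ a, n₂ a] <;> rintro rfl <;> simp at ha
  have vr : ∀ a, a ≠ .iter → v.nat a = (recount.run m s₄).nat a := fun a ha => setNat_nat_of_ne ha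
  obtain ⟨q1, q2, q3, q4⟩ := run_recount (m := m) s₄
  have vnumH : v.nat .numH 0 0 = nH := by
    rw [vr _ (by simp), q1, nat4 _ (by simp), hnH, Nat.add_sub_cancel]
  have vnumBars : v.nat .numBars 0 0 = N + 1 := by rw [vr _ (by simp), q2, nat4 _ (by simp)]
  have vnumCob : v.nat .numCob 0 0 = n + 1 := by rw [vr _ (by simp), q3, nat4 _ (by simp)]
  have vnumR : v.nat .numR 0 0 = n + 1 := by
    rw [vr _ (by simp), q4, nat4 _ (by simp), h.numR_eq]
  have viter : v.nat .iter 0 0 = i + 1 := by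
    change (recount.run m s₄).nat .iter 0 0 + 1 = i + 1
    rw [run_nat_of_notMem m recount (by simp [recount, natWrites]), nat4 _ (by simp), h.iter_eq]
  have realv : ∀ a ∈ [RealArray.matCob, .matBoC], v.real a = s.real a := fun a ha => by
    rw [hvr, e₄ a, e₃ a, e₂ a, e₁ a] <;> rintro rfl <;> simp at ha
  have realv1 : ∀ a ∈ [RealArray.matR, .matSC], v.real a = s₁.real a := fun a ha => by
    rw [hvr, e₄ a, e₃ a, e₂ a] <;> rintro rfl <;> simp at ha
  have colv : ∀ a ∈ [RealArray.matCob, .matBoC], ∀ j, v.col a m j = s.col a m j := fun a ha j =>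
    col_eq_of_real_eq (by rw [realv a ha])
  have hdim : s.nat .numVertices (s.nat .iter 0 0) 0 - 1 = F.dim ⟨i, hi⟩ := by
    have := inputState_numVertices F ⟨i, hi⟩
    rw [h.iter_eq, h.numVertices_eq]
    rw [F.card_eq_dim_add_one] at this
    simp only at this
    omega
  rw [hdim] at x9 x11
  have hdim1 : F.dim k₀ + 1 = F.dim ⟨i, hi⟩ := boundary_ne_zero_dim h.reduced.homog hk₀.1
  -- the columns of H and the bars
  have H₃ : ∀ j, s₃.col .matH m j = s.col .matH m j := fun j =>
    col_eq_of_real_eq (by rw [e₃ _ (by simp), e₂ _ (by simp), e₁ _ (by simp) (by simp)])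
  have H₂ : ∀ j, s₂.col .matH m j = s.col .matH m j := fun j =>
    col_eq_of_real_eq (by rw [e₂ _ (by simp), e₁ _ (by simp) (by simp)])
  have dH₂ : s₂.nat .degH = s.nat .degH := by
    rw [n₂ _ (by simp) (by simp) (by simp), n₁ _ (by simp) (by simp) (by simp) (by simp) (by simp)]
  have dH₃ : s₃.nat .degH = s.nat .degH := by
    rw [n₃ _ (by simp) (by simp) (by simp) (by simp), dH₂]
  have bH₂ : s₂.nat .birthH = s.nat .birthH := by
    rw [n₂ _ (by simp) (by simp) (by simp), n₁ _ (by simp) (by simp) (by simp) (by simp) (by simp)]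
  have bH₃ : s₃.nat .birthH = s.nat .birthH := by
    rw [n₃ _ (by simp) (by simp) (by simp) (by simp), bH₂]
  have vdH : v.nat .degH = s₄.nat .degH := nv' _ (by simp) (by simp) (by simp) (by simp) (by simp)
  have vbH : v.nat .birthH = s₄.nat .birthH := nv' _ (by simp) (by simp) (by simp) (by simp) (by simp)
  have vH : ∀ j, v.col .matH m j = s₄.col .matH m j := fun _ => rfl
  have prod₃ : ∀ j < m, s₃.real prodH 0 j = s.col .matH m j ⬝ᵥ F.boundary x := fun j hj => by
    rw [e₃ _ (by simp), g1 j hj]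
  have ld : ∀ j < j₀, v.nat .degH j 0 = s.nat .degH j 0 := fun j hj => by
    rw [vdH, (t1 j hj).2.1, dH₃]
  have lb : ∀ j < j₀, v.nat .birthH j 0 = s.nat .birthH j 0 := fun j hj => by
    rw [vbH, (t1 j hj).2.2, bH₃]
  have lH : ∀ j < j₀, v.col .matH m j = s.col .matH m j := fun j hj => by
    rw [vH, (t1 j hj).1, H₃]
  have gd : ∀ j, j₀ ≤ j → j < nH → v.nat .degH j 0 = s.nat .degH (j + 1) 0 := fun j h1 h2 => by
    rw [vdH, (t2 j h1 (by omega)).2.1, dH₃]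
  have gb : ∀ j, j₀ ≤ j → j < nH → v.nat .birthH j 0 = s.nat .birthH (j + 1) 0 := fun j h1 h2 => by
    rw [vbH, (t2 j h1 (by omega)).2.2, bH₃]
  have gH : ∀ j, j₀ ≤ j → j < nH → v.col .matH m j = s.col .matH m (j + 1) -
      (s.col .matH m (j + 1) ⬝ᵥ F.boundary x / s.col .matH m j₀ ⬝ᵥ F.boundary x) •
        s.col .matH m j₀ := fun j h1 h2 => by
    rw [vH, (t2 j h1 (by omega)).1, H₃, r2, H₂, prod₃ _ (by omega), prod₃ _ (by omega)]
  have vbars : ∀ a ∈ [NatArray.degBar, .birthBar, .deathBar], v.nat a = s₃.nat a := fun a ha => by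
    rw [nv' a, n₄ a] <;> rintro rfl <;> simp at ha
  have bars₂ : ∀ a ∈ [NatArray.degBar, .birthBar, .deathBar], s₂.nat a = s.nat a := fun a ha => by
    rw [n₂ a, n₁ a] <;> rintro rfl <;> simp at ha
  have vrep : v.real .repBar = s₃.real .repBar := by rw [hvr, e₄ _ (by simp) (by simp)]
  have hharm : HarmInv F i (nH + 1) (fun j => s.nat .degH j 0) (fun j => s.nat .birthH j 0)
    (fun j => s.col .matH m j) := hnH ▸ h.harm
  have hbars : BarInv F i (nH + 1) (fun j => s.nat .degH j 0) (fun j => s.nat .birthH j 0)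
      N (fun l => s.nat .degBar l 0) (fun l => s.nat .birthBar l 0)
      (fun l => s.nat .deathBar l 0) (fun l => s.col .repBar m l) := hnH ▸ h.bars
  have hharm' := h.reduced.harmInv_of_boundary_ne_zero h.cob hr hharm hj₀ g3 g4 ld lb lH gd gb gH
  have hrep : F.IsRep (s.nat .degH j₀ 0) (s.nat .birthH j₀ 0) i (s.col .matH m j₀) := by
    obtain ⟨k, hk, hkp⟩ := hharm.pivot j₀ hj₀
    rw [← hk]
    refine ⟨isPartialRep_of_isPivot hi.le (hharm.mem j₀ hj₀) (hharm.homog j₀ hj₀) hkp, fun _ h1 => ?_⟩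
    exact g3 ((h.reduced.mem_harm_succ_iff h.cob hr).mp (mem_harmonic_iff.mp h1).1).2
  have hcases : ∀ j < n + 1, j < n ∨ j = n := fun j hj => Nat.lt_succ_iff_lt_or_eq.mp hj
  refine ⟨?_, viter, hi, ?_, ?_, ?_, ?_, ?_, ?_, ?_, ?_, ?_, ?_, ?_, ?_⟩
  · rw [natv _ (by simp)]; exact h.size_eq
  · rw [vnumCob]; exact Nat.succ_le_succ h.numCob_le
  · rw [vnumH]; have := h.numH_le; omega
  · rw [vnumR, vnumCob]
  · rw [vnumCob, natv1 .degR (by simp), natv1 .degCob (by simp)]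
    intro j hj
    rcases hcases j hj with h1 | rfl
    · rw [x10 j h1.ne, x8 j h1.ne]; exact h.degR_eq j h1
    -- By `hdim1` the new simplex has dimension at least one, so the truncated subtraction in the
    -- degree of R is exact.
    · rw [x11, x9]; omega
  · rw [vnumCob, natv1 .own (by simp), natv1 .degCob (by simp)]
    simp only [colv .matCob (by simp)]
    exact h.reduced.cobInv_of_boundary_ne_zero h.cob hr hk₀ (fun j hj => x8 j hj.ne) x9
      (fun j _ => rfl) rfl x1 (fun k hk => x2 k fun he => hk (Fin.ext he))
  · rw [vnumCob]
    intro j hj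
    rw [colv .matCob (by simp), colv .matBoC (by simp)]
    rcases hcases j hj with h1 | rfl
    · exact h.boc j h1
    · exact hbx
  · rw [vnumCob]
    intro j hj
    rw [colv .matBoC (by simp), col_eq_of_real_eq (congrFun (realv1 .matR (by simp)) j) (m := m)]
    rcases hcases j hj with h1 | rfl
    · rw [col_eq_of_real_eq (x3 j h1.ne), h.matR j h1]
    · exact x4
  · rw [vnumCob]
    intro j hj l hl
    rw [colv .matCob (by simp), colv .matCob (by simp), realv1 .matSC (by simp)]
    rcases hcases l hl with h2 | rfl
    · rcases hcases j hj with h1 | rfl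
      · rw [x5 j h1.ne l h2.ne, h.gram j h1 l h2]
      · rw [x6 l (h2.trans hnm), h.prodC_eq l (h2.trans hnm), dotProduct_comm]
    · rw [x7 j (by omega), h.prodC_eq j (by omega)]
  · rw [vnumH]; exact hharm'
  · rw [vnumH, vnumBars, vbars .degBar (by simp), vbars .birthBar (by simp), vbars .deathBar (by simp)]
    refine hbars.of_death hj₀ hharm.mono (h.reduced.not_isBirth_of_boundary_ne_zero h.cob hr)
      (h.reduced.isDeath_iff_of_boundary_ne_zero h.cob hr (hharm.mem j₀ hj₀) (hharm.homog j₀ hj₀) g3)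
      ld lb gd gb (fun l hl => ?_) (fun l hl => ?_) (fun l hl => ?_) (fun l hl => ?_) ?_ ?_ r5 ?_
    · simp only [(r1 l hl.ne).2.1, bars₂ .degBar (by simp)]
    · simp only [(r1 l hl.ne).2.2.1, bars₂ .birthBar (by simp)]
    · simp only [(r1 l hl.ne).2.2.2, bars₂ .deathBar (by simp)]
    · refine col_eq_of_real_eq ?_
      rw [vrep, (r1 l hl.ne).1, e₂ _ (by simp), e₁ _ (by simp) (by simp)]
    · simp only [r3, dH₂]
    · simp only [r4, bH₂]
    · have : v.col .repBar m N = s.col .matH m j₀ := by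
        rw [col_eq_of_real_eq (congrFun vrep N), r2, H₂]
      rw [this]; exact hrep
  · rw [natv _ (by simp)]; exact h.vertex_eq
  · rw [natv _ (by simp)]; exact h.numVertices_eq

theorem memInv_step (hi : i < m) {s : State} (h : MemInv F i s) :
    MemInv F (i + 1) (step.run m s) := by
  have h1 := memReduced_run hi h
  rw [step]
  simp only [run]
  set u := findPivot.run m (products.run m (reduce.run m (load.run m s)))
  rcases h1.pivot_eq with ⟨hp, h0⟩ | ⟨k, hp, hk⟩
  · rw [if_pos (show (Test.natEq pivot (.const 0)).Holds u from hp)]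
    exact memInv_birth hi h1 h0
  · rw [if_neg (show ¬ (Test.natEq pivot (.const 0)).Holds u from
      fun h : u.nat (.scratch 2) 0 0 = 0 => by omega)]
    exact memInv_death hi h1 hp hk

end Algorithm

end

/-! ### The final step, the output and the running time -/

noncomputable section

open SimplexwiseFiltration

namespace Algorithm

open Prog

variable {m : ℕ} {F : SimplexwiseFiltration m} {i : ℕ}

theorem final_spec {s : State} {N nH : ℕ} (hN : s.nat .numBars 0 0 = N) (hnH : s.nat .numH 0 0 = nH)
    (hnm : nH ≤ m) (hm : s.nat .size 0 0 = m) :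
    (final.run m s).nat .numBars 0 0 = N + nH ∧
    (∀ l < N, (final.run m s).col .repBar m l = s.col .repBar m l ∧
      (final.run m s).nat .degBar l 0 = s.nat .degBar l 0 ∧
      (final.run m s).nat .birthBar l 0 = s.nat .birthBar l 0 ∧
      (final.run m s).nat .deathBar l 0 = s.nat .deathBar l 0) ∧
    ∀ j < nH, (final.run m s).col .repBar m (N + j) = s.col .matH m j ∧
      (final.run m s).nat .degBar (N + j) 0 = s.nat .degH j 0 ∧
      (final.run m s).nat .birthBar (N + j) 0 = s.nat .birthH j 0 ∧
      (final.run m s).nat .deathBar (N + j) 0 = m := by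
  have key := run_up_induction (m := m) (x := 0) (s := s)
    (P := .when (.natLt x numH) (.seq (recordBar x (.scalar .size)) (assignNat .numBars (.succ numBars))))
    (I := fun k t => t.nat .numBars 0 0 = N + min k nH ∧
    (∀ l < N, t.col .repBar m l = s.col .repBar m l ∧
      t.nat .degBar l 0 = s.nat .degBar l 0 ∧ t.nat .birthBar l 0 = s.nat .birthBar l 0 ∧
      t.nat .deathBar l 0 = s.nat .deathBar l 0) ∧
    ∀ j < min k nH, t.col .repBar m (N + j) = s.col .matH m j ∧
      t.nat .degBar (N + j) 0 = s.nat .degH j 0 ∧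
      t.nat .birthBar (N + j) 0 = s.nat .birthH j 0 ∧ t.nat .deathBar (N + j) 0 = m)
    ⟨by simp [State.setNat, hN], fun l _ => ⟨rfl, by simp [State.setNat]⟩, by simp⟩ (by
      rintro k hk s' h1 h2 h3 ⟨h4, h5, h6⟩
      have nat' : ∀ a ∈ [NatArray.numH, .size, .degH, .birthH], s'.nat a = s.nat a := fun a ha =>
        h2 a (by rcases a <;> simp [natWrites, recordBar, row] at ha ⊢)
      have eH : ∀ j, s'.col .matH m j = s.col .matH m j := fun j =>
        col_eq_of_real_eq (by rw [h3 _ (by simp [realWrites, recordBar, row])])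
      rcases lt_or_ge k nH with hkn | hkn
      · rw [min_eq_left hkn.le] at h4 h6
        obtain ⟨r1, r2, r3, r4, r5⟩ := recordBar_spec (m := m) (s := s') (je := x)
          (de := .scalar .size) (j := k) (d := m) h4
          (fun t _ _ h => by simp only [NatExpr.eval]; rw [h, h1])
          (fun t _ h => by simp only [NatExpr.eval]; rw [h, nat' _ (by simp), hm])
        rw [run, if_pos (by
          simp only [Test.Holds, NatExpr.eval]; rw [h1, nat' _ (by simp), hnH]; exact hkn)]
        set t := (recordBar x (.scalar .size)).run m s' with ht
        rw [nat' .degH (by simp)] at r3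
        rw [nat' .birthH (by simp)] at r4
        rw [eH] at r2
        have hb : t.nat .numBars 0 0 = N + k := by
          rw [ht, run_nat_of_notMem m _ (by simp [recordBar, row, natWrites]), h4]
        set u := ((Prog.seq (recordBar x (.scalar .size)) (assignNat .numBars (.succ numBars))).run m
          s').setNat (.scratch 0) 0 0 (k + 1) with hu
        have hun : ∀ a, a ≠ .scratch 0 → a ≠ .numBars → u.nat a = t.nat a := fun a h0 h1 => by
          rw [hu, setNat_nat_of_ne h0]
          exact setNat_nat_of_ne h1
        have huc : ∀ l, u.col .repBar m l = t.col .repBar m l := fun _ => rfl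
        rw [min_eq_left (Nat.succ_le_of_lt hkn), hun .degBar (by simp) (by simp),
          hun .birthBar (by simp) (by simp), hun .deathBar (by simp) (by simp)]
        refine ⟨?_, fun l hl => ?_, fun j hj => ?_⟩
        · rw [hu, setNat_nat_of_ne (by simp)]
          change t.nat .numBars 0 0 + 1 = _
          rw [hb, Nat.add_assoc]
        · obtain ⟨g1, g2, g3, g4⟩ := r1 l (by omega)
          rw [huc, col_eq_of_real_eq g1, g2, g3, g4]
          exact h5 l hl
        · rcases Nat.lt_succ_iff_lt_or_eq.mp hj with h7 | rfl
          · obtain ⟨g1, g2, g3, g4⟩ := r1 (N + j) (by omega)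
            rw [huc, col_eq_of_real_eq g1, g2, g3, g4]
            exact h6 j h7
          · exact ⟨r2, r3, r4, r5⟩
      · rw [run, if_neg (by
          simp only [Test.Holds, NatExpr.eval]; rw [h1, nat' _ (by simp), hnH]; exact not_lt.mpr hkn)]
        rw [min_eq_right hkn] at h4 h6
        rw [min_eq_right (hkn.trans (Nat.le_succ k))]
        have hun : ∀ a, a ≠ .scratch 0 → (((Prog.skip).run m s').setNat (.scratch 0) 0 0 (k + 1)).nat a =
          s'.nat a := fun a h0 => setNat_nat_of_ne h0
        rw [hun .numBars (by simp), hun .degBar (by simp), hun .birthBar (by simp),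
          hun .deathBar (by simp)]
        exact ⟨h4, h5, h6⟩)
  rw [min_eq_right hnm] at key
  exact key

theorem isOutput_final {s : State} (h : MemInv F m s) : IsOutput F (final.run m s) := by
  obtain ⟨f1, f2, f3⟩ := final_spec rfl rfl h.numH_le h.size_eq
  have hb := h.bars.barList h.harm (d' := fun l => (final.run m s).nat .degBar l 0)
    (b' := fun l => (final.run m s).nat .birthBar l 0)
    (e' := fun l => (final.run m s).nat .deathBar l 0)
    (z' := fun l => (final.run m s).col .repBar m l)
    (fun l hl => (f2 l hl).2.1) (fun l hl => (f2 l hl).2.2.1) (fun l hl => (f2 l hl).2.2.2)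
    (fun l hl => (f2 l hl).1) (fun j hj => (f3 j hj).2.1) (fun j hj => (f3 j hj).2.2.1)
    (fun j hj => (f3 j hj).2.2.2) (fun j hj => (f3 j hj).1)
  rw [← f1] at hb
  refine ⟨fun p => hb.isBarcode p, hb.isBarcode_all, ?_⟩
  rintro l p b d ⟨hl, rfl, rfl, rfl⟩
  exact hb.rep l hl

/-- The memory after `i` steps. -/
def stateAt (F : SimplexwiseFiltration m) : ℕ → State
  | 0 => inputState F
  | i + 1 => step.run m (stateAt F i)

theorem memInv_stateAt (F : SimplexwiseFiltration m) : ∀ {i : ℕ}, i ≤ m → MemInv F i (stateAt F i)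
  | 0, _ => memInv_inputState F
  | _ + 1, h => memInv_step h (memInv_stateAt F (Nat.le_of_succ_le h))

theorem exec_step (F : SimplexwiseFiltration m) (hi : i < m) :
    ∃ t ≤ 4 * step.coef * m ^ 2, Exec step.compile (stateAt F i) t (stateAt F (i + 1)) := by
  obtain ⟨t, ht, h⟩ := exec_compile step wellFormed_step size_notMem_step (stateAt F i)
    (memInv_stateAt F hi.le).size_eq
  refine ⟨t, ht.trans ?_, h⟩
  rw [depth_step, mul_comm 4, mul_assoc]
  -- From i < m follows m ≥ 1, hence (m + 1)² ≤ 4 m².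
  exact Nat.mul_le_mul le_rfl (by nlinarith)

/-- The test for a further insertion. -/
abbrev unfinished : Test :=
  .natLt (.get .iter (.const 0) (.const 0)) (.get .size (.const 0) (.const 0))

/-- Induction on the number k of insertions still to come. Each round adds 7 for its test, and the
last, failing test costs 7 more. -/
theorem exec_loop (F : SimplexwiseFiltration m) : ∀ {k : ℕ}, k ≤ m →
    ∃ t ≤ k * (4 * step.coef * m ^ 2 + 7) + 7,
      Exec (.loop unfinished step.compile) (stateAt F (m - k)) t (stateAt F m)
  | 0, _ => ⟨7, by omega, .loop_false (b := unfinished) fun h => by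
      have h1 := memInv_stateAt F (le_refl m)
      simp only [Test.Holds, NatExpr.eval, Nat.sub_zero] at h
      rw [h1.iter_eq, h1.size_eq] at h
      exact lt_irrefl m h⟩
  | k + 1, hk => by
      obtain ⟨t, ht, h⟩ := exec_loop F (Nat.le_of_succ_le hk)
      obtain ⟨t', ht', h'⟩ := exec_step F (i := m - (k + 1)) (by omega)
      rw [show m - (k + 1) + 1 = m - k by omega] at h'
      refine ⟨7 + t' + t, ?_, .loop_true (b := unfinished) ?_ h' h⟩
      · rw [Nat.succ_mul]; omega
      · have h1 := memInv_stateAt F (i := m - (k + 1)) (Nat.sub_le _ _)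
        simp only [Test.Holds, NatExpr.eval]
        rw [h1.iter_eq, h1.size_eq]
        omega

theorem exec_mainProgram (F : SimplexwiseFiltration m) :
    ∃ t ≤ (4 * (step.coef + final.coef) + 14) * (m ^ 3 + 1),
      Exec (mainProgram step.compile final.compile) (inputState F) t
        (final.run m (stateAt F m)) := by
  obtain ⟨t, ht, h⟩ := exec_loop F (le_refl m)
  obtain ⟨t', ht', h'⟩ := exec_compile final wellFormed_final size_notMem_final (stateAt F m)
    (memInv_stateAt F (le_refl m)).size_eq
  rw [Nat.sub_self] at h
  refine ⟨t + t', ?_, .seq h h'⟩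
  rw [depth_final] at ht'
  have h1 : m ≤ m ^ 3 := Nat.le_self_pow (by norm_num) m
  -- The final step is also of nesting depth 2; the summand 1 takes care of the empty filtration.
  have h2 : (m + 1) ^ 2 ≤ 4 * (m ^ 3 + 1) := by
    rcases Nat.eq_zero_or_pos m with rfl | hm
    · norm_num
    · have : m ^ 2 ≤ m ^ 3 := Nat.pow_le_pow_right hm (by norm_num)
      nlinarith
  have h3 := ht'.trans (Nat.mul_le_mul (le_refl final.coef) h2)
  calc t + t' ≤ (m * (4 * step.coef * m ^ 2 + 7) + 7) + final.coef * (4 * (m ^ 3 + 1)) :=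
        Nat.add_le_add ht h3
    _ = 4 * step.coef * m ^ 3 + 7 * m + 7 + 4 * final.coef * (m ^ 3 + 1) := by ring
    _ ≤ 4 * step.coef * (m ^ 3 + 1) + 14 * (m ^ 3 + 1) + 4 * final.coef * (m ^ 3 + 1) := by
        have : 4 * step.coef * m ^ 3 ≤ 4 * step.coef * (m ^ 3 + 1) :=
          Nat.mul_le_mul le_rfl (Nat.le_succ _)
        omega
    _ = (4 * (step.coef + final.coef) + 14) * (m ^ 3 + 1) := by ring

end Algorithm

end
end HarmonicBarcode

theorem mainTheorem3 :
    ∃ (step final : HarmonicBarcode.Cmd) (C : ℕ),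
      ∀ (m : ℕ) (F : HarmonicBarcode.SimplexwiseFiltration m),
        (∃ s : ℕ → HarmonicBarcode.State,
          s 0 = HarmonicBarcode.inputState F ∧
          (∀ i ≤ m, HarmonicBarcode.Maintained F i (s i)) ∧
          ∀ i < m, ∃ t ≤ C * m ^ 2, HarmonicBarcode.Exec step (s i) t (s (i + 1))) ∧
        ∃ (T : ℕ) (out : HarmonicBarcode.State),
          HarmonicBarcode.Exec (HarmonicBarcode.mainProgram step final)
            (HarmonicBarcode.inputState F) T out ∧
          T ≤ C * (m ^ 3 + 1) ∧
          HarmonicBarcode.IsOutput F out := by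
  open HarmonicBarcode Algorithm in
  refine ⟨step.compile, final.compile, 4 * (step.coef + final.coef) + 14, fun m F =>
    ⟨⟨stateAt F, rfl, fun i hi => (memInv_stateAt F hi).maintained, fun i hi => ?_⟩, ?_⟩⟩
  · obtain ⟨t, ht, h⟩ := HarmonicBarcode.Algorithm.exec_step F hi
    exact ⟨t, ht.trans (Nat.mul_le_mul_right _ (by omega)), h⟩
  · obtain ⟨t, ht, h⟩ := HarmonicBarcode.Algorithm.exec_mainProgram F
    exact ⟨t, _, h, ht, HarmonicBarcode.Algorithm.isOutput_final
      (HarmonicBarcode.Algorithm.memInv_stateAt F le_rfl)⟩
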